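/- Consider the one-dimensional Dirac–Klein–Gordon system on $\mathbb{R}^{1+1}$, \[ \left(-i\gamma^0\partial_t - i\gamma^1\partial_x + M\right)\psi = \phi\,\psi, \qquad \left(\partial_t^2-\partial_x^2+m^2\right)\phi = \psi^*\gamma^0\psi \qquad (t,x\in\mathbb{R}), \] with initial condition $\psi(0,x)=\psi_0(x)$, $\phi(0,x)=\phi_0(x)$, $\partial_t\phi(0,x)=\phi_1(x)$, for unknowns $\psi:\mathbb{R}^{1+1}\to\mathbb{C}^2$ and $\phi:\mathbb{R}^{1+1}\to\mathbb{R}$, where $M,m\ge 0$ are constants and $\gamma^0=\begin{pmatrix}0&1\\1&0\end{pmatrix}$, $\gamma^1=\begin{pmatrix}0&-1\\1&0\end{pmatrix}$. For $\sigma>0$ and $s\in\mathbb{R}$ let $G^{\sigma,s}$ be the space of all $f\in L^2(\mathbb{R})$ with \[ \|f\|_{G^{\sigma,s}}=\left\|e^{\sigma|\xi|}(1+|\xi|^2)^{s/2}\,\widehat f(\xi)\right\|_{L^2_\xi}<\infty, \qquad \widehat f(\xi)=\int_{\mathbb{R}}e^{-ix\xi}f(x)\,dx . \] Let $M,m\ge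 0$, $\sigma_0>0$ and $(r,s)\in\mathbb{R}^2$. Then for any data \[ (\psi_0,\phi_0,\phi_1)\in G^{\sigma_0,s}(\mathbb{R};\mathbb{C}^2)\times G^{\sigma_0,r}(\mathbb{R};\mathbb{R})\times G^{\sigma_0,r-1}(\mathbb{R};\mathbb{R}) \] the Cauchy problem has a unique smooth solution $(\psi,\phi)$ on all of $\mathbb{R}^{1+1}$, and there is a function $\sigma:\mathbb{R}\to(0,\infty)$ such that \[ (\psi,\phi,\partial_t\phi)(t)\in G^{\sigma(t),s}\times G^{\sigma(t),r}\times G^{\sigma(t),r-1}\qquad\text{for all } t\in\mathbb{R}, \] and \[ \sigma(t)\ge \frac{c}{t^4}\qquad\text{for all } |t|\ge T_0, \] where the constants $c>0$ and $T_0>0$ depend only on $m$, $M$, $\sigma_0$, $r$, $s$ and on an upper bound $R$ for the norm $\|\psi_0\|_{G^{\sigma_0,s}}+\|\phi_0\|_{G^{\sigma_0,r}}+\|\phi_1\|_{G^{\sigma_0,r-1}}$ of the data. -/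

import Mathlib

open MeasureTheory FourierTransform
open scoped ContDiff

noncomputable section

/-- The values of a Dirac spinor: `ℂ²` with its Hermitian norm. -/
abbrev Spinor : Type := EuclideanSpace ℂ (Fin 2)

/-- The Dirac matrix `γ⁰`. -/
def diracGamma0 : Matrix (Fin 2) (Fin 2) ℂ := !![0, 1; 1, 0]

/-- The Dirac matrix `γ¹`. -/
def diracGamma1 : Matrix (Fin 2) (Fin 2) ℂ := !![0, -1; 1, 0]

section Gevrey

variable {F : Type*} [NormedAddCommGroup F] [InnerProductSpace ℂ F] [CompleteSpace F]

/-- The (Plancherel) Fourier transform `f̂(ξ) = ∫ e^{-i x ξ} f(x) dx` of a square-integrable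
function on the line, as a function defined up to null sets. Mathlib's transform has the kernel
`e^{-2π i x η}`, whence the substitution `η = ξ / (2π)`. -/
def l2Fourier (f : ℝ → F) (hf : MemLp f 2 (volume : Measure ℝ)) (ξ : ℝ) : F :=
  (𝓕 (hf.toLp f) : Lp F 2 (volume : Measure ℝ)) (ξ / (2 * Real.pi))

/-- The function `ξ ↦ e^{σ|ξ|} ⟨ξ⟩^s f̂(ξ)`, where `⟨ξ⟩ = (1 + |ξ|²)^{1/2}`. -/
def gevreyWeighted (σ s : ℝ) (f : ℝ → F) (hf : MemLp f 2 (volume : Measure ℝ)) (ξ : ℝ) : F :=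
  (Real.exp (σ * |ξ|) * Real.sqrt (1 + |ξ| ^ 2) ^ s) • l2Fourier f hf ξ

/-- Membership in the Gevrey space
`G^{σ,s} = {f ∈ L² : e^{σ|ξ|} ⟨ξ⟩^s f̂ ∈ L²}`, for `σ > 0` and `s ∈ ℝ`. -/
def MemGevrey (σ s : ℝ) (f : ℝ → F) : Prop :=
  ∃ hf : MemLp f 2 (volume : Measure ℝ),
    MemLp (gevreyWeighted σ s f hf) 2 (volume : Measure ℝ)

open Classical in
/-- The norm `‖f‖_{G^{σ,s}} = ‖e^{σ|ξ|} ⟨ξ⟩^s f̂‖_{L²}` (meaningful for `f ∈ G^{σ,s}`). -/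
def gevreyNorm (σ s : ℝ) (f : ℝ → F) : ℝ :=
  if hf : MemLp f 2 (volume : Measure ℝ) then
    (eLpNorm (gevreyWeighted σ s f hf) 2 (volume : Measure ℝ)).toReal
  else 0

end Gevrey

/-- A real-valued function, regarded as a complex-valued one. -/
def complexify (f : ℝ → ℝ) : ℝ → ℂ := fun x => (f x : ℂ)

/-- `(ψ, φ)` is a smooth global solution on `ℝ^{1+1}`, written as functions of `t` and then `x`, of
the Dirac–Klein–Gordon system with Dirac mass `M` and Klein–Gordon mass `m`, with initial data
`(ψ₀, φ₀, φ₁)`. The data are functions modulo null sets, so they are attained almost everywhere. -/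
structure IsDKGSolution (M m : ℝ) (ψ₀ : ℝ → Spinor) (φ₀ φ₁ : ℝ → ℝ)
    (ψ : ℝ → ℝ → Spinor) (φ : ℝ → ℝ → ℝ) : Prop where
  smooth_ψ : ContDiff ℝ ∞ (fun p : ℝ × ℝ => ψ p.1 p.2)
  smooth_φ : ContDiff ℝ ∞ (fun p : ℝ × ℝ => φ p.1 p.2)
  /-- `(-i γ⁰ ∂ₜ - i γ¹ ∂ₓ + M) ψ = φ ψ` -/
  dirac : ∀ t x : ℝ,
    (-Complex.I) • Matrix.toEuclideanCLM (𝕜 := ℂ) diracGamma0 (deriv (fun τ => ψ τ x) t)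
      - Complex.I • Matrix.toEuclideanCLM (𝕜 := ℂ) diracGamma1 (deriv (fun y => ψ t y) x)
      + (M : ℂ) • ψ t x = (φ t x : ℂ) • ψ t x
  /-- `(∂ₜ² - ∂ₓ² + m²) φ = ψ* γ⁰ ψ` -/
  kleinGordon : ∀ t x : ℝ,
    ((iteratedDeriv 2 (fun τ => φ τ x) t - iteratedDeriv 2 (fun y => φ t y) x
        + m ^ 2 * φ t x : ℝ) : ℂ)
      = inner ℂ (ψ t x) (Matrix.toEuclideanCLM (𝕜 := ℂ) diracGamma0 (ψ t x))
  initial_ψ : ∀ᵐ x : ℝ, ψ 0 x = ψ₀ x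
  initial_φ : ∀ᵐ x : ℝ, φ 0 x = φ₀ x
  initial_dtφ : ∀ᵐ x : ℝ, deriv (fun τ => φ τ x) 0 = φ₁ x

end

/-!
# Global solutions of the one-dimensional Dirac–Klein–Gordon system with analytic data

By a Paley–Wiener argument, the Gevrey space `G^{σ,s}` consists, up to an arbitrarily small loss in
`σ`, of the restrictions to the real line of holomorphic functions in the strip `|Im z| < σ` that are
bounded in `L²` on horizontal lines (`MemGevrey.exists_extension`, `memGevrey_of_strip`). The theorem
thus asks for a solution in a strip, and for the width of this strip as a function of time.

In terms of the components `u = ψ₀`, `v = ψ₁` of the spinor and of `p = (∂ₜ + ∂ₓ) φ`,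
`q = (∂ₜ - ∂ₓ) φ` the system is diagonal and of first order, with real speeds:
`(∂ₜ + ∂ₓ) u = i (φ - M) v`, `(∂ₜ - ∂ₓ) v = i (φ - M) u`, `2 ∂ₜ φ = p + q`,
`(∂ₜ - ∂ₓ) p = (∂ₜ + ∂ₓ) q = u* v + v* u - m² φ`. With `u*(t, z)` read as the conjugate of
`u(t, conj z)` it makes sense in the strip, and its characteristics stay on horizontal lines. There
the equations look like those on the real line, except that `φ` is complex.

* The growth of the charge `∫ |u|² + |v|²` on a horizontal line is governed by `Im φ` alone
  (`dirac_charge_bound`). If `|Im φ| ≤ η` with `e^{2ηT} ≤ 2`, then the charge, and its flux through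
  characteristics, at most double up to time `T`.
* The source of the Klein–Gordon equation is then bounded in `L¹` on lines, and as the Riemann
  function `J₀(m √(τ² - y²))` is bounded, `|φ| ≲ T²` (`kleinGordon_bound`). Integrating along
  characteristics and using the fluxes gives `|u|, |v| ≲ T^{5/2}` (`DiracSol.norm_le`), and once more
  `|p|, |q|, |∂_z φ| ≲ T³` (`norm_mild_source_le`).
* As `φ` is real on the real line, `|Im φ| ≲ σ T³` in the strip of half-width `σ`
  (`abs_im_le_of_deriv_le`). So the assumption `|Im φ| ≤ η ~ T⁻¹` reproduces itself if `σ ≲ T⁻⁴`.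

These bounds are used to set up an iteration. Solving the linear Dirac equation with a potential, and
then the Klein–Gordon equation with the resulting source, maps the set of potentials that obey the
above bounds to itself (`exists_step`), and is a contraction for the norm with weight `e^{-λ|t|}`,
`λ` large. The fixed point solves the system up to time `T` in a strip of width `c T⁻⁴`, for every
`T ≥ 1` (`exists_dkgStripSol`); an energy estimate puts it in `L²` on lines (`strip_energy`).

The solutions for different `T` agree on the real line by finite speed of propagation
(`IsLineSol.unique`), which also gives uniqueness, and they are smooth because the equations express
time derivatives through holomorphic functions (`DKGStripSol.reg`). Hence they fit together to a
global smooth solution (`exists_global_fields`).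
-/

/-! ### The Fourier transform on `L¹ ∩ L²` -/

section FourierL2
variable {F : Type*} [NormedAddCommGroup F] [InnerProductSpace ℂ F] [CompleteSpace F]

/-- The Plancherel transform agrees with the Fourier integral on `L¹ ∩ L²`: both have the same
pairing with every test function. -/
theorem l2_fourier_ae_eq {h : ℝ → F} (h1 : Integrable h) (h2 : MemLp h 2 (volume : Measure ℝ)) :
    ((𝓕 (h2.toLp h) : Lp F 2 (volume : Measure ℝ)) : ℝ → F) =ᵐ[volume] 𝓕 h := by
  have hcont : Continuous (𝓕 h) :=
    VectorFourier.fourierIntegral_continuous Real.continuous_fourierChar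
      (innerSL ℝ).continuous₂ h1
  refine ae_eq_of_integral_contDiff_smul_eq
    ((Lp.memLp _).locallyIntegrable (by norm_num)) hcont.locallyIntegrable ?_
  intro g g_smooth g_cpt
  have hg₁ : HasCompactSupport (Complex.ofRealCLM ∘ g) := g_cpt.comp_left rfl
  have hg₂ : ContDiff ℝ ∞ (Complex.ofRealCLM ∘ g) := by fun_prop
  set G : SchwartzMap ℝ ℂ := hg₁.toSchwartzMap hg₂ with hG
  have hGv : ∀ x, G x = (g x : ℂ) := fun x => by simp [hG]
  have e1 : ∫ x, G x • (𝓕 (h2.toLp h) : Lp F 2 (volume : Measure ℝ)) x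
      = ∫ x, (𝓕 G) x • h x := by
    have := congrArg (fun T => T G) (Lp.fourier_toTemperedDistribution_eq (h2.toLp h))
    simp only [TemperedDistribution.fourier_apply, Lp.toTemperedDistribution_apply] at this
    rw [← this]
    refine integral_congr_ae ?_
    filter_upwards [h2.coeFn_toLp] with x hx
    rw [hx]
  have e2 : ∫ x, (𝓕 G) x • h x = ∫ x, G x • 𝓕 h x := by
    have := VectorFourier.integral_fourierIntegral_smul_eq_flip (μ := (volume : Measure ℝ))
      (ν := (volume : Measure ℝ)) (L := innerₗ ℝ) (f := (G : ℝ → ℂ)) (g := h)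
      Real.continuous_fourierChar (innerSL ℝ).continuous₂ G.integrable h1
    rw [flip_innerₗ] at this
    exact this
  have e3 := e1.trans e2
  simp only [hGv] at e3
  simpa using e3

theorem l2_fourierInv_ae_eq {h : ℝ → F} (h1 : Integrable h)
    (h2 : MemLp h 2 (volume : Measure ℝ)) :
    ((𝓕⁻ (h2.toLp h) : Lp F 2 (volume : Measure ℝ)) : ℝ → F) =ᵐ[volume] 𝓕⁻ h := by
  have hcont : Continuous (𝓕⁻ h) := by
    rw [Real.fourierInv_eq_fourier_comp_neg]
    exact VectorFourier.fourierIntegral_continuous Real.continuous_fourierChar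
      (innerSL ℝ).continuous₂ h1.comp_neg
  refine ae_eq_of_integral_contDiff_smul_eq
    ((Lp.memLp _).locallyIntegrable (by norm_num)) hcont.locallyIntegrable ?_
  intro g g_smooth g_cpt
  have hg₁ : HasCompactSupport (Complex.ofRealCLM ∘ g) := g_cpt.comp_left rfl
  have hg₂ : ContDiff ℝ ∞ (Complex.ofRealCLM ∘ g) := by fun_prop
  set G : SchwartzMap ℝ ℂ := hg₁.toSchwartzMap hg₂ with hG
  have hGv : ∀ x, G x = (g x : ℂ) := fun x => by simp [hG]
  have e1 : ∫ x, G x • (𝓕⁻ (h2.toLp h) : Lp F 2 (volume : Measure ℝ)) x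
      = ∫ x, (𝓕⁻ G) x • h x := by
    have := congrArg (fun T => T G) (Lp.fourierInv_toTemperedDistribution_eq (h2.toLp h))
    simp only [TemperedDistribution.fourierInv_apply, Lp.toTemperedDistribution_apply] at this
    rw [← this]
    refine integral_congr_ae ?_
    filter_upwards [h2.coeFn_toLp] with x hx
    rw [hx]
  have e2 : ∫ x, (𝓕⁻ G) x • h x = ∫ x, G x • 𝓕⁻ h x := by
    have := VectorFourier.integral_fourierIntegral_smul_eq_flip (μ := (volume : Measure ℝ))
      (ν := (volume : Measure ℝ)) (L := -innerₗ ℝ) (f := (G : ℝ → ℂ)) (g := h)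
      Real.continuous_fourierChar (by
        have : Continuous fun p : ℝ × ℝ => -(inner ℝ p.1 p.2) := by fun_prop
        simpa using this) G.integrable h1
    have hfl : (-innerₗ ℝ : ℝ →ₗ[ℝ] ℝ →ₗ[ℝ] ℝ).flip = -innerₗ ℝ := by
      ext; simp
    rw [hfl] at this
    simp only [SchwartzMap.fourierInv_coe]; exact this
  have e3 := e1.trans e2
  simp only [hGv] at e3
  simpa using e3

end FourierL2

/-! ### Fourier–Laplace integrals in a strip -/

/-- The horizontal strip `{z : |Im z| < σ}`. -/
def strip (σ : ℝ) : Set ℂ := {z | |z.im| < σ}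

theorem isOpen_strip (σ : ℝ) : IsOpen (strip σ) :=
  isOpen_lt (by fun_prop) continuous_const

/-- Polynomial weights, of either sign, cost an arbitrarily small part of the exponential. The
fourth power leaves room for a derivative and for Cauchy–Schwarz against `(1 + η²)⁻¹`. -/
theorem weight_le_exp {δ : ℝ} (hδ : 0 < δ) (s : ℝ) :
    ∃ C : ℝ, 0 < C ∧ ∀ ξ : ℝ, (1 + |ξ|) ^ 4 * Real.sqrt (1 + |ξ| ^ 2) ^ s
      ≤ C * Real.exp (δ * |ξ|) := by
  obtain ⟨n, hn⟩ := exists_nat_ge |s|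
  refine ⟨(n + 4).factorial / δ ^ (n + 4) * Real.exp δ, by positivity, fun ξ => ?_⟩
  have hx : 0 ≤ |ξ| := abs_nonneg ξ
  have h1 : Real.sqrt (1 + |ξ| ^ 2) ≤ 1 + |ξ| :=
    Real.sqrt_le_iff.2 ⟨by positivity, by nlinarith⟩
  have h2 : 1 ≤ Real.sqrt (1 + |ξ| ^ 2) := by
    rw [Real.one_le_sqrt]; nlinarith [sq_nonneg |ξ|]
  have h3 : Real.sqrt (1 + |ξ| ^ 2) ^ s ≤ (1 + |ξ|) ^ n := by
    calc Real.sqrt (1 + |ξ| ^ 2) ^ s ≤ Real.sqrt (1 + |ξ| ^ 2) ^ (n : ℝ) :=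
          Real.rpow_le_rpow_of_exponent_le h2 ((le_abs_self s).trans hn)
      _ = Real.sqrt (1 + |ξ| ^ 2) ^ n := Real.rpow_natCast _ _
      _ ≤ _ := pow_le_pow_left₀ (by positivity) h1 n
  have h4 := Real.pow_div_factorial_le_exp (δ * (1 + |ξ|)) (by positivity) (n + 4)
  have h5 : Real.exp (δ * (1 + |ξ|)) = Real.exp δ * Real.exp (δ * |ξ|) := by
    rw [← Real.exp_add]; ring_nf
  rw [h5, div_le_iff₀ (by positivity), mul_pow] at h4
  calc (1 + |ξ|) ^ 4 * Real.sqrt (1 + |ξ| ^ 2) ^ s ≤ (1 + |ξ|) ^ 4 * (1 + |ξ|) ^ n := by gcongr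
    _ = δ ^ (n + 4) * (1 + |ξ|) ^ (n + 4) / δ ^ (n + 4) := by field_simp; ring
    _ ≤ Real.exp δ * Real.exp (δ * |ξ|) * (n + 4).factorial / δ ^ (n + 4) := by gcongr
    _ = _ := by ring

section Laplace
variable {F : Type*} [NormedAddCommGroup F] [InnerProductSpace ℂ F]

/-- The Fourier–Laplace integral `∫ e^{2π i η z} g(η) dη`, for complex `z`. -/
noncomputable def fourierLaplace (g : ℝ → F) (z : ℂ) : F :=
  ∫ η : ℝ, Complex.exp (2 * Real.pi * Complex.I * η * z) • g η

theorem norm_exp_laplace (η : ℝ) (z : ℂ) :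
    ‖Complex.exp (2 * Real.pi * Complex.I * η * z)‖ = Real.exp (-(2 * Real.pi * η * z.im)) := by
  rw [Complex.norm_exp]; congr 1; simp

theorem norm_exp_laplace_le {σ : ℝ} (η : ℝ) {z : ℂ} (hz : |z.im| ≤ σ) :
    ‖Complex.exp (2 * Real.pi * Complex.I * η * z)‖ ≤ Real.exp (2 * Real.pi * σ * |η|) := by
  rw [norm_exp_laplace]
  refine Real.exp_le_exp.2 ?_
  have : -(η * z.im) ≤ |η| * |z.im| := by rw [← abs_mul]; exact neg_le_abs _
  have h2 : |η| * |z.im| ≤ |η| * σ := by gcongr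
  have := Real.pi_pos
  nlinarith

theorem aestronglyMeasurable_laplace {g : ℝ → F} (hg : AEStronglyMeasurable g) (z : ℂ) :
    AEStronglyMeasurable fun η : ℝ => Complex.exp (2 * Real.pi * Complex.I * η * z) • g η :=
  (by fun_prop : Continuous fun η : ℝ =>
    Complex.exp (2 * Real.pi * Complex.I * η * z)).aestronglyMeasurable.smul hg

theorem integrable_laplace {σ : ℝ} {g : ℝ → F} (hg : AEStronglyMeasurable g)
    (hi : Integrable fun η => Real.exp (2 * Real.pi * σ * |η|) * ‖g η‖) {z : ℂ}
    (hz : |z.im| ≤ σ) :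
    Integrable fun η : ℝ => Complex.exp (2 * Real.pi * Complex.I * η * z) • g η := by
  refine hi.mono' (aestronglyMeasurable_laplace hg z) (Filter.Eventually.of_forall fun η => ?_)
  rw [norm_smul]
  gcongr
  exact norm_exp_laplace_le η hz

theorem norm_fourierLaplace_le {σ : ℝ} {g : ℝ → F}
    (hi : Integrable fun η => Real.exp (2 * Real.pi * σ * |η|) * ‖g η‖) {z : ℂ}
    (hz : |z.im| ≤ σ) :
    ‖fourierLaplace g z‖ ≤ ∫ η, Real.exp (2 * Real.pi * σ * |η|) * ‖g η‖ := by
  refine norm_integral_le_of_norm_le hi (Filter.Eventually.of_forall fun η => ?_)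
  rw [norm_smul]
  gcongr
  exact norm_exp_laplace_le η hz

theorem hasDerivAt_fourierLaplace [CompleteSpace F] {σ : ℝ} {g : ℝ → F}
    (hg : AEStronglyMeasurable g)
    (hi : Integrable fun η => Real.exp (2 * Real.pi * σ * |η|) * ‖g η‖)
    (hi' : Integrable fun η => Real.exp (2 * Real.pi * σ * |η|) *
      ‖(2 * Real.pi * Complex.I * (η : ℂ)) • g η‖) {z : ℂ} (hz : z ∈ strip σ) :
    HasDerivAt (fourierLaplace g)
      (fourierLaplace (fun η => (2 * Real.pi * Complex.I * (η : ℂ)) • g η) z) z := by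
  have hm : AEStronglyMeasurable fun η : ℝ => (2 * Real.pi * Complex.I * (η : ℂ)) • g η :=
    (by fun_prop : Continuous fun η : ℝ =>
      (2 * Real.pi * Complex.I * (η : ℂ))).aestronglyMeasurable.smul hg
  refine (hasDerivAt_integral_of_dominated_loc_of_deriv_le (s := strip σ)
    (F := fun (z : ℂ) (η : ℝ) => Complex.exp (2 * Real.pi * Complex.I * η * z) • g η)
    (F' := fun (z : ℂ) (η : ℝ) => Complex.exp (2 * Real.pi * Complex.I * η * z) •
      ((2 * Real.pi * Complex.I * (η : ℂ)) • g η))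
    ((isOpen_strip σ).mem_nhds hz)
    (Filter.Eventually.of_forall fun z => aestronglyMeasurable_laplace hg z)
    (integrable_laplace hg hi (le_of_lt hz)) (aestronglyMeasurable_laplace hm z)
    (Filter.Eventually.of_forall fun η w hw => ?_) hi'
    (Filter.Eventually.of_forall fun η w hw => ?_)).2
  · rw [norm_smul]
    gcongr
    exact norm_exp_laplace_le η (le_of_lt hw)
  · have h : HasDerivAt (fun z : ℂ => Complex.exp (2 * Real.pi * Complex.I * η * z))
        (Complex.exp (2 * Real.pi * Complex.I * η * w) * (2 * Real.pi * Complex.I * η)) w := by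
      have := ((hasDerivAt_id w).const_mul (2 * Real.pi * Complex.I * (η : ℂ))).cexp
      simpa using this
    simpa [smul_smul] using h.smul_const (g η)

/-- On the line `Im z = y` the Fourier–Laplace integral is the inverse transform of
`e^{-2π y η} g(η)`, so that Plancherel applies. -/
theorem fourierLaplace_eq_fourierInv (g : ℝ → F) (x y : ℝ) :
    fourierLaplace g (x + y * Complex.I)
      = 𝓕⁻ (fun η : ℝ => (Real.exp (-(2 * Real.pi * y * η)) : ℂ) • g η) x := by
  rw [Real.fourierInv_eq', fourierLaplace]
  refine integral_congr_ae (Filter.Eventually.of_forall fun η => ?_)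
  simp only [smul_smul, Complex.ofReal_exp, ← Complex.exp_add]
  congr 2
  simp
  linear_combination (2 * (Real.pi : ℂ) * η * y) * Complex.I_sq

theorem integral_norm_sq_eq_norm_sq (f : Lp F 2 (volume : Measure ℝ)) :
    ∫ x, ‖f x‖ ^ 2 = ‖f‖ ^ 2 := by
  have h := @inner_self_eq_norm_sq ℂ _ _ _ _ f
  rw [← h, L2.inner_def, ← integral_re (𝕜 := ℂ) (L2.integrable_inner (𝕜 := ℂ) f f)]
  refine integral_congr_ae (Filter.Eventually.of_forall fun x => ?_)
  exact (inner_self_eq_norm_sq (𝕜 := ℂ) (f x)).symm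

theorem fourierInv_l2 [CompleteSpace F] {h : ℝ → F} (h1 : Integrable h)
    (h2 : MemLp h 2 (volume : Measure ℝ)) :
    (Integrable fun x => ‖𝓕⁻ h x‖ ^ 2) ∧ ∫ x, ‖𝓕⁻ h x‖ ^ 2 = ∫ x, ‖h x‖ ^ 2 := by
  have hae := l2_fourierInv_ae_eq h1 h2
  have hn : ‖(𝓕⁻ (h2.toLp h) : Lp F 2 (volume : Measure ℝ))‖ = ‖h2.toLp h‖ :=
    (Lp.fourierTransformₗᵢ ℝ F).symm.norm_map _
  have hm : MemLp (𝓕⁻ h) 2 (volume : Measure ℝ) := (Lp.memLp _).ae_eq hae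
  refine ⟨(memLp_two_iff_integrable_sq_norm hm.1).1 hm, ?_⟩
  calc ∫ x, ‖𝓕⁻ h x‖ ^ 2
      = ∫ x, ‖(𝓕⁻ (h2.toLp h) : Lp F 2 (volume : Measure ℝ)) x‖ ^ 2 :=
        integral_congr_ae (hae.symm.mono fun x hx => by simp only [hx])
    _ = ∫ x, ‖(h2.toLp h) x‖ ^ 2 := by
        rw [integral_norm_sq_eq_norm_sq, integral_norm_sq_eq_norm_sq, hn]
    _ = _ := integral_congr_ae (h2.coeFn_toLp.mono fun x hx => by simp only [hx])

theorem fourierLaplace_l2 [CompleteSpace F] {σ : ℝ} {g : ℝ → F} (hg : AEStronglyMeasurable g)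
    (hi : Integrable fun η => Real.exp (2 * Real.pi * σ * |η|) * ‖g η‖)
    (hi2 : Integrable fun η => (Real.exp (2 * Real.pi * σ * |η|) * ‖g η‖) ^ 2)
    {y : ℝ} (hy : |y| ≤ σ) :
    (Integrable fun x : ℝ => ‖fourierLaplace g (x + y * Complex.I)‖ ^ 2) ∧
      ∫ x : ℝ, ‖fourierLaplace g (x + y * Complex.I)‖ ^ 2
        ≤ ∫ η, (Real.exp (2 * Real.pi * σ * |η|) * ‖g η‖) ^ 2 := by
  set h : ℝ → F := fun η : ℝ => (Real.exp (-(2 * Real.pi * y * η)) : ℂ) • g η with hh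
  have hm : AEStronglyMeasurable h :=
    (by fun_prop : Continuous fun η : ℝ =>
      (Real.exp (-(2 * Real.pi * y * η)) : ℂ)).aestronglyMeasurable.smul hg
  have hle : ∀ η, ‖h η‖ ≤ Real.exp (2 * Real.pi * σ * |η|) * ‖g η‖ := by
    intro η
    have := norm_exp_laplace_le (σ := σ) η (z := (y : ℂ) * Complex.I) (by simpa using hy)
    rw [norm_exp_laplace] at this
    simp only [hh, norm_smul, Complex.norm_real, Real.norm_eq_abs, Real.abs_exp]
    refine mul_le_mul_of_nonneg_right (le_trans (le_of_eq ?_) this) (norm_nonneg _)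
    congr 1
    simp
    ring
  have h1 : Integrable h := hi.mono' hm (Filter.Eventually.of_forall hle)
  have h2i : Integrable fun η => ‖h η‖ ^ 2 := by
    refine hi2.mono' (hm.norm.pow 2) (Filter.Eventually.of_forall fun η => ?_)
    rw [Real.norm_of_nonneg (by positivity)]
    gcongr
    exact hle η
  have h2 : MemLp h 2 (volume : Measure ℝ) := (memLp_two_iff_integrable_sq_norm hm).2 h2i
  obtain ⟨a, b⟩ := fourierInv_l2 h1 h2
  simp only [fourierLaplace_eq_fourierInv]
  refine ⟨a, b.le.trans ?_⟩
  refine integral_mono h2i hi2 fun η => ?_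
  have := hle η
  gcongr

end Laplace

/-! ### From Gevrey spaces to holomorphic functions -/

section PaleyWiener
variable {F : Type*} [NormedAddCommGroup F] [InnerProductSpace ℂ F] [CompleteSpace F]

theorem gevrey_weight_bound {σ₀ σ₁ : ℝ} (h : σ₁ < σ₀) (s : ℝ) :
    ∃ C : ℝ, 0 < C ∧ ∀ ξ : ℝ, (1 + |ξ|) ^ 4 * Real.exp (σ₁ * |ξ|)
      ≤ C * (Real.exp (σ₀ * |ξ|) * Real.sqrt (1 + |ξ| ^ 2) ^ s) := by
  obtain ⟨C, hC, hb⟩ := weight_le_exp (sub_pos.2 h) (-s)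
  refine ⟨C, hC, fun ξ => ?_⟩
  have hp : 0 < Real.sqrt (1 + |ξ| ^ 2) := Real.sqrt_pos.2 (by positivity)
  have h1 := hb ξ
  rw [Real.rpow_neg hp.le, ← div_eq_mul_inv, div_le_iff₀ (by positivity)] at h1
  calc (1 + |ξ|) ^ 4 * Real.exp (σ₁ * |ξ|)
      ≤ (C * Real.exp ((σ₀ - σ₁) * |ξ|) * Real.sqrt (1 + |ξ| ^ 2) ^ s) * Real.exp (σ₁ * |ξ|) := by
        gcongr
    _ = _ := by
        have : Real.exp (σ₀ * |ξ|) = Real.exp ((σ₀ - σ₁) * |ξ|) * Real.exp (σ₁ * |ξ|) := by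
          rw [← Real.exp_add]; ring_nf
        rw [this]; ring

theorem integral_sq_le_gevreyNorm {σ s R : ℝ} {f : ℝ → F} (hf : MemLp f 2 (volume : Measure ℝ))
    (hw : MemLp (gevreyWeighted σ s f hf) 2 (volume : Measure ℝ)) (hR : gevreyNorm σ s f ≤ R) :
    Integrable (fun ξ => ‖gevreyWeighted σ s f hf ξ‖ ^ 2) ∧
      ∫ ξ, ‖gevreyWeighted σ s f hf ξ‖ ^ 2 ≤ R ^ 2 := by
  refine ⟨(memLp_two_iff_integrable_sq_norm hw.1).1 hw, ?_⟩
  have h1 : gevreyNorm σ s f = (∫ ξ, ‖gevreyWeighted σ s f hf ξ‖ ^ 2) ^ (2 : ℝ)⁻¹ := by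
    rw [gevreyNorm, dif_pos hf, hw.eLpNorm_eq_integral_rpow_norm (by norm_num) (by norm_num),
      ENNReal.toReal_ofReal (by positivity)]
    norm_num
  have h0 : 0 ≤ ∫ ξ, ‖gevreyWeighted σ s f hf ξ‖ ^ 2 := by positivity
  have h2 : ∫ ξ, ‖gevreyWeighted σ s f hf ξ‖ ^ 2 = gevreyNorm σ s f ^ 2 := by
    rw [h1, ← Real.rpow_natCast, ← Real.rpow_mul h0]; norm_num
  have h3 : 0 ≤ gevreyNorm σ s f := by rw [h1]; positivity
  rw [h2]
  gcongr

/-- Easy half of Paley–Wiener: an element of `G^{σ₀,s}` extends holomorphically to every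
narrower strip, with bounds that depend only on its norm. -/
theorem MemGevrey.exists_extension {σ₀ σ₁ : ℝ} (h₁ : 0 < σ₁) (h : σ₁ < σ₀) (s R : ℝ) :
    ∃ D : ℝ, 0 < D ∧ ∀ f : ℝ → F, MemGevrey σ₀ s f → gevreyNorm σ₀ s f ≤ R →
      ∃ g : ℂ → F, DifferentiableOn ℂ g (strip σ₁) ∧ (∀ᵐ x : ℝ, g x = f x) ∧
        (∀ z ∈ strip σ₁, ‖g z‖ ≤ D ∧ ‖deriv g z‖ ≤ D) ∧
        ∀ y : ℝ, |y| < σ₁ →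
          ((Integrable fun x : ℝ => ‖g (x + y * Complex.I)‖ ^ 2) ∧
            ∫ x : ℝ, ‖g (x + y * Complex.I)‖ ^ 2 ≤ D) ∧
          ((Integrable fun x : ℝ => ‖deriv g (x + y * Complex.I)‖ ^ 2) ∧
            ∫ x : ℝ, ‖deriv g (x + y * Complex.I)‖ ^ 2 ≤ D) := by
  obtain ⟨C, hC, hw⟩ := gevrey_weight_bound h s
  set E : ℝ := C ^ 2 * R ^ 2 + ∫ x : ℝ, (1 + x ^ 2)⁻¹ with hE
  have hE0 : 0 ≤ ∫ x : ℝ, (1 + x ^ 2)⁻¹ := integral_nonneg fun x => by positivity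
  refine ⟨E + 1, by positivity, fun f ⟨hf, hfw⟩ hR => ?_⟩
  obtain ⟨hi, hile⟩ := integral_sq_le_gevreyNorm hf hfw hR
  set k : Lp F 2 (volume : Measure ℝ) := 𝓕 (hf.toLp f) with hk
  set g : ℝ → F := fun η => k η with hg
  have hgm : AEStronglyMeasurable g := (Lp.memLp k).1
  have hpi : (0 : ℝ) < 2 * Real.pi := by positivity
  -- the weighted transform in the variable `η = ξ / 2π`
  set W : ℝ → ℝ := fun η => ‖gevreyWeighted σ₀ s f hf (2 * Real.pi * η)‖ ^ 2 with hW
  have hWi : Integrable W := hi.comp_mul_left' hpi.ne'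
  have hWle : ∫ η, W η ≤ R ^ 2 := by
    have := Measure.integral_comp_mul_left (fun ξ => ‖gevreyWeighted σ₀ s f hf ξ‖ ^ 2)
      (2 * Real.pi)
    rw [hW, this, smul_eq_mul, abs_of_pos (by positivity)]
    have h0 : 0 ≤ ∫ ξ, ‖gevreyWeighted σ₀ s f hf ξ‖ ^ 2 := by positivity
    have h1 : (2 * Real.pi)⁻¹ ≤ 1 := inv_le_one_of_one_le₀ (by linarith [Real.pi_gt_three])
    nlinarith
  set H : ℝ → ℝ := fun η => Real.exp (2 * Real.pi * σ₁ * |η|) * ((1 + 2 * Real.pi * |η|) * ‖g η‖)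
    with hH
  have hH0 : ∀ η, 0 ≤ H η := fun η => by positivity
  have hHm : AEStronglyMeasurable H :=
    (by fun_prop : Continuous fun η : ℝ =>
      Real.exp (2 * Real.pi * σ₁ * |η|)).aestronglyMeasurable.mul
      ((by fun_prop : Continuous fun η : ℝ => (1 + 2 * Real.pi * |η|)).aestronglyMeasurable.mul
        hgm.norm)
  have hHW : ∀ η, (H η * (1 + η ^ 2)) ^ 2 ≤ C ^ 2 * W η := by
    intro η
    have habs : |2 * Real.pi * η| = 2 * Real.pi * |η| := by rw [abs_mul, abs_of_pos hpi]
    have h1 := hw (2 * Real.pi * η)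
    rw [habs] at h1
    have e : gevreyWeighted σ₀ s f hf (2 * Real.pi * η)
        = (Real.exp (σ₀ * (2 * Real.pi * |η|))
          * Real.sqrt (1 + (2 * Real.pi * |η|) ^ 2) ^ s) • g η := by
      simp only [gevreyWeighted, l2Fourier, habs, hg, hk]
      congr 3
      field_simp
    rw [hW, ← mul_pow]
    rw [e, norm_smul, Real.norm_of_nonneg (by positivity)]
    have h2 : (1 + 2 * Real.pi * |η|) * (1 + η ^ 2) ≤ (1 + 2 * Real.pi * |η|) ^ 4 := by
      have hx : 0 ≤ |η| := abs_nonneg η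
      have h3 : |η| ≤ 2 * Real.pi * |η| := by nlinarith [Real.pi_gt_three]
      have h4 : 1 + η ^ 2 ≤ (1 + 2 * Real.pi * |η|) ^ 2 := by rw [← sq_abs η]; nlinarith
      have h5 : (1 + 2 * Real.pi * |η|) ^ 2 ≤ (1 + 2 * Real.pi * |η|) ^ 3 :=
        pow_le_pow_right₀ (by linarith) (by norm_num)
      calc _ ≤ (1 + 2 * Real.pi * |η|) * (1 + 2 * Real.pi * |η|) ^ 3 := by gcongr; linarith
        _ = _ := by ring
    refine pow_le_pow_left₀ (by positivity) ?_ 2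
    calc H η * (1 + η ^ 2) = ((1 + 2 * Real.pi * |η|) * (1 + η ^ 2))
          * Real.exp (σ₁ * (2 * Real.pi * |η|)) * ‖g η‖ := by simp only [hH]; ring_nf
      _ ≤ (1 + 2 * Real.pi * |η|) ^ 4 * Real.exp (σ₁ * (2 * Real.pi * |η|)) * ‖g η‖ := by gcongr
      _ ≤ (C * (Real.exp (σ₀ * (2 * Real.pi * |η|)) *
            Real.sqrt (1 + (2 * Real.pi * |η|) ^ 2) ^ s)) * ‖g η‖ :=
          mul_le_mul_of_nonneg_right h1 (norm_nonneg _)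
      _ = _ := by ring
  have hHW2 : ∀ η, H η ^ 2 ≤ C ^ 2 * W η := fun η => by
    refine le_trans ?_ (hHW η)
    have := hH0 η
    gcongr
    nlinarith [sq_nonneg η]
  have hHb : ∀ η, H η ≤ C ^ 2 * W η + (1 + η ^ 2)⁻¹ := fun η => by
    have h1 := hHW η
    have h2 : 0 < 1 + η ^ 2 := by positivity
    have h3 : H η = (H η * (1 + η ^ 2)) * (1 + η ^ 2)⁻¹ := by field_simp
    have h4 : (1 + η ^ 2)⁻¹ ≤ 1 := inv_le_one_of_one_le₀ (by nlinarith [sq_nonneg η])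
    have h5 : 0 < (1 + η ^ 2)⁻¹ := by positivity
    nlinarith [sq_nonneg (H η * (1 + η ^ 2) - (1 + η ^ 2)⁻¹), hH0 η]
  have hHi : Integrable H := ((hWi.const_mul (C ^ 2)).add integrable_inv_one_add_sq).mono' hHm
    (Filter.Eventually.of_forall fun η => by
      rw [Real.norm_of_nonneg (hH0 η)]; exact hHb η)
  have hH2i : Integrable fun η => H η ^ 2 := (hWi.const_mul (C ^ 2)).mono' (hHm.pow 2)
    (Filter.Eventually.of_forall fun η => by
      rw [Real.norm_of_nonneg (by positivity)]; exact hHW2 η)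
  have hHle : ∫ η, H η ≤ E := by
    calc ∫ η, H η ≤ ∫ η, (C ^ 2 * W η + (1 + η ^ 2)⁻¹) :=
          integral_mono hHi ((hWi.const_mul _).add integrable_inv_one_add_sq) hHb
      _ = C ^ 2 * (∫ η, W η) + ∫ η : ℝ, (1 + η ^ 2)⁻¹ := by
          rw [integral_add (hWi.const_mul _) integrable_inv_one_add_sq, integral_const_mul]
      _ ≤ _ := by rw [hE]; gcongr
  have hH2le : ∫ η, H η ^ 2 ≤ E := by
    calc ∫ η, H η ^ 2 ≤ ∫ η, C ^ 2 * W η := integral_mono hH2i (hWi.const_mul _) hHW2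
      _ = C ^ 2 * (∫ η, W η) := integral_const_mul _ _
      _ ≤ C ^ 2 * R ^ 2 := by gcongr
      _ ≤ _ := by rw [hE]; linarith
  -- the transform `g` and the transform `2π i η g` of the derivative are both dominated by `H`
  set g' : ℝ → F := fun η => (2 * Real.pi * Complex.I * (η : ℂ)) • g η with hg'
  have hgm' : AEStronglyMeasurable g' :=
    (by fun_prop : Continuous fun η : ℝ =>
      (2 * Real.pi * Complex.I * (η : ℂ))).aestronglyMeasurable.smul hgm
  have hexpm : AEStronglyMeasurable fun η : ℝ => Real.exp (2 * Real.pi * σ₁ * |η|) :=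
    (by fun_prop : Continuous fun η : ℝ => Real.exp (2 * Real.pi * σ₁ * |η|)).aestronglyMeasurable
  have hng' : ∀ η, ‖g' η‖ = 2 * Real.pi * |η| * ‖g η‖ := fun η => by
    simp [hg', norm_smul, abs_of_pos Real.pi_pos]
  have dom : ∀ q : ℝ → F, AEStronglyMeasurable q →
      (∀ η, ‖q η‖ ≤ (1 + 2 * Real.pi * |η|) * ‖g η‖) →
      (Integrable fun η => Real.exp (2 * Real.pi * σ₁ * |η|) * ‖q η‖) ∧
      (∫ η, Real.exp (2 * Real.pi * σ₁ * |η|) * ‖q η‖ ≤ E) ∧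
      (Integrable fun η => (Real.exp (2 * Real.pi * σ₁ * |η|) * ‖q η‖) ^ 2) ∧
      (∫ η, (Real.exp (2 * Real.pi * σ₁ * |η|) * ‖q η‖) ^ 2 ≤ E) := by
    intro q hq hle
    have hle' : ∀ η, Real.exp (2 * Real.pi * σ₁ * |η|) * ‖q η‖ ≤ H η := fun η => by
      simp only [hH]; gcongr; exact hle η
    have hle2 : ∀ η, (Real.exp (2 * Real.pi * σ₁ * |η|) * ‖q η‖) ^ 2 ≤ H η ^ 2 := fun η =>
      pow_le_pow_left₀ (by positivity) (hle' η) 2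
    have i1 : Integrable fun η => Real.exp (2 * Real.pi * σ₁ * |η|) * ‖q η‖ :=
      hHi.mono' (hexpm.mul hq.norm) (Filter.Eventually.of_forall fun η => by
        rw [Real.norm_of_nonneg (by positivity)]; exact hle' η)
    have i2 : Integrable fun η => (Real.exp (2 * Real.pi * σ₁ * |η|) * ‖q η‖) ^ 2 :=
      hH2i.mono' ((hexpm.mul hq.norm).pow 2) (Filter.Eventually.of_forall fun η => by
        rw [Real.norm_of_nonneg (by positivity)]; exact hle2 η)
    exact ⟨i1, (integral_mono i1 hHi hle').trans hHle, i2,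
      (integral_mono i2 hH2i hle2).trans hH2le⟩
  obtain ⟨a1, a2, a3, a4⟩ := dom g hgm fun η => by
    have : 0 ≤ 2 * Real.pi * |η| := by positivity
    nlinarith [norm_nonneg (g η)]
  obtain ⟨b1, b2, b3, b4⟩ := dom g' hgm' fun η => by
    rw [hng']; nlinarith [norm_nonneg (g η)]
  have hder : ∀ z ∈ strip σ₁, HasDerivAt (fourierLaplace g) (fourierLaplace g' z) z := fun z hz =>
    hasDerivAt_fourierLaplace hgm a1 b1 hz
  refine ⟨fourierLaplace g, fun z hz => (hder z hz).differentiableAt.differentiableWithinAt,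
    ?_, fun z hz => ⟨?_, ?_⟩, fun y hy => ⟨?_, ?_⟩⟩
  · have e1 : Integrable g := by
      refine a1.mono' hgm (Filter.Eventually.of_forall fun η => ?_)
      have : 1 ≤ Real.exp (2 * Real.pi * σ₁ * |η|) := Real.one_le_exp (by positivity)
      nlinarith [norm_nonneg (g η)]
    have e2 : MemLp g 2 (volume : Measure ℝ) := Lp.memLp k
    have e3 := l2_fourierInv_ae_eq e1 e2
    have e4 : e2.toLp g = k := Lp.toLp_coeFn k e2
    rw [e4, hk, fourierInv_fourier_eq] at e3
    filter_upwards [e3, hf.coeFn_toLp] with x hx hx'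
    have := fourierLaplace_eq_fourierInv g x 0
    simp only [Complex.ofReal_zero, zero_mul, add_zero, mul_zero, neg_zero, Real.exp_zero,
      Complex.ofReal_one, one_smul] at this
    rw [this, ← hx', hx]
  · exact (norm_fourierLaplace_le a1 (le_of_lt hz)).trans (by linarith)
  · rw [(hder z hz).deriv]
    exact (norm_fourierLaplace_le b1 (le_of_lt hz)).trans (by linarith)
  · obtain ⟨p, q⟩ := fourierLaplace_l2 hgm a1 a3 hy.le
    exact ⟨p, by linarith⟩
  · obtain ⟨p, q⟩ := fourierLaplace_l2 hgm' b1 b3 hy.le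
    have e : ∀ x : ℝ, deriv (fourierLaplace g) (x + y * Complex.I)
        = fourierLaplace g' (x + y * Complex.I) := fun x =>
      (hder _ (by simpa [strip] using hy)).deriv
    simp only [e]
    exact ⟨p, by linarith⟩

end PaleyWiener

/-! ### Contour shifts for regularised functions -/

section ContourShift
variable {F : Type*} [NormedAddCommGroup F] [InnerProductSpace ℂ F]

/-- The integral over a horizontal line in the strip does not depend on the line, for functions
with Gaussian decay. -/
theorem strip_integral_shift [CompleteSpace F] {σ ε B : ℝ} (hε : 0 < ε) {G : ℂ → F}
    (hG : DifferentiableOn ℂ G (strip σ))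
    {y : ℝ} (hy : |y| < σ)
    (hB : ∀ x t : ℝ, |t| ≤ |y| → ‖G (x + t * Complex.I)‖ ≤ B * Real.exp (-ε * x ^ 2)) :
    ∫ x : ℝ, G (x + y * Complex.I) = ∫ x : ℝ, G x := by
  have hline : ∀ t : ℝ, |t| ≤ |y| → Integrable fun x : ℝ => G (x + t * Complex.I) := by
    intro t ht
    refine ((integrable_exp_neg_mul_sq hε).const_mul B).mono' ?_
      (Filter.Eventually.of_forall fun x => hB x t ht)
    refine Continuous.aestronglyMeasurable ?_
    refine hG.continuousOn.comp_continuous (by fun_prop) fun x => ?_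
    simpa [strip] using lt_of_le_of_lt ht hy
  have h0 := hline 0 (by simp)
  simp only [Complex.ofReal_zero, zero_mul, add_zero] at h0
  have h1 := hline y le_rfl
  have l0 := intervalIntegral_tendsto_integral h0
    (Filter.tendsto_neg_atTop_atBot.comp tendsto_natCast_atTop_atTop)
    (tendsto_natCast_atTop_atTop (R := ℝ))
  have l1 := intervalIntegral_tendsto_integral h1
    (Filter.tendsto_neg_atTop_atBot.comp tendsto_natCast_atTop_atTop)
    (tendsto_natCast_atTop_atTop (R := ℝ))
  have key : ∀ n : ℕ, ‖(∫ x in (-(n:ℝ))..n, G x) - ∫ x in (-(n:ℝ))..n, G (x + y * Complex.I)‖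
      ≤ 2 * (B * Real.exp (-ε * (n : ℝ) ^ 2) * |y|) := by
    intro n
    have hr := Complex.integral_boundary_rect_eq_zero_of_differentiableOn G (-(n : ℂ))
      ((n : ℂ) + y * Complex.I) (hG.mono fun z hz => by
        have h2 := hz.2
        simp only [Set.mem_preimage] at h2
        simp only [Complex.neg_im, Complex.natCast_im, neg_zero, Complex.add_im, Complex.mul_im,
          Complex.ofReal_re, Complex.I_im, mul_one, Complex.ofReal_im, Complex.I_re, mul_zero,
          add_zero, zero_add] at h2
        have := Set.abs_sub_left_of_mem_uIcc h2
        simp only [sub_zero] at this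
        exact lt_of_le_of_lt this hy)
    simp only [Complex.neg_im, Complex.natCast_im, neg_zero, Complex.add_im, Complex.mul_im,
          Complex.ofReal_re, Complex.I_im, mul_one, Complex.ofReal_im, Complex.I_re, mul_zero,
          add_zero, zero_add, Complex.neg_re, Complex.natCast_re, Complex.add_re, Complex.mul_re,
          zero_mul, Complex.ofReal_zero, Complex.ofReal_neg, sub_self,
          Complex.ofReal_natCast] at hr
    have hside : ∀ a : ℝ, a ^ 2 = (n : ℝ) ^ 2 → ‖∫ t in (0:ℝ)..y, G ((a : ℂ) + t * Complex.I)‖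
        ≤ B * Real.exp (-ε * (n : ℝ) ^ 2) * |y| := by
      intro a ha
      have := intervalIntegral.norm_integral_le_of_norm_le_const (a := 0) (b := y)
        (C := B * Real.exp (-ε * (n : ℝ) ^ 2)) (f := fun t : ℝ => G ((a : ℂ) + t * Complex.I)) ?_
      · simpa using this
      · intro t ht
        rw [← ha]
        refine hB a t ?_
        have := Set.abs_sub_left_of_mem_uIcc (Set.uIoc_subset_uIcc ht)
        simpa using this
    have s1 := hside n rfl
    have s2 := hside (-n) (by ring)
    simp only [Complex.ofReal_neg, Complex.ofReal_natCast] at s1 s2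
    set A := (∫ x in (-(n:ℝ))..n, G x) - ∫ x in (-(n:ℝ))..n, G (x + y * Complex.I)
    have hA : A = Complex.I • (∫ t in (0:ℝ)..y, G (-(n : ℂ) + t * Complex.I))
        - Complex.I • (∫ t in (0:ℝ)..y, G ((n : ℂ) + t * Complex.I)) := by
      rw [eq_sub_iff_add_eq, ← sub_eq_zero]; exact hr
    rw [hA]
    refine (norm_sub_le _ _).trans ?_
    rw [norm_smul, norm_smul, Complex.norm_I]
    linarith
  have hz : Filter.Tendsto (fun n : ℕ => 2 * (B * Real.exp (-ε * (n : ℝ) ^ 2) * |y|))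
      Filter.atTop (nhds 0) := by
    have h2 : Filter.Tendsto (fun n : ℕ => Real.exp (-ε * (n : ℝ) ^ 2)) Filter.atTop (nhds 0) := by
      refine Real.tendsto_exp_atBot.comp ?_
      refine Filter.Tendsto.const_mul_atTop_of_neg (by linarith) ?_
      exact (Filter.tendsto_pow_atTop (by norm_num)).comp tendsto_natCast_atTop_atTop
    simpa using ((h2.const_mul B).mul_const |y|).const_mul 2
  have := squeeze_zero_norm key hz
  exact (sub_eq_zero.1 (tendsto_nhds_unique (l0.sub l1) this)).symm

theorem norm_gauss (ε : ℝ) (x t : ℝ) :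
    ‖Complex.exp (-ε * ((x : ℂ) + t * Complex.I) ^ 2)‖
      = Real.exp (ε * t ^ 2) * Real.exp (-ε * x ^ 2) := by
  rw [Complex.norm_exp, ← Real.exp_add]
  congr 1
  simp [pow_two]
  ring

/-- Restricting to the line `Im z = y` multiplies the Fourier transform by `e^{-2π y η}`. The
Gaussian factor makes the contour shift legitimate for functions that are merely bounded. -/
theorem gauss_shift_fourier [CompleteSpace F] {σ ε B : ℝ} (hε : 0 < ε) {g : ℂ → F}
    (hg : DifferentiableOn ℂ g (strip σ)) (hB : ∀ z ∈ strip σ, ‖g z‖ ≤ B) {y : ℝ} (hy : |y| < σ)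
    (η : ℝ) :
    𝓕 (fun x : ℝ => Complex.exp (-ε * ((x : ℂ) + y * Complex.I) ^ 2) • g (x + y * Complex.I)) η
      = (Real.exp (-(2 * Real.pi * y * η)) : ℂ) •
        𝓕 (fun x : ℝ => Complex.exp (-ε * (x : ℂ) ^ 2) • g x) η := by
  have h0 : (0:ℂ) ∈ strip σ := by simpa [strip] using lt_of_le_of_lt (abs_nonneg y) hy
  have hB0 : 0 ≤ B := (norm_nonneg _).trans (hB _ h0)
  have h := strip_integral_shift (F := F) hε (σ := σ)
    (B := Real.exp (ε * y ^ 2) * Real.exp (2 * Real.pi * |y| * |η|) * B)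
    (G := fun z => Complex.exp (-ε * z ^ 2) • Complex.exp
      (-(2 * Real.pi * Complex.I * η * z)) • g z)
    (by
      refine DifferentiableOn.smul ?_ (DifferentiableOn.smul ?_ hg)
      · exact Differentiable.differentiableOn (by fun_prop)
      · exact Differentiable.differentiableOn (by fun_prop)) hy (by
      intro x t ht
      rw [norm_smul, norm_smul, norm_gauss]
      have e1 : ‖Complex.exp (-(2 * Real.pi * Complex.I * η * (x + t * Complex.I)))‖
          ≤ Real.exp (2 * Real.pi * |y| * |η|) := by
        rw [Complex.norm_exp]
        refine Real.exp_le_exp.2 ?_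
        simp
        have := abs_mul η t ▸ le_abs_self (η * t)
        have h3 : |η| * |t| ≤ |η| * |y| := by gcongr
        nlinarith [Real.pi_pos]
      have e2 : Real.exp (ε * t ^ 2) ≤ Real.exp (ε * y ^ 2) := by
        refine Real.exp_le_exp.2 ?_
        have := sq_le_sq.2 ht
        gcongr
      have e3 : ‖g (x + t * Complex.I)‖ ≤ B := hB _ (by simpa [strip] using lt_of_le_of_lt ht hy)
      calc _ ≤ (Real.exp (ε * y ^ 2) * Real.exp (-ε * x ^ 2)) *
              (Real.exp (2 * Real.pi * |y| * |η|) * B) := by gcongr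
        _ = _ := by ring)
  rw [Real.fourier_real_eq_integral_exp_smul, Real.fourier_real_eq_integral_exp_smul]
  have e1 : ∫ x : ℝ, Complex.exp (-ε * (x : ℂ) ^ 2) •
      Complex.exp (-(2 * Real.pi * Complex.I * η * x)) • g x =
      ∫ v : ℝ, Complex.exp (↑(-2 * Real.pi * v * η) * Complex.I) •
        Complex.exp (-ε * (v : ℂ) ^ 2) • g v := by
    refine integral_congr_ae (Filter.Eventually.of_forall fun x => ?_)
    simp only
    rw [smul_comm]
    congr 2
    push_cast; ring
  rw [← e1, ← h, ← integral_smul]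
  refine integral_congr_ae (Filter.Eventually.of_forall fun x => ?_)
  simp only
  rw [smul_comm (Complex.exp (-ε * ((x : ℂ) + y * Complex.I) ^ 2)), smul_smul _
    (Complex.exp (-(2 * Real.pi * Complex.I * η * _))), Complex.ofReal_exp, ← Complex.exp_add]
  congr 2
  push_cast
  linear_combination (2 * (Real.pi : ℂ) * η * y) * Complex.I_sq

end ContourShift

/-! ### From holomorphic functions to Gevrey spaces -/

section Converse
variable {F : Type*} [NormedAddCommGroup F] [InnerProductSpace ℂ F]

theorem fourier_l2 [CompleteSpace F] {h : ℝ → F} (h1 : Integrable h)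
    (h2 : MemLp h 2 (volume : Measure ℝ)) :
    (Integrable fun x => ‖𝓕 h x‖ ^ 2) ∧ ∫ x, ‖𝓕 h x‖ ^ 2 = ∫ x, ‖h x‖ ^ 2 := by
  have hae := l2_fourier_ae_eq h1 h2
  have hm : MemLp (𝓕 h) 2 (volume : Measure ℝ) := (Lp.memLp _).ae_eq hae
  refine ⟨(memLp_two_iff_integrable_sq_norm hm.1).1 hm, ?_⟩
  calc ∫ x, ‖𝓕 h x‖ ^ 2
      = ∫ x, ‖(𝓕 (h2.toLp h) : Lp F 2 (volume : Measure ℝ)) x‖ ^ 2 :=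
        integral_congr_ae (hae.symm.mono fun x hx => by simp only [hx])
    _ = ∫ x, ‖(h2.toLp h) x‖ ^ 2 := by
        rw [integral_norm_sq_eq_norm_sq, integral_norm_sq_eq_norm_sq, Lp.norm_fourier_eq]
    _ = _ := integral_congr_ae (h2.coeFn_toLp.mono fun x hx => by simp only [hx])

theorem norm_toLp_sq {f : ℝ → F} (hf : MemLp f 2 (volume : Measure ℝ)) :
    ‖hf.toLp f‖ ^ 2 = ∫ x, ‖f x‖ ^ 2 := by
  rw [← integral_norm_sq_eq_norm_sq]
  exact integral_congr_ae (hf.coeFn_toLp.mono fun x hx => by simp only [hx])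

/-- Hard half of Paley–Wiener: the exponential decay of the transform follows from `L²` bounds on
horizontal lines. Plancherel on the lines `Im z = ±ρ` gives it for `e^{-ε z²} g`, uniformly in `ε`,
and Fatou's lemma for `g`. -/
theorem integrable_exp_mul_fourier_sq [CompleteSpace F] {σ ρ B C : ℝ} (hρ0 : 0 ≤ ρ) (hρ : ρ < σ)
    {g : ℂ → F}
    (hg : DifferentiableOn ℂ g (strip σ)) (hB : ∀ z ∈ strip σ, ‖g z‖ ≤ B)
    (hL : ∀ y : ℝ, |y| < σ → (Integrable fun x : ℝ => ‖g (x + y * Complex.I)‖ ^ 2) ∧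
      ∫ x : ℝ, ‖g (x + y * Complex.I)‖ ^ 2 ≤ C)
    (hf : MemLp (fun x : ℝ => g x) 2 (volume : Measure ℝ)) :
    Integrable fun η : ℝ => Real.exp (4 * Real.pi * ρ * |η|) *
      ‖(𝓕 (hf.toLp _) : Lp F 2 (volume : Measure ℝ)) η‖ ^ 2 := by
  have hσ : 0 < σ := lt_of_le_of_lt hρ0 hρ
  set fy : ℝ → ℝ → ℝ → F := fun ε y x =>
    Complex.exp (-ε * ((x : ℂ) + y * Complex.I) ^ 2) • g (x + y * Complex.I) with hfy
  have hB0 : 0 ≤ B := (norm_nonneg _).trans (hB 0 (by simpa [strip] using hσ))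
  have hcont : ∀ ε y : ℝ, |y| < σ → Continuous (fy ε y) := fun ε y hy => by
    refine Continuous.smul (by fun_prop) (hg.continuousOn.comp_continuous (by fun_prop) fun x => ?_)
    simpa [strip] using hy
  have hint : ∀ ε y : ℝ, 0 < ε → |y| < σ → Integrable (fy ε y) := fun ε y hε hy => by
    refine ((integrable_exp_neg_mul_sq hε).const_mul (Real.exp (ε * y ^ 2) * B)).mono'
      (hcont ε y hy).aestronglyMeasurable (Filter.Eventually.of_forall fun x => ?_)
    rw [hfy]; simp only [norm_smul, norm_gauss]
    have : ‖g (x + y * Complex.I)‖ ≤ B := hB _ (by simpa [strip] using hy)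
    calc _ ≤ Real.exp (ε * y ^ 2) * Real.exp (-ε * x ^ 2) * B := by gcongr
      _ = _ := by ring
  have hsq : ∀ ε y x : ℝ, 0 < ε → ε ≤ 1 → |y| ≤ ρ →
      ‖fy ε y x‖ ^ 2 ≤ Real.exp (2 * ρ ^ 2) * ‖g (x + y * Complex.I)‖ ^ 2 := by
    intro ε y x hε hε1 hy
    rw [hfy]; simp only [norm_smul, norm_gauss]
    have h1 : Real.exp (-ε * x ^ 2) ≤ 1 := Real.exp_le_one_iff.2 (by nlinarith [sq_nonneg x])
    have h2 : Real.exp (ε * y ^ 2) ≤ Real.exp (ρ ^ 2) := by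
      refine Real.exp_le_exp.2 ?_
      have := sq_le_sq' (by linarith [neg_abs_le y]) ((le_abs_self y).trans hy)
      nlinarith [sq_nonneg y]
    calc _ ≤ (Real.exp (ρ ^ 2) * 1 * ‖g (x + y * Complex.I)‖) ^ 2 := by gcongr
      _ = _ := by
        rw [mul_one, mul_pow, pow_two (Real.exp (ρ ^ 2)), ← Real.exp_add]; ring_nf
  have hsqi : ∀ ε y : ℝ, 0 < ε → ε ≤ 1 → |y| ≤ ρ → Integrable fun x => ‖fy ε y x‖ ^ 2 := by
    intro ε y hε hε1 hy
    have hy' : |y| < σ := lt_of_le_of_lt hy hρ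
    refine ((hL y hy').1.const_mul (Real.exp (2 * ρ ^ 2))).mono'
      (((hcont ε y hy').norm.pow 2).aestronglyMeasurable) (Filter.Eventually.of_forall fun x => ?_)
    rw [Real.norm_of_nonneg (by positivity)]
    exact hsq ε y x hε hε1 hy
  have hmem : ∀ ε y : ℝ, 0 < ε → ε ≤ 1 → |y| ≤ ρ → MemLp (fy ε y) 2 (volume : Measure ℝ) :=
    fun ε y hε hε1 hy => (memLp_two_iff_integrable_sq_norm
      (hcont ε y (lt_of_le_of_lt hy hρ)).aestronglyMeasurable).2 (hsqi ε y hε hε1 hy)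
  have hρρ : |ρ| ≤ ρ := (abs_of_nonneg hρ0).le
  have hρn : |-ρ| ≤ ρ := by rw [abs_neg]; exact hρρ
  have hline : ∀ ε y : ℝ, 0 < ε → ε ≤ 1 → |y| ≤ ρ →
      (Integrable fun η : ℝ => Real.exp (-(4 * Real.pi * y * η)) * ‖𝓕 (fy ε 0) η‖ ^ 2) ∧
      ∫ η : ℝ, Real.exp (-(4 * Real.pi * y * η)) * ‖𝓕 (fy ε 0) η‖ ^ 2
        ≤ Real.exp (2 * ρ ^ 2) * C := by
    intro ε y hε hε1 hy
    have hy' : |y| < σ := lt_of_le_of_lt hy hρ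
    obtain ⟨p, q⟩ := fourier_l2 (hint ε y hε hy') (hmem ε y hε hε1 hy)
    have e : ∀ η : ℝ, ‖𝓕 (fy ε y) η‖ ^ 2
        = Real.exp (-(4 * Real.pi * y * η)) * ‖𝓕 (fy ε 0) η‖ ^ 2 := by
      intro η
      have := gauss_shift_fourier hε hg hB hy' η
      have e0 : fy ε 0 = fun x : ℝ => Complex.exp (-ε * (x : ℂ) ^ 2) • g x := by
        simp [hfy]
      rw [e0, hfy]
      simp only
      rw [this, norm_smul, mul_pow, Complex.norm_real, Real.norm_eq_abs, Real.abs_exp, pow_two,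
        ← Real.exp_add]
      ring_nf
    simp only [e] at p q
    refine ⟨p, q.le.trans ?_⟩
    calc ∫ x, ‖fy ε y x‖ ^ 2
        ≤ ∫ x : ℝ, Real.exp (2 * ρ ^ 2) * ‖g (x + y * Complex.I)‖ ^ 2 :=
          integral_mono (hsqi ε y hε hε1 hy) ((hL y hy').1.const_mul _)
            fun x => hsq ε y x hε hε1 hy
      _ = Real.exp (2 * ρ ^ 2) * ∫ x : ℝ, ‖g (x + y * Complex.I)‖ ^ 2 := integral_const_mul _ _
      _ ≤ _ := by gcongr; exact (hL y hy').2
  set ε : ℕ → ℝ := fun n => 1 / ((n : ℝ) + 1) with hε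
  have hε0 : ∀ n, 0 < ε n := fun n => by simp only [hε]; positivity
  have hε1 : ∀ n, ε n ≤ 1 := fun n => by
    simp only [hε]; rw [div_le_one (by positivity)]; linarith [n.cast_nonneg (α := ℝ)]
  have hεt : Filter.Tendsto ε Filter.atTop (nhds 0) := tendsto_one_div_add_atTop_nhds_zero_nat
  have hm0 : ∀ n, MemLp (fy (ε n) 0) 2 (volume : Measure ℝ) := fun n =>
    hmem _ _ (hε0 n) (hε1 n) (by simpa using hρ0)
  have hL0 := (hL 0 (by simpa using hσ)).1
  simp only [Complex.ofReal_zero, zero_mul, add_zero] at hL0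
  -- `L²` convergence of the regularised functions
  have hlim : Filter.Tendsto (fun n => (hm0 n).toLp (fy (ε n) 0)) Filter.atTop
      (nhds (hf.toLp _)) := by
    rw [tendsto_iff_norm_sub_tendsto_zero]
    have hs : ∀ n, ‖(hm0 n).toLp (fy (ε n) 0) - hf.toLp _‖ ^ 2
        = ∫ x : ℝ, ‖fy (ε n) 0 x - g x‖ ^ 2 := fun n => by
      rw [← MemLp.toLp_sub, norm_toLp_sq]; rfl
    have e0 : ∀ n x, fy (ε n) 0 x = (Real.exp (-(ε n) * x ^ 2) : ℂ) • g x := fun n x => by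
      simp [hfy]
    have hd : Filter.Tendsto (fun n => ∫ x : ℝ, ‖fy (ε n) 0 x - g x‖ ^ 2) Filter.atTop
        (nhds (∫ _ : ℝ, (0 : ℝ))) := by
      refine tendsto_integral_of_dominated_convergence (fun x : ℝ => ‖g x‖ ^ 2) (fun n => ?_) hL0
        (fun n => Filter.Eventually.of_forall fun x => ?_) (Filter.Eventually.of_forall fun x => ?_)
      · exact (((hm0 n).1.sub hf.1).norm.pow 2)
      · rw [Real.norm_of_nonneg (by positivity), e0]
        have h1 : ((Real.exp (-(ε n) * x ^ 2) : ℝ) : ℂ) • g x - g x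
            = ((Real.exp (-(ε n) * x ^ 2) - 1 : ℝ) : ℂ) • g x := by
          push_cast; rw [sub_smul, one_smul]
        rw [h1, norm_smul, Complex.norm_real, Real.norm_eq_abs]
        have h2 : Real.exp (-(ε n) * x ^ 2) ≤ 1 :=
          Real.exp_le_one_iff.2 (by nlinarith [sq_nonneg x, hε0 n])
        have h3 : |Real.exp (-(ε n) * x ^ 2) - 1| ≤ 1 := by
          rw [abs_le]; constructor <;> linarith [Real.exp_pos (-(ε n) * x ^ 2)]
        calc _ ≤ (1 * ‖g x‖) ^ 2 := by gcongr
          _ = _ := by ring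
      · have h1 : Filter.Tendsto (fun n => ((Real.exp (-(ε n) * x ^ 2) : ℝ) : ℂ) • g x)
            Filter.atTop (nhds ((Real.exp (-0 * x ^ 2) : ℂ) • g x)) := by
          refine Filter.Tendsto.smul_const ?_ _
          refine (Complex.continuous_ofReal.tendsto _).comp ?_
          exact (Real.continuous_exp.tendsto _).comp ((hεt.neg).mul_const _)
        simp only [neg_zero, zero_mul, Real.exp_zero, Complex.ofReal_one, one_smul] at h1
        have h2 := ((h1.sub_const (g x)).norm).pow 2
        simpa [e0] using h2
    simp only [integral_zero, ← hs] at hd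
    have := hd.sqrt
    simpa [Real.sqrt_sq (norm_nonneg _)] using this
  have hlimF := ((continuous_fourier (E := Lp F 2 (volume : Measure ℝ))
    (F := Lp F 2 (volume : Measure ℝ))).tendsto _).comp hlim
  set k : Lp F 2 (volume : Measure ℝ) := 𝓕 (hf.toLp _) with hk
  obtain ⟨ns, hns, hae⟩ := (tendstoInMeasure_of_tendsto_Lp hlimF).exists_seq_tendsto_ae
  have hae2 : ∀ᵐ η : ℝ, Filter.Tendsto (fun n => 𝓕 (fy (ε (ns n)) 0) η) Filter.atTop
    (nhds (k η)) := by
    have hall : ∀ᵐ η : ℝ, ∀ n, (𝓕 ((hm0 (ns n)).toLp _) : Lp F 2 (volume : Measure ℝ)) η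
        = 𝓕 (fy (ε (ns n)) 0) η :=
      ae_all_iff.2 fun n => l2_fourier_ae_eq (hint _ _ (hε0 _) (by simpa using hσ)) (hm0 _)
    filter_upwards [hae, hall] with η h1 h2
    refine h1.congr fun n => ?_
    exact h2 n
  have hwm : AEStronglyMeasurable fun η : ℝ => Real.exp (4 * Real.pi * ρ * |η|) * ‖k η‖ ^ 2 :=
    (by fun_prop : Continuous fun η : ℝ =>
      Real.exp (4 * Real.pi * ρ * |η|)).aestronglyMeasurable.mul
      ((Lp.memLp k).1.norm.pow 2)
  refine ⟨hwm, ?_⟩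
  rw [hasFiniteIntegral_iff_ofReal (Filter.Eventually.of_forall fun η => by positivity)]
  set Hn : ℕ → ℝ → ENNReal := fun n η =>
    ENNReal.ofReal (Real.exp (4 * Real.pi * ρ * |η|) * ‖𝓕 (fy (ε (ns n)) 0) η‖ ^ 2) with hHn
  have hFc : ∀ n, Continuous (𝓕 (fy (ε (ns n)) 0)) := fun n =>
    VectorFourier.fourierIntegral_continuous Real.continuous_fourierChar
      (innerSL ℝ).continuous₂ (hint _ _ (hε0 _) (by simpa using hσ))
  have hmeas : ∀ n, Measurable (Hn n) := fun n =>
    ENNReal.measurable_ofReal.comp (Continuous.measurable (by have := hFc n; fun_prop))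
  have hbd : ∀ n, ∫⁻ η, Hn n η ≤ ENNReal.ofReal (2 * (Real.exp (2 * ρ ^ 2) * C)) := by
    intro n
    obtain ⟨p1, q1⟩ := hline (ε (ns n)) ρ (hε0 _) (hε1 _) hρρ
    obtain ⟨p2, q2⟩ := hline (ε (ns n)) (-ρ) (hε0 _) (hε1 _) hρn
    calc ∫⁻ η, Hn n η ≤ ∫⁻ η, ENNReal.ofReal
          (Real.exp (-(4 * Real.pi * ρ * η)) * ‖𝓕 (fy (ε (ns n)) 0) η‖ ^ 2 +
            Real.exp (-(4 * Real.pi * (-ρ) * η)) * ‖𝓕 (fy (ε (ns n)) 0) η‖ ^ 2) := by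
          refine lintegral_mono fun η => ENNReal.ofReal_le_ofReal ?_
          rw [← add_mul]
          gcongr
          rcases abs_cases η with ⟨h, _⟩ | ⟨h, _⟩ <;> rw [h]
          · have : Real.exp (4 * Real.pi * ρ * η) = Real.exp (-(4 * Real.pi * (-ρ) * η)) :=
              by ring_nf
            linarith [Real.exp_pos (-(4 * Real.pi * ρ * η))]
          · have : Real.exp (4 * Real.pi * ρ * -η) = Real.exp (-(4 * Real.pi * ρ * η)) := by ring_nf
            linarith [Real.exp_pos (-(4 * Real.pi * (-ρ) * η))]
      _ = ENNReal.ofReal (∫ η, (Real.exp (-(4 * Real.pi * ρ * η)) * ‖𝓕 (fy (ε (ns n)) 0) η‖ ^ 2 +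
            Real.exp (-(4 * Real.pi * (-ρ) * η)) * ‖𝓕 (fy (ε (ns n)) 0) η‖ ^ 2)) :=
          (ofReal_integral_eq_lintegral_ofReal (p1.add p2)
            (Filter.Eventually.of_forall fun η => by
              simp only [Pi.zero_apply, Pi.add_apply]; positivity)).symm
      _ ≤ _ := by
          rw [integral_add p1 p2]
          exact ENNReal.ofReal_le_ofReal (by linarith)
  calc ∫⁻ η, ENNReal.ofReal (Real.exp (4 * Real.pi * ρ * |η|) * ‖k η‖ ^ 2)
      = ∫⁻ η, Filter.liminf (fun n => Hn n η) Filter.atTop := by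
        refine lintegral_congr_ae (hae2.mono fun η h => ?_)
        have : Filter.Tendsto (fun n => Hn n η) Filter.atTop
            (nhds (ENNReal.ofReal (Real.exp (4 * Real.pi * ρ * |η|) * ‖k η‖ ^ 2))) :=
          (ENNReal.continuous_ofReal.tendsto _).comp ((h.norm.pow 2).const_mul _)
        exact this.liminf_eq.symm
    _ ≤ Filter.liminf (fun n => ∫⁻ η, Hn n η) Filter.atTop := lintegral_liminf_le hmeas
    _ ≤ ENNReal.ofReal (2 * (Real.exp (2 * ρ ^ 2) * C)) := by
        refine Filter.liminf_le_of_le (by isBoundedDefault) fun b hb => ?_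
        obtain ⟨n, hn⟩ := hb.exists
        exact hn.trans (hbd n)
    _ < ⊤ := ENNReal.ofReal_lt_top

/-- Converse of `MemGevrey.exists_extension`. The index `s` is arbitrary because the strip is wider
than the Gevrey radius. -/
theorem memGevrey_of_strip [CompleteSpace F] {σ σ' B C : ℝ} (hσ : 0 < σ) (hσ' : σ' < σ) (s : ℝ)
    {g : ℂ → F}
    (hg : DifferentiableOn ℂ g (strip σ)) (hB : ∀ z ∈ strip σ, ‖g z‖ ≤ B)
    (hL : ∀ y : ℝ, |y| < σ → (Integrable fun x : ℝ => ‖g (x + y * Complex.I)‖ ^ 2) ∧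
      ∫ x : ℝ, ‖g (x + y * Complex.I)‖ ^ 2 ≤ C) :
    MemGevrey σ' s fun x : ℝ => g x := by
  have hcont : Continuous fun x : ℝ => g x :=
    hg.continuousOn.comp_continuous (by fun_prop) fun x => by simpa [strip] using hσ
  have hL0 := (hL 0 (by simpa using hσ)).1
  simp only [Complex.ofReal_zero, zero_mul, add_zero] at hL0
  have hf : MemLp (fun x : ℝ => g x) 2 (volume : Measure ℝ) :=
    (memLp_two_iff_integrable_sq_norm hcont.aestronglyMeasurable).2 hL0
  obtain ⟨ρ, hρ1, hρ2⟩ : ∃ ρ, max σ' 0 < ρ ∧ ρ < σ := exists_between (max_lt hσ' hσ)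
  have hρ0 : 0 < ρ := (le_max_right _ _).trans_lt hρ1
  have hρ' : σ' < ρ := (le_max_left _ _).trans_lt hρ1
  have key := integrable_exp_mul_fourier_sq hρ0.le hρ2 hg hB hL hf
  obtain ⟨K, hK, hw⟩ := weight_le_exp (sub_pos.2 hρ') s
  refine ⟨hf, ?_⟩
  have hm : AEStronglyMeasurable (gevreyWeighted σ' s (fun x : ℝ => g x) hf) := by
    have hc : Continuous fun ξ : ℝ => Real.exp (σ' * |ξ|) * Real.sqrt (1 + |ξ| ^ 2) ^ s :=
      (by fun_prop : Continuous fun ξ : ℝ => Real.exp (σ' * |ξ|)).mul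
        ((by fun_prop : Continuous fun ξ : ℝ => Real.sqrt (1 + |ξ| ^ 2)).rpow_const fun ξ =>
          Or.inl (Real.sqrt_pos.2 (by positivity)).ne')
    exact hc.aestronglyMeasurable.smul
      ((Lp.stronglyMeasurable _).comp_measurable (by fun_prop)).aestronglyMeasurable
  rw [memLp_two_iff_integrable_sq_norm hm]
  have hpi : (2 * Real.pi)⁻¹ ≠ 0 := by positivity
  refine ((key.comp_mul_left' hpi).const_mul (K ^ 2)).mono' (hm.norm.pow 2)
    (Filter.Eventually.of_forall fun ξ => ?_)
  rw [Real.norm_of_nonneg (by positivity), gevreyWeighted, norm_smul, mul_pow, l2Fourier,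
    div_eq_inv_mul ξ, ← mul_assoc]
  refine mul_le_mul_of_nonneg_right ?_ (by positivity)
  have h1 : Real.exp (4 * Real.pi * ρ * |(2 * Real.pi)⁻¹ * ξ|) = Real.exp (ρ * |ξ|) ^ 2 := by
    rw [abs_mul, abs_of_pos (by positivity), pow_two, ← Real.exp_add]
    congr 1
    field_simp
    ring
  rw [h1, ← mul_pow, Real.norm_of_nonneg (by positivity)]
  refine pow_le_pow_left₀ (by positivity) ?_ 2
  have h2 := hw ξ
  have h3 : Real.sqrt (1 + |ξ| ^ 2) ^ s ≤ (1 + |ξ|) ^ 4 * Real.sqrt (1 + |ξ| ^ 2) ^ s := by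
    have : 1 ≤ (1 + |ξ|) ^ 4 := one_le_pow₀ (by linarith [abs_nonneg ξ])
    have h0 : 0 ≤ Real.sqrt (1 + |ξ| ^ 2) ^ s := by positivity
    nlinarith
  calc Real.exp (σ' * |ξ|) * Real.sqrt (1 + |ξ| ^ 2) ^ s
      ≤ Real.exp (σ' * |ξ|) * (K * Real.exp ((ρ - σ') * |ξ|)) := by gcongr; linarith
    _ = K * Real.exp (ρ * |ξ|) := by
        have : Real.exp (ρ * |ξ|) = Real.exp (σ' * |ξ|) * Real.exp ((ρ - σ') * |ξ|) := by
          rw [← Real.exp_add]; ring_nf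
        rw [this]; ring

end Converse

open Set Filter Topology

/-! ### Time-dependent holomorphic functions -/

theorem sub_real_mem_strip {σ : ℝ} {z : ℂ} (hz : z ∈ strip σ) (r : ℝ) : z - (r : ℂ) ∈ strip σ := by
  simpa [strip] using hz

theorem conj_mem_strip {σ : ℝ} {z : ℂ} (hz : z ∈ strip σ) :
    (starRingEnd ℂ) z ∈ strip σ := by simpa [strip] using hz

theorem line_mem_strip {σ y : ℝ} (hy : |y| < σ) (x : ℝ) : (x : ℂ) + y * Complex.I ∈ strip σ := by
  simpa [strip] using hy

/-- A time-dependent function, jointly continuous on `ℝ × strip σ` and holomorphic in the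
space variable. Values off the strip are irrelevant. -/
structure StripHol {E : Type*} [NormedAddCommGroup E] [NormedSpace ℂ E] (σ : ℝ)
    (f : ℝ → ℂ → E) : Prop where
  cont : ContinuousOn (fun p : ℝ × ℂ => f p.1 p.2) (univ ×ˢ strip σ)
  hol : ∀ t, DifferentiableOn ℂ (f t) (strip σ)

namespace StripHol

variable {E : Type*} [NormedAddCommGroup E] [NormedSpace ℂ E] {σ : ℝ} {f g : ℝ → ℂ → E}

theorem comp_cont (hf : StripHol σ f) {X : Type*} [TopologicalSpace X] {a : X → ℝ} {b : X → ℂ}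
    (ha : Continuous a) (hb : Continuous b) (hm : ∀ x, b x ∈ strip σ) :
    Continuous fun x => f (a x) (b x) :=
  hf.cont.comp_continuous (ha.prodMk hb) fun x => ⟨mem_univ _, hm x⟩

theorem continuous_line (hf : StripHol σ f) {y : ℝ} (hy : |y| < σ) :
    Continuous fun p : ℝ × ℝ => f p.1 (p.2 + y * Complex.I) :=
  hf.comp_cont continuous_fst (by fun_prop) fun _ => line_mem_strip hy _

theorem differentiableAt (hf : StripHol σ f) (t : ℝ) {z : ℂ} (hz : z ∈ strip σ) :
    DifferentiableAt ℂ (f t) z := (hf.hol t).differentiableAt ((isOpen_strip σ).mem_nhds hz)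

theorem of_cont {f : ℝ → ℂ → E} (h : ∀ q : ℝ × ℂ, q.2 ∈ strip σ →
    ContinuousAt (fun p : ℝ × ℂ => f p.1 p.2) q)
      (h2 : ∀ t, ∀ z ∈ strip σ, DifferentiableAt ℂ (f t) z) :
    StripHol σ f :=
  ⟨fun _ hp => (h _ hp.2).continuousWithinAt, fun t z hz => (h2 t z hz).differentiableWithinAt⟩

theorem zero : StripHol σ fun _ _ => (0 : E) :=
  ⟨continuousOn_const, fun _ => differentiableOn_const _⟩

theorem const (c : E) : StripHol σ fun _ _ => c :=
  ⟨continuousOn_const, fun _ => differentiableOn_const _⟩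

theorem add (hf : StripHol σ f) (hg : StripHol σ g) : StripHol σ fun t z => f t z + g t z :=
  ⟨hf.cont.add hg.cont, fun t => (hf.hol t).add (hg.hol t)⟩

theorem sub (hf : StripHol σ f) (hg : StripHol σ g) : StripHol σ fun t z => f t z - g t z :=
  ⟨hf.cont.sub hg.cont, fun t => (hf.hol t).sub (hg.hol t)⟩

theorem mul {a b : ℝ → ℂ → ℂ} (ha : StripHol σ a) (hb : StripHol σ b) :
    StripHol σ fun t z => a t z * b t z :=
  ⟨ha.cont.mul hb.cont, fun t => (ha.hol t).mul (hb.hol t)⟩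

theorem const_mul {b : ℝ → ℂ → ℂ} (c : ℂ) (hb : StripHol σ b) :
    StripHol σ fun t z => c * b t z := (const c).mul hb

theorem sum {ι : Type*} (s : Finset ι) {f : ι → ℝ → ℂ → E} (h : ∀ i ∈ s, StripHol σ (f i)) :
    StripHol σ fun t z => ∑ i ∈ s, f i t z :=
  ⟨continuousOn_finsetSum s fun i hi => (h i hi).cont,
    fun t => DifferentiableOn.fun_sum fun i hi => (h i hi).hol t⟩

theorem pi {ι : Type*} [Fintype ι] {f : ℝ → ℂ → ι → ℂ} (h : ∀ i, StripHol σ fun t z => f t z i) :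
    StripHol σ f :=
  ⟨continuousOn_pi.2 fun i => (h i).cont, fun t => differentiableOn_pi.2 fun i => (h i).hol t⟩

theorem apply {ι : Type*} [Fintype ι] {f : ℝ → ℂ → ι → ℂ} (h : StripHol σ f) (i : ι) :
    StripHol σ fun t z => f t z i :=
  ⟨continuousOn_pi.1 h.cont i, fun t => differentiableOn_pi.1 (h.hol t) i⟩

theorem reparam (hf : StripHol σ f) {a : ℝ → ℝ} (ha : Continuous a) :
    StripHol σ fun t z => f (a t) z :=
  ⟨hf.cont.comp (f := fun p : ℝ × ℂ => (a p.1, p.2)) (by fun_prop)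
    fun p hp => ⟨mem_univ _, hp.2⟩, fun t => hf.hol (a t)⟩

theorem translate {g : ℂ → E} (hg : DifferentiableOn ℂ g (strip σ)) (c : ℝ) :
    StripHol σ fun t z => g (z - (c * t : ℝ)) := by
  refine ⟨hg.continuousOn.comp (f := fun p : ℝ × ℂ => p.2 - ((c * p.1 : ℝ) : ℂ)) (by fun_prop)
    fun p hp => sub_real_mem_strip hp.2 _, fun t => ?_⟩
  exact hg.comp (by fun_prop) fun z hz => sub_real_mem_strip hz _

/-- The reflected conjugate `f*(t,z) = conj (f(t, conj z))`. It is holomorphic in `z` with `f`, and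
restricts to the complex conjugate of `f` on the real line. -/
def _root_.conjRefl (f : ℝ → ℂ → ℂ) (t : ℝ) (z : ℂ) : ℂ :=
  (starRingEnd ℂ) (f t ((starRingEnd ℂ) z))

theorem conjRefl {f : ℝ → ℂ → ℂ} (hf : StripHol σ f) : StripHol σ (conjRefl f) := by
  refine ⟨?_, fun t z hz => ?_⟩
  · refine Complex.continuous_conj.comp_continuousOn ?_
    exact hf.cont.comp (f := fun p : ℝ × ℂ => (p.1, (starRingEnd ℂ) p.2))
      (by fun_prop) fun p hp => ⟨mem_univ _, conj_mem_strip hp.2⟩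
  · have h := (hf.differentiableAt t (conj_mem_strip hz)).hasDerivAt
    have h2 := h.conj_conj
    simp only [Complex.conj_conj] at h2
    exact h2.differentiableAt.differentiableWithinAt

protected theorem deriv [CompleteSpace E] (hf : StripHol σ f) : StripHol σ fun t z =>
  deriv (f t) z := by
  refine of_cont (fun p hp => ?_) fun t z hz =>
    ((hf.hol t).deriv (isOpen_strip σ)).differentiableAt ((isOpen_strip σ).mem_nhds hz)
  obtain ⟨t₀, z₀⟩ := p
  have hloc : TendstoLocallyUniformlyOn (fun p : ℝ × ℂ => f p.1) (f t₀) (𝓝 (t₀, z₀)) (strip σ) := by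
    rw [Metric.tendstoLocallyUniformlyOn_iff]
    intro ε hε x hx
    have hc : ContinuousAt (fun p : ℝ × ℂ => f p.1 p.2) (t₀, x) :=
      hf.cont.continuousAt ((isOpen_univ.prod (isOpen_strip σ)).mem_nhds ⟨mem_univ _, hx⟩)
    have h1 := Metric.continuousAt_iff'.1 hc (ε / 2) (by positivity)
    rw [nhds_prod_eq, eventually_prod_iff] at h1
    obtain ⟨pa, ha, pb, hb, hab⟩ := h1
    refine ⟨{y | pb y}, mem_nhdsWithin_of_mem_nhds hb, ?_⟩
    rw [nhds_prod_eq]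
    filter_upwards [ha.prod_inl (𝓝 z₀)] with n hn y hy
    have h2 := hab hn hy
    have h3 := hab ha.self_of_nhds hy
    simp only at h2 h3
    calc dist (f t₀ y) (f n.1 y) ≤ dist (f t₀ y) (f t₀ x) + dist (f n.1 y) (f t₀ x) :=
          dist_triangle_right _ _ _
      _ < ε := by linarith
  have hd := hloc.deriv (Eventually.of_forall fun p => hf.hol p.1) (isOpen_strip σ)
  have hcd : ContinuousWithinAt (deriv (f t₀)) (strip σ) z₀ :=
    (((hf.hol t₀).deriv (isOpen_strip σ)) z₀ hp).continuousWithinAt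
  have hg : Tendsto (fun p : ℝ × ℂ => p.2) (𝓝 (t₀, z₀)) (𝓝[strip σ] z₀) := by
    rw [(isOpen_strip σ).nhdsWithin_eq hp]
    exact continuous_snd.tendsto _
  exact hd.tendsto_comp hcd hp hg

end StripHol

/-! ### Duhamel integrals -/

/-- The Duhamel integral of the transport operator `∂ₜ + c ∂_z`. As `c` and `t - s` are real, the
characteristics stay on horizontal lines. -/
noncomputable def duhamel {E : Type*} [NormedAddCommGroup E] [NormedSpace ℂ E] (c : ℝ)
    (f : ℝ → ℂ → E) (t : ℝ)
    (z : ℂ) : E :=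
  ∫ s in (0 : ℝ)..t, f s (z - (c * (t - s) : ℝ))

section Duhamel
variable {E : Type*} [NormedAddCommGroup E] [NormedSpace ℂ E] {σ : ℝ}
  {f : ℝ → ℂ → E}

theorem StripHol.continuous_char (hf : StripHol σ f) {z : ℂ} (hz : z ∈ strip σ) {a b : ℝ → ℝ}
    (ha : Continuous a) (hb : Continuous b) : Continuous fun s => f (a s) (z - (b s : ℝ)) :=
  hf.comp_cont ha (by fun_prop) fun _ => sub_real_mem_strip hz _

/-- Continuity of the integral of `f` over a segment of the characteristic through `(0, z - r)`,
jointly in the length of the segment, in `z` and in `r`. -/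
theorem StripHol.continuousOn_char_integral (hf : StripHol σ f) (c : ℝ) :
    ContinuousOn (fun p : (ℝ × ℝ) × ℂ => ∫ s in (0 : ℝ)..p.1.1, f s (p.2 - (p.1.2 - c * s : ℝ)))
      (univ ×ˢ strip σ) := by
  rw [continuousOn_iff_continuous_domRestrict]
  exact intervalIntegral.continuous_parametric_intervalIntegral_of_continuous
    (f := fun (p : ((univ : Set (ℝ × ℝ)) ×ˢ strip σ : Set _)) (s : ℝ) =>
      f s ((p : (ℝ × ℝ) × ℂ).2 - ((p : (ℝ × ℝ) × ℂ).1.2 - c * s : ℝ)))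
    (s := fun p => (p : (ℝ × ℝ) × ℂ).1.1)
    (by
      refine hf.comp_cont (by fun_prop) (by fun_prop) ?_
      rintro ⟨⟨p, hp⟩, s⟩
      exact sub_real_mem_strip hp.2 _) (by fun_prop)

theorem StripHol.continuousOn_duhamel (hf : StripHol σ f) (c : ℝ) :
    ContinuousOn (fun p : ℝ × ℂ => duhamel c f p.1 p.2) (univ ×ˢ strip σ) := by
  have h := (hf.continuousOn_char_integral c).comp
    (f := fun p : ℝ × ℂ => ((p.1, c * p.1), p.2)) (s := univ ×ˢ strip σ)
    (by fun_prop) fun p hp => ⟨mem_univ _, hp.2⟩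
  refine h.congr fun p hp => ?_
  simp only [duhamel, Function.comp]
  ring_nf

theorem StripHol.hasDerivAt_char_integral [CompleteSpace E] (hf : StripHol σ f) {b : ℝ → ℝ}
    (hb : Continuous b)
    (t : ℝ) {z : ℂ} (hz : z ∈ strip σ) :
    HasDerivAt (fun z => ∫ s in (0 : ℝ)..t, f s (z - (b s : ℝ)))
      (∫ s in (0 : ℝ)..t, deriv (f s) (z - (b s : ℝ))) z := by
  obtain ⟨r, hr, hball⟩ := Metric.isOpen_iff.1 (isOpen_strip σ) z hz
  have hsub : Metric.closedBall z (r / 2) ⊆ strip σ :=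
    (Metric.closedBall_subset_ball (by linarith)).trans hball
  -- the derivative is bounded on the compact set of all points that occur
  have hK : IsCompact (uIcc 0 t ×ˢ Metric.closedBall z (r / 2)) :=
    isCompact_uIcc.prod (isCompact_closedBall z (r / 2))
  obtain ⟨B, hB⟩ := hK.exists_bound_of_continuousOn
    (f := fun p : ℝ × ℂ => deriv (f p.1) (p.2 - (b p.1 : ℝ)))
    (hf.deriv.cont.comp (f := fun p : ℝ × ℂ => (p.1, p.2 - ((b p.1 : ℝ) : ℂ))) (by fun_prop)
      fun p hp => ⟨mem_univ _, sub_real_mem_strip (hsub hp.2) _⟩)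
  refine (intervalIntegral.hasDerivAt_integral_of_dominated_loc_of_deriv_le
    (F := fun (z : ℂ) (s : ℝ) => f s (z - (b s : ℝ)))
    (F' := fun (z : ℂ) (s : ℝ) => deriv (f s) (z - (b s : ℝ))) (bound := fun _ => B)
    (s := Metric.ball z (r / 2)) (Metric.ball_mem_nhds z (by positivity)) ?_ ?_ ?_ ?_ ?_ ?_).2
  · filter_upwards [(isOpen_strip σ).mem_nhds hz] with w hw
    exact (hf.continuous_char hw continuous_id hb).aestronglyMeasurable
  · exact (hf.continuous_char hz continuous_id hb).intervalIntegrable _ _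
  · exact (hf.deriv.continuous_char hz continuous_id hb).aestronglyMeasurable
  · refine Eventually.of_forall fun s hs w hw => ?_
    exact hB (s, w) ⟨uIoc_subset_uIcc hs, Metric.ball_subset_closedBall hw⟩
  · exact intervalIntegrable_const
  · refine Eventually.of_forall fun s _ w hw => ?_
    have hw' : w - (b s : ℝ) ∈ strip σ :=
      sub_real_mem_strip (hsub (Metric.ball_subset_closedBall hw)) _
    have := (hf.differentiableAt s hw').hasDerivAt
    simpa using this.comp_sub_const w _

theorem StripHol.hasDerivAt_duhamel [CompleteSpace E] (hf : StripHol σ f) (c t : ℝ) {z : ℂ}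
    (hz : z ∈ strip σ) :
    HasDerivAt (duhamel c f t) (duhamel c (fun s z => deriv (f s) z) t z) z :=
  hf.hasDerivAt_char_integral (b := fun s => c * (t - s)) (by fun_prop) t hz

theorem StripHol.stripHol_duhamel [CompleteSpace E] (hf : StripHol σ f)
    (c : ℝ) : StripHol σ (duhamel c f) :=
  ⟨hf.continuousOn_duhamel c, fun t _ hz =>
    (hf.hasDerivAt_duhamel c t hz).differentiableAt.differentiableWithinAt⟩

/-- The Duhamel integral solves `∂ₜ w + c ∂_z w = f`. -/
theorem StripHol.hasDerivAt_duhamel_time [CompleteSpace E] (hf : StripHol σ f) (c t : ℝ) {z : ℂ}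
    (hz : z ∈ strip σ) :
    HasDerivAt (fun t => duhamel c f t z)
      (f t z - (c : ℂ) • deriv (duhamel c f t) z) t := by
  set A : ℝ → ℝ → E := fun t r => ∫ s in (0 : ℝ)..t, f s (z - (r - c * s : ℝ)) with hA
  set A₁ : ℝ → ℝ → E := fun t r => f t (z - (r - c * t : ℝ)) with hA₁
  set A₂ : ℝ → ℝ → E := fun t r => -∫ s in (0 : ℝ)..t, deriv (f s) (z - (r - c * s : ℝ)) with hA₂
  have hcs : ∀ r : ℝ, Continuous fun s => f s (z - (r - c * s : ℝ)) := fun r =>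
    hf.continuous_char hz continuous_id (by fun_prop)
  have d1 : ∀ t r, HasDerivAt (fun t => A t r) (A₁ t r) t := fun t r =>
    intervalIntegral.integral_hasDerivAt_right
      ((hcs r).intervalIntegrable _ _) ((hcs r).stronglyMeasurableAtFilter _ _)
      (hcs r).continuousAt
  have d2 : ∀ t r, HasDerivAt (fun r => A t r) (A₂ t r) r := fun t r => by
    have h := hf.hasDerivAt_char_integral (b := fun s => -(c * s)) (by fun_prop) t
      (sub_real_mem_strip hz r)
    have h2 : HasDerivAt (fun r : ℝ => z - (r : ℂ)) (-1) r := by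
      simpa using (Complex.ofRealCLM.hasDerivAt (x := r)).const_sub z
    have h3 := h.scomp r h2
    have e : ∀ r s : ℝ, z - ((r - c * s : ℝ) : ℂ) = z - (r : ℂ) - ((-(c * s) : ℝ) : ℂ) := by
      intro r s; push_cast; ring
    simp only [hA, hA₂, e]
    simpa [Function.comp_def] using h3
  have c1 : Continuous (Function.uncurry A₁) :=
    hf.comp_cont continuous_fst (by fun_prop) fun _ => sub_real_mem_strip hz _
  have c2 : Continuous (Function.uncurry A₂) := by
    refine Continuous.neg ?_
    exact (hf.deriv.continuousOn_char_integral c).comp_continuous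
      (f := fun p : ℝ × ℝ => ((p.1, p.2), z)) (by fun_prop) fun p => ⟨mem_univ _, hz⟩
  have hs := hasStrictFDerivAt_uncurry_coprod (𝕜 := ℝ) (u := (t, c * t)) (f := A)
    (f₁ := fun t r => ContinuousLinearMap.toSpanSingleton ℝ (A₁ t r))
    (f₂ := fun t r => ContinuousLinearMap.toSpanSingleton ℝ (A₂ t r))
    (Eventually.of_forall fun v => (d1 v.1 v.2).hasFDerivAt)
    (Eventually.of_forall fun v => (d2 v.1 v.2).hasFDerivAt)
    (((ContinuousLinearMap.toSpanSingletonCLE (𝕜 := ℝ) (E := E)).continuous.comp c1).continuousAt)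
    (((ContinuousLinearMap.toSpanSingletonCLE (𝕜 := ℝ) (E := E)).continuous.comp c2).continuousAt)
  have hpath : HasDerivAt (fun t : ℝ => (t, c * t)) (1, c) t := by
    simpa using (hasDerivAt_id t).prodMk ((hasDerivAt_id t).const_mul c)
  have h := hs.hasFDerivAt.comp_hasDerivAt t hpath
  rw [(hf.hasDerivAt_duhamel c t hz).deriv]
  convert h using 1
  · ext t
    simp only [hA, duhamel, Function.comp, Function.HasUncurry.uncurry, id]
    ring_nf
  · simp only [hA₁, hA₂, duhamel, Function.HasUncurry.uncurry, id, ContinuousLinearMap.coprod_apply,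
      ContinuousLinearMap.toSpanSingleton_apply, one_smul, sub_self, Complex.ofReal_zero, sub_zero,
      smul_neg, ← sub_eq_add_neg]
    congr 1
    rw [Complex.coe_smul]
    ring_nf

end Duhamel

/-! ### Exponentially weighted norms -/

section Weighted
variable {E : Type*} [NormedAddCommGroup E] [NormedSpace ℂ E] {σ : ℝ}

/-- In the norm with weight `e^{-λ|t|}`, integration in time gains a factor `1 / λ`. -/
theorem norm_integral_le_exp {F : ℝ → E} {H lam t : ℝ} (hH : 0 ≤ H) (hl : 0 < lam)
    (h : ∀ s, |s| ≤ |t| → ‖F s‖ ≤ H * Real.exp (lam * |s|)) :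
    ‖∫ s in (0 : ℝ)..t, F s‖ ≤ H / lam * Real.exp (lam * |t|) := by
  have key : ∀ {F : ℝ → E} {t : ℝ}, 0 ≤ t →
      (∀ s, |s| ≤ |t| → ‖F s‖ ≤ H * Real.exp (lam * |s|)) →
      ‖∫ s in (0 : ℝ)..t, F s‖ ≤ H / lam * Real.exp (lam * |t|) := by
    intro F t ht h
    have h1 : ‖∫ s in (0 : ℝ)..t, F s‖ ≤ ∫ s in (0 : ℝ)..t, H * Real.exp (lam * s) := by
      refine intervalIntegral.norm_integral_le_of_norm_le ht
        (Eventually.of_forall fun s hs => ?_)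
        (Continuous.intervalIntegrable (by fun_prop) _ _)
      have := h s (by rw [abs_of_pos hs.1, abs_of_nonneg ht]; exact hs.2)
      rwa [abs_of_pos hs.1] at this
    refine h1.trans ?_
    have h2 : ∫ s in (0 : ℝ)..t, H * Real.exp (lam * s)
        = H / lam * Real.exp (lam * t) - H / lam * Real.exp (lam * 0) := by
      refine intervalIntegral.integral_eq_sub_of_hasDerivAt
        (f := fun s => H / lam * Real.exp (lam * s)) (fun s _ => ?_)
        (Continuous.intervalIntegrable (by fun_prop) _ _)
      have := (((hasDerivAt_id s).const_mul lam).exp).const_mul (H / lam)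
      refine this.congr_deriv ?_
      simp only [id_eq, mul_one]
      field_simp
    rw [h2, abs_of_nonneg ht]
    have : 0 ≤ H / lam * Real.exp (lam * 0) := by positivity
    linarith
  rcases le_total 0 t with ht | ht
  · exact key ht h
  · have h1 := key (F := fun s => F (-s)) (t := -t) (by linarith) fun s hs => by
      have := h (-s) (by simpa using hs)
      simpa using this
    rw [intervalIntegral.integral_comp_neg, neg_neg, neg_zero, intervalIntegral.integral_symm,
      norm_neg, abs_neg] at h1
    exact h1

theorem norm_duhamel_le_exp {f : ℝ → ℂ → E} {H lam t c : ℝ} (hH : 0 ≤ H) (hl : 0 < lam)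
    (h : ∀ s, |s| ≤ |t| → ∀ z ∈ strip σ, ‖f s z‖ ≤ H * Real.exp (lam * |s|)) {z : ℂ}
    (hz : z ∈ strip σ) :
    ‖duhamel c f t z‖ ≤ H / lam * Real.exp (lam * |t|) :=
  norm_integral_le_exp hH hl fun s hs => h s hs _ (sub_real_mem_strip hz _)

/-- Banach's fixed point theorem for the norm `sup e^{-λ|t|} ‖f(t,z)‖` over `ℝ × strip σ`. The set
`A` need only be closed under pointwise limits that are again holomorphic, and distances between
its elements need not be finite. -/
theorem exists_fixedPoint_weighted [CompleteSpace E] {lam C : ℝ} (A : Set (ℝ → ℂ → E))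
    (T : (ℝ → ℂ → E) → ℝ → ℂ → E) {w₀ : ℝ → ℂ → E} (h₀ : w₀ ∈ A) (hmaps : ∀ w ∈ A, T w ∈ A)
    (hol : ∀ w ∈ A, StripHol σ w)
    (hclosed : ∀ (W : ℕ → ℝ → ℂ → E) (w : ℝ → ℂ → E), (∀ n, W n ∈ A) → StripHol σ w →
      (∀ t, ∀ z ∈ strip σ, Tendsto (fun n => W n t z) atTop (𝓝 (w t z))) → w ∈ A)
    (hinit : ∀ t, ∀ z ∈ strip σ, ‖T w₀ t z - w₀ t z‖ ≤ C * Real.exp (lam * |t|))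
    (hcontr : ∀ v ∈ A, ∀ w ∈ A, ∀ d : ℝ, 0 ≤ d →
      (∀ t, ∀ z ∈ strip σ, ‖v t z - w t z‖ ≤ d * Real.exp (lam * |t|)) →
      ∀ t, ∀ z ∈ strip σ, ‖T v t z - T w t z‖ ≤ d / 2 * Real.exp (lam * |t|)) :
    ∃ w ∈ A, ∀ t, ∀ z ∈ strip σ, T w t z = w t z := by
  rcases (strip σ).eq_empty_or_nonempty with hS | ⟨z₁, hz₁⟩
  · exact ⟨w₀, h₀, fun t z hz => by simp [hS] at hz⟩
  have hC : 0 ≤ C := by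
    have := (norm_nonneg _).trans (hinit 0 z₁ hz₁)
    simpa using this
  set W : ℕ → ℝ → ℂ → E := fun n => T^[n] w₀ with hW
  have hWs : ∀ n, W (n + 1) = T (W n) := fun n => Function.iterate_succ_apply' T n w₀
  have hWA : ∀ n, W n ∈ A := by
    intro n
    induction n with
    | zero => exact h₀
    | succ n ih => rw [hWs]; exact hmaps _ ih
  have hstep : ∀ n t, ∀ z ∈ strip σ,
      ‖W (n + 1) t z - W n t z‖ ≤ C / 2 ^ n * Real.exp (lam * |t|) := by
    intro n
    induction n with
    | zero => intro t z hz; simpa [hW] using hinit t z hz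
    | succ n ih =>
      intro t z hz
      rw [hWs (n + 1), hWs n]
      have := hcontr _ (hWs n ▸ hWA (n + 1)) _ (hWA n) (C / 2 ^ n) (by positivity)
        (fun t z hz => hWs n ▸ ih t z hz) t z hz
      rw [pow_succ, ← div_div]
      exact this
  have hdist : ∀ t, ∀ z ∈ strip σ, ∀ n,
      dist (W n t z) (W (n + 1) t z) ≤ (2 * C * Real.exp (lam * |t|)) / 2 / 2 ^ n := by
    intro t z hz n
    rw [dist_comm, dist_eq_norm]
    refine (hstep n t z hz).trans (le_of_eq ?_)
    field_simp
  have hlim : ∀ t, ∀ z ∈ strip σ, ∃ l, Tendsto (fun n => W n t z) atTop (𝓝 l) := fun t z hz =>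
    cauchySeq_tendsto_of_complete (cauchySeq_of_le_geometric_two (hdist t z hz))
  classical
  set w : ℝ → ℂ → E := fun t z => if hz : z ∈ strip σ then (hlim t z hz).choose else 0 with hw
  have hwlim : ∀ t, ∀ z ∈ strip σ, Tendsto (fun n => W n t z) atTop (𝓝 (w t z)) := by
    intro t z hz
    simp only [hw, dif_pos hz]
    exact (hlim t z hz).choose_spec
  have htail : ∀ n t, ∀ z ∈ strip σ,
      dist (W n t z) (w t z) ≤ (2 * C * Real.exp (lam * |t|)) / 2 ^ n := fun n t z hz =>
    dist_le_of_le_geometric_two_of_tendsto (hdist t z hz) (hwlim t z hz) n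
  have hpow : ∀ K : ℝ, Tendsto (fun n : ℕ => K / 2 ^ n) atTop (𝓝 0) := fun K => by
    have := (tendsto_pow_atTop_nhds_zero_of_lt_one (r := (1/2 : ℝ)) (by norm_num)
      (by norm_num)).const_mul K
    simpa [div_eq_mul_inv] using this
  -- on bounded time intervals the convergence is uniform
  have hunif : ∀ (M : ℝ), ∀ ε > 0, ∀ᶠ n in atTop, ∀ t, |t| ≤ M → ∀ z ∈ strip σ,
      dist (w t z) (W n t z) < ε := by
    intro M ε hε
    filter_upwards [(hpow (2 * C * Real.exp (|lam| * M))).eventually (gt_mem_nhds hε)]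
      with n hn t ht z hz
    rw [dist_comm]
    refine lt_of_le_of_lt ((htail n t z hz).trans ?_) hn
    have : lam * |t| ≤ |lam| * M :=
      mul_le_mul (le_abs_self _) ht (abs_nonneg _) (abs_nonneg _)
    gcongr
  have hwH : StripHol σ w := by
    constructor
    · refine TendstoLocallyUniformlyOn.continuousOn
        (F := fun n (p : ℝ × ℂ) => W n p.1 p.2) (p := atTop) ?_
        (Eventually.of_forall fun n => (hol _ (hWA n)).cont).frequently
      rw [Metric.tendstoLocallyUniformlyOn_iff]
      intro ε hε p hp
      refine ⟨{q | |q.1| < |p.1| + 1} ∩ (univ ×ˢ strip σ), ?_, ?_⟩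
      · exact inter_mem (mem_nhdsWithin_of_mem_nhds
          ((isOpen_lt (by fun_prop) continuous_const).mem_nhds (by simp))) self_mem_nhdsWithin
      · filter_upwards [hunif (|p.1| + 1) ε hε] with n hn q hq
        exact hn q.1 (le_of_lt hq.1) q.2 hq.2.2
    · intro t
      refine TendstoLocallyUniformlyOn.differentiableOn (F := fun n => W n t) (φ := atTop) ?_
        (Eventually.of_forall fun n => (hol _ (hWA n)).hol t) (isOpen_strip σ)
      refine TendstoUniformlyOn.tendstoLocallyUniformlyOn ?_
      rw [Metric.tendstoUniformlyOn_iff]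
      intro ε hε
      filter_upwards [hunif |t| ε hε] with n hn z hz
      exact hn t le_rfl z hz
  have hwA : w ∈ A := hclosed W w hWA hwH hwlim
  refine ⟨w, hwA, fun t z hz => ?_⟩
  have h1 : Tendsto (fun n => W (n + 1) t z) atTop (𝓝 (w t z)) :=
    (hwlim t z hz).comp (tendsto_add_atTop_nat 1)
  refine tendsto_nhds_unique (tendsto_iff_dist_tendsto_zero.2 ?_) h1
  refine squeeze_zero (fun _ => dist_nonneg) (fun n => ?_)
    (hpow (C * Real.exp (lam * |t|)))
  rw [dist_eq_norm, hWs]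
  refine (hcontr _ (hWA n) _ hwA (2 * C / 2 ^ n) (by positivity) (fun t z hz => ?_) t z hz).trans
    (le_of_eq ?_)
  · rw [← dist_eq_norm]
    exact (htail n t z hz).trans (le_of_eq (by ring))
  · field_simp

/-- A bound that improves from `D` to `D / 2 + d` whenever it holds improves to `2 d`. This is
Grönwall's inequality in disguise: the contraction comes from the weight `g`. -/
theorem le_two_mul_of_contraction {X : Type*} {s : Set X} {f g : X → ℝ} {C d : ℝ} (hC : 0 ≤ C)
    (hd : 0 ≤ d) (h₀ : ∀ x ∈ s, f x ≤ C * g x)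
    (step : ∀ D : ℝ, 0 ≤ D → (∀ x ∈ s, f x ≤ D * g x) → ∀ x ∈ s, f x ≤ (D / 2 + d) * g x) :
    ∀ x ∈ s, f x ≤ 2 * d * g x := by
  have key : ∀ n : ℕ, ∀ x ∈ s, f x ≤ (C / 2 ^ n + 2 * d * (1 - 1 / 2 ^ n)) * g x := by
    intro n
    induction n with
    | zero => simpa using h₀
    | succ n ih =>
      intro x hx
      have h1 : (1 : ℝ) / 2 ^ n ≤ 1 := by
        rw [div_le_one (by positivity)]; exact one_le_pow₀ (by norm_num)
      have := step _ (add_nonneg (by positivity) (mul_nonneg (by positivity) (by linarith))) ih x hx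
      convert this using 2
      rw [pow_succ]; field_simp; ring
  intro x hx
  have hpow : Tendsto (fun n : ℕ => (1 : ℝ) / 2 ^ n) atTop (𝓝 0) := by
    have := tendsto_pow_atTop_nhds_zero_of_lt_one (r := (1/2 : ℝ)) (by norm_num) (by norm_num)
    simpa using this
  have hl : Tendsto (fun n : ℕ => (C * (1 / 2 ^ n) + 2 * d * (1 - 1 / 2 ^ n)) * g x) atTop
      (𝓝 ((C * 0 + 2 * d * (1 - 0)) * g x)) :=
    ((hpow.const_mul C).add ((hpow.const_sub 1).const_mul _)).mul_const _
  have := ge_of_tendsto' hl fun n => (key n x hx).trans (le_of_eq (by ring))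
  simpa using this

end Weighted

/-! ### Transport equations and linear systems in the strip -/

/-- The mild solution of `∂ₜ w + c ∂_z w = f`, `w(0) = w₀`. -/
noncomputable def mild (c : ℝ) (w₀ : ℂ → ℂ) (f : ℝ → ℂ → ℂ) (t : ℝ) (z : ℂ) : ℂ :=
  w₀ (z - (c * t : ℝ)) + duhamel c f t z

section Mild
variable {σ c : ℝ} {w₀ : ℂ → ℂ} {f g : ℝ → ℂ → ℂ}

theorem stripHol_mild (hw : DifferentiableOn ℂ w₀ (strip σ)) (hf : StripHol σ f) :
    StripHol σ (mild c w₀ f) := (StripHol.translate hw c).add (hf.stripHol_duhamel c)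

theorem mild_zero (z : ℂ) : mild c w₀ f 0 z = w₀ z := by simp [mild, duhamel]

theorem mild_sub (hf : StripHol σ f) (hg : StripHol σ g) (t : ℝ)
    {z : ℂ} (hz : z ∈ strip σ) :
    mild c w₀ f t z - mild c w₀ g t z = duhamel c (fun s ζ => f s ζ - g s ζ) t z := by
  simp only [mild, add_sub_add_left_eq_sub, duhamel]
  rw [← intervalIntegral.integral_sub]
  · exact (hf.continuous_char hz continuous_id (by fun_prop)).intervalIntegrable _ _
  · exact (hg.continuous_char hz continuous_id (by fun_prop)).intervalIntegrable _ _

theorem duhamel_congr (h : ∀ t, ∀ z ∈ strip σ, f t z = g t z) {t : ℝ} {z : ℂ} (hz : z ∈ strip σ) :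
    duhamel c f t z = duhamel c g t z :=
  intervalIntegral.integral_congr fun s _ => h s _ (sub_real_mem_strip hz _)

theorem hasDerivAt_mild_space (hw : DifferentiableOn ℂ w₀ (strip σ)) (hf : StripHol σ f) (t : ℝ)
    {z : ℂ} (hz : z ∈ strip σ) :
    HasDerivAt (mild c w₀ f t) (mild c (deriv w₀) (fun s z => deriv (f s) z) t z) z := by
  have h1 : HasDerivAt w₀ (deriv w₀ (z - (c * t : ℝ))) (z - (c * t : ℝ)) :=
    (hw.differentiableAt ((isOpen_strip σ).mem_nhds (sub_real_mem_strip hz _))).hasDerivAt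
  exact (h1.comp_sub_const z _).add (hf.hasDerivAt_duhamel c t hz)

theorem hasDerivAt_mild (hw : DifferentiableOn ℂ w₀ (strip σ)) (hf : StripHol σ f) (t : ℝ)
    {z : ℂ} (hz : z ∈ strip σ) :
    HasDerivAt (fun t => mild c w₀ f t z) (f t z - c * deriv (mild c w₀ f t) z) t := by
  have h1 : HasDerivAt w₀ (deriv w₀ (z - (c * t : ℝ))) (z - (c * t : ℝ)) :=
    (hw.differentiableAt ((isOpen_strip σ).mem_nhds (sub_real_mem_strip hz _))).hasDerivAt
  have h2 : HasDerivAt (fun t : ℝ => z - ((c * t : ℝ) : ℂ)) (-c) t := by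
    have := (((hasDerivAt_id t).const_mul c).ofReal_comp).const_sub z
    simpa using this
  have h3 := (h1.comp t h2).add (hf.hasDerivAt_duhamel_time c t hz)
  have h4 : deriv (mild c w₀ f t) z = deriv w₀ (z - (c * t : ℝ)) + deriv (duhamel c f t) z := by
    rw [(hasDerivAt_mild_space hw hf t hz).deriv, (hf.hasDerivAt_duhamel c t hz).deriv, mild]
  rw [h4]
  refine h3.congr_deriv ?_
  rw [smul_eq_mul]
  ring

end Mild

/-- Global solvability, in the strip, of linear hyperbolic systems in diagonal form with bounded
holomorphic coefficients. -/
theorem exists_linear_solution {σ K B D : ℝ} {ι : Type*} [Fintype ι] (c : ι → ℝ)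
    (a : ι → ι → ℝ → ℂ → ℂ) (b : ι → ℝ → ℂ → ℂ) (w₀ : ι → ℂ → ℂ) (hK : 0 ≤ K) (hB : 0 ≤ B)
    (hD : 0 ≤ D) (ha : ∀ j k, StripHol σ (a j k)) (hb : ∀ j, StripHol σ (b j))
    (hw : ∀ j, DifferentiableOn ℂ (w₀ j) (strip σ))
    (haK : ∀ j k t, ∀ z ∈ strip σ, ‖a j k t z‖ ≤ K) (hbB : ∀ j t, ∀ z ∈ strip σ, ‖b j t z‖ ≤ B)
    (hwD : ∀ j, ∀ z ∈ strip σ, ‖w₀ j z‖ ≤ D) :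
    ∃ w : ι → ℝ → ℂ → ℂ, (∀ j, StripHol σ (w j)) ∧
      (∀ j t, ∀ z ∈ strip σ,
        w j t z = mild (c j) (w₀ j) (fun s ζ => b j s ζ + ∑ k, a j k s ζ * w k s ζ) t z) ∧
      ∃ C lam : ℝ, 0 ≤ C ∧ 0 ≤ lam ∧ ∀ j t, ∀ z ∈ strip σ, ‖w j t z‖
        ≤ C * Real.exp (lam * |t|) := by
  set n : ℝ := (Fintype.card ι : ℝ) with hn
  have hn0 : 0 ≤ n := Nat.cast_nonneg _
  set lam : ℝ := 2 * (n * K) + 1 with hlam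
  have hl : 0 < lam := by positivity
  set S : (ℝ → ℂ → ι → ℂ) → ι → ℝ → ℂ → ℂ := fun w j s ζ => b j s ζ + ∑ k, a j k s ζ * w s ζ k
    with hS
  set T : (ℝ → ℂ → ι → ℂ) → ℝ → ℂ → ι → ℂ := fun w t z j => mild (c j) (w₀ j) (S w j) t z with hT
  set M : ℝ := 2 * (D + B / lam) with hM
  have hM0 : 0 ≤ M := by positivity
  set A : Set (ℝ → ℂ → ι → ℂ) := {w | StripHol σ w ∧
    ∀ t, ∀ z ∈ strip σ, ‖w t z‖ ≤ M * Real.exp (lam * |t|)} with hA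
  have hSH : ∀ w, StripHol σ w → ∀ j, StripHol σ (S w j) := fun w hw j =>
    (hb j).add (StripHol.sum _ fun k _ => (ha j k).mul (hw.apply k))
  have hone : ∀ t : ℝ, 1 ≤ Real.exp (lam * |t|) := fun t => Real.one_le_exp (by positivity)
  -- the linear part gains a factor `n K / λ ≤ 1/2`
  have hgain : ∀ (v : ℝ → ℂ → ι → ℂ) (d : ℝ), 0 ≤ d →
      (∀ t, ∀ z ∈ strip σ, ‖v t z‖ ≤ d * Real.exp (lam * |t|)) → ∀ j t, ∀ z ∈ strip σ,
      ‖duhamel (c j) (fun s ζ => ∑ k, a j k s ζ * v s ζ k) t z‖ ≤ d / 2 * Real.exp (lam * |t|) := by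
    intro v d hd hv j t z hz
    refine (norm_duhamel_le_exp (H := n * (K * d)) (lam := lam) (σ := σ) (by positivity) hl
      (fun s _ ζ hζ => ?_) hz).trans ?_
    · refine (norm_sum_le _ _).trans ?_
      have : ∀ k ∈ Finset.univ, ‖a j k s ζ * v s ζ k‖ ≤ K * (d * Real.exp (lam * |s|)) := by
        intro k _
        rw [norm_mul]
        exact mul_le_mul (haK j k s ζ hζ) ((norm_le_pi_norm _ k).trans (hv s ζ hζ))
          (norm_nonneg _) hK
      refine (Finset.sum_le_card_nsmul _ _ _ this).trans (le_of_eq ?_)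
      rw [nsmul_eq_mul, Finset.card_univ, ← hn]; ring
    · refine mul_le_mul_of_nonneg_right ?_ (Real.exp_pos _).le
      rw [div_le_div_iff₀ hl (by norm_num), hlam]
      nlinarith
  have hTsub : ∀ v w, StripHol σ v → StripHol σ w → ∀ j t, ∀ z ∈ strip σ, T v t z j - T w t z j
      = duhamel (c j) (fun s ζ => ∑ k, a j k s ζ * (v s ζ - w s ζ) k) t z := by
    intro v w hv hw j t z hz
    simp only [hT, mild, add_sub_add_left_eq_sub, duhamel]
    rw [← intervalIntegral.integral_sub]
    · refine intervalIntegral.integral_congr fun s _ => ?_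
      simp only [hS, add_sub_add_left_eq_sub, ← Finset.sum_sub_distrib, Pi.sub_apply, mul_sub]
    · exact ((hSH v hv j).continuous_char hz continuous_id (by fun_prop)).intervalIntegrable _ _
    · exact ((hSH w hw j).continuous_char hz continuous_id (by fun_prop)).intervalIntegrable _ _
  have hTzero : ∀ j t, ∀ z ∈ strip σ,
      ‖T (fun _ _ => 0) t z j‖ ≤ (D + B / lam) * Real.exp (lam * |t|) := by
    intro j t z hz
    simp only [hT, mild, hS, Pi.zero_apply, mul_zero, Finset.sum_const_zero, add_zero]
    refine (norm_add_le _ _).trans ?_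
    rw [add_mul]
    refine add_le_add ?_ (norm_duhamel_le_exp hB hl (fun s _ ζ hζ => ?_) hz)
    · have := hwD j _ (sub_real_mem_strip hz (c j * t))
      nlinarith [hone t]
    · have := hbB j s ζ hζ
      nlinarith [hone s]
  have hTw : ∀ w ∈ A, ∀ j t, ∀ z ∈ strip σ, ‖T w t z j‖ ≤ M * Real.exp (lam * |t|) := by
    intro w hw j t z hz
    have h1 : T w t z j = T (fun _ _ => 0) t z j + (T w t z j - T (fun _ _ => 0) t z j) := by ring
    rw [h1, hTsub w _ hw.1 StripHol.zero j t z hz]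
    refine (norm_add_le _ _).trans ?_
    have h2 := hgain (fun s ζ => w s ζ - 0) M hM0
      (fun t z hz => by simpa using hw.2 t z hz) j t z hz
    have h3 := hTzero j t z hz
    have h4 : D + B / lam = M / 2 := by rw [hM]; ring
    rw [h4] at h3
    linarith
  obtain ⟨w, hwA, hfix⟩ := exists_fixedPoint_weighted (σ := σ) (lam := lam) (C := M) A T
    (w₀ := fun _ _ => 0)
    ⟨StripHol.zero, fun t z hz => by rw [norm_zero]; positivity⟩
    (fun w hw' => ⟨StripHol.pi fun j => stripHol_mild (hw j) (hSH w hw'.1 j), fun t z hz =>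
      (pi_norm_le_iff_of_nonneg (by positivity)).2 fun j => hTw w hw' j t z hz⟩)
    (fun w hw => hw.1)
    (fun W w hW hw hlim => ⟨hw, fun t z hz =>
      le_of_tendsto' (hlim t z hz).norm fun n => (hW n).2 t z hz⟩)
    (fun t z hz => by
      rw [sub_zero]
      refine (pi_norm_le_iff_of_nonneg (by positivity)).2 fun j => (hTzero j t z hz).trans ?_
      have : D + B / lam ≤ M := by rw [hM]; have : 0 ≤ D + B / lam := by positivity
                                   linarith
      gcongr)
    (fun v hv w hw d hd hvw t z hz => by
      refine (pi_norm_le_iff_of_nonneg (by positivity)).2 fun j => ?_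
      rw [Pi.sub_apply, hTsub v w hv.1 hw.1 j t z hz]
      exact hgain (fun s ζ => v s ζ - w s ζ) d hd hvw j t z hz)
  refine ⟨fun j t z => w t z j, fun j => hwA.1.apply j, fun j t z hz => ?_, M, lam, hM0, hl.le,
    fun j t z hz => (norm_le_pi_norm _ j).trans (hwA.2 t z hz)⟩
  exact (congrFun (hfix t z hz) j).symm

/-! ### Energy on light cones -/

/-- `f` is continuously differentiable on `ℝ × ℝ`, with partial derivatives `ft` and `fx`. -/
structure IsC1 {E : Type*} [NormedAddCommGroup E] [NormedSpace ℝ E] (f ft fx : ℝ → ℝ → E) :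
    Prop where
  cont : Continuous (Function.uncurry f)
  cont_t : Continuous (Function.uncurry ft)
  cont_x : Continuous (Function.uncurry fx)
  dt : ∀ t x, HasDerivAt (fun t => f t x) (ft t x) t
  dx : ∀ t x, HasDerivAt (f t) (fx t x) x

namespace IsC1
variable {E : Type*} [NormedAddCommGroup E] [NormedSpace ℝ E] {f ft fx g gt gx : ℝ → ℝ → E}

theorem hasFDerivAt (h : IsC1 f ft fx) (t x : ℝ) :
    HasFDerivAt (Function.uncurry f) ((ContinuousLinearMap.toSpanSingleton ℝ (ft t x)).coprod
      (ContinuousLinearMap.toSpanSingleton ℝ (fx t x))) (t, x) :=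
  (hasStrictFDerivAt_uncurry_coprod (𝕜 := ℝ) (u := (t, x)) (f := f)
    (f₁ := fun t r => ContinuousLinearMap.toSpanSingleton ℝ (ft t r))
    (f₂ := fun t r => ContinuousLinearMap.toSpanSingleton ℝ (fx t r))
    (Eventually.of_forall fun v => (h.dt v.1 v.2).hasFDerivAt)
    (Eventually.of_forall fun v => (h.dx v.1 v.2).hasFDerivAt)
    (((ContinuousLinearMap.toSpanSingletonCLE (𝕜 := ℝ) (E := E)).continuous.comp
      h.cont_t).continuousAt)
    (((ContinuousLinearMap.toSpanSingletonCLE (𝕜 := ℝ) (E := E)).continuous.comp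
      h.cont_x).continuousAt)).hasFDerivAt

theorem hasDerivAt_path (h : IsC1 f ft fx) {b : ℝ → ℝ} {b' s : ℝ} (hb : HasDerivAt b b' s) :
    HasDerivAt (fun s => f s (b s)) (ft s (b s) + b' • fx s (b s)) s := by
  have := (h.hasFDerivAt s (b s)).comp_hasDerivAt s ((hasDerivAt_id s).prodMk hb)
  simpa [Function.comp_def, Function.uncurry] using this

/-- Reflection in time and space, which reduces negative times to positive ones while keeping the
characteristic speeds. -/
theorem reflect (h : IsC1 f ft fx) :
    IsC1 (fun t x => f (-t) (-x)) (fun t x => -ft (-t) (-x)) (fun t x => -fx (-t) (-x)) where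
  cont := h.cont.comp (g := Function.uncurry f) (f := fun p : ℝ × ℝ => (-p.1, -p.2)) (by fun_prop)
  cont_t := (h.cont_t.comp (g := Function.uncurry ft) (f := fun p : ℝ × ℝ => (-p.1, -p.2))
    (by fun_prop)).neg
  cont_x := (h.cont_x.comp (g := Function.uncurry fx) (f := fun p : ℝ × ℝ => (-p.1, -p.2))
    (by fun_prop)).neg
  dt t x := by
    have := (h.dt (-t) (-x)).scomp t (hasDerivAt_neg t)
    simpa [Function.comp_def] using this
  dx t x := by
    have := (h.dx (-t) (-x)).scomp x (hasDerivAt_neg x)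
    simpa [Function.comp_def] using this

theorem neg (h : IsC1 f ft fx) :
    IsC1 (fun t x => -f t x) (fun t x => -ft t x) (fun t x => -fx t x) where
  cont := h.cont.neg
  cont_t := h.cont_t.neg
  cont_x := h.cont_x.neg
  dt t x := (h.dt t x).neg
  dx t x := (h.dx t x).neg

theorem sub (h : IsC1 f ft fx) (h' : IsC1 g gt gx) :
    IsC1 (fun t x => f t x - g t x) (fun t x => ft t x - gt t x) (fun t x => fx t x - gx t x) where
  cont := h.cont.sub h'.cont
  cont_t := h.cont_t.sub h'.cont_t
  cont_x := h.cont_x.sub h'.cont_x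
  dt t x := (h.dt t x).sub (h'.dt t x)
  dx t x := (h.dx t x).sub (h'.dx t x)

end IsC1

theorem StripHol.isC1 {E : Type*} [NormedAddCommGroup E] [NormedSpace ℂ E] [CompleteSpace E] {σ : ℝ}
    {f g : ℝ → ℂ → E} (hf : StripHol σ f) (hg : StripHol σ g)
    (h : ∀ t, ∀ z ∈ strip σ, HasDerivAt (fun t => f t z) (g t z) t) {y : ℝ} (hy : |y| < σ) :
    IsC1 (fun t x : ℝ => f t (x + y * Complex.I)) (fun t x : ℝ => g t (x + y * Complex.I))
      (fun t x : ℝ => deriv (f t) (x + y * Complex.I)) where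
  cont := hf.continuous_line hy
  cont_t := hg.continuous_line hy
  cont_x := hf.deriv.continuous_line hy
  dt t x := h t _ (line_mem_strip hy x)
  dx t x := by
    have h1 := (hf.differentiableAt t (line_mem_strip hy x)).hasDerivAt
    have h2 : HasDerivAt (fun x : ℝ => (x : ℂ) + y * Complex.I) 1 x := by
      simpa using (Complex.ofRealCLM.hasDerivAt (x := x)).add_const (y * Complex.I)
    simpa [Function.comp_def] using h1.scomp x h2

section Cone
variable {E : Type*} [NormedAddCommGroup E] [NormedSpace ℝ E] [CompleteSpace E]

/-- Divergence theorem on backward light cones, in differentiated form. -/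
theorem hasDerivAt_cone_integral {P Pt Px Q Qt Qx : ℝ → ℝ → E} (hP : IsC1 P Pt Px)
    (hQ : IsC1 Q Qt Qx) (t x s : ℝ) :
    HasDerivAt (fun s => ∫ y in (x - (t - s))..(x + (t - s)), P s y)
      ((∫ y in (x - (t - s))..(x + (t - s)), (Pt s y + Qx s y))
        - (P s (x + (t - s)) + Q s (x + (t - s))) - (P s (x - (t - s)) - Q s (x - (t - s)))) s := by
  set K : ℝ → ℝ → E := fun s b => ∫ y in x..b, P s y with hK
  set K₁ : ℝ → ℝ → E := fun s b => ∫ y in x..b, Pt s y with hK₁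
  have cP : ∀ s, Continuous (P s) := fun s =>
    hP.cont.comp (by fun_prop : Continuous fun y => (s, y))
  have cPt : ∀ s, Continuous (Pt s) := fun s =>
    hP.cont_t.comp (by fun_prop : Continuous fun y => (s, y))
  have cQx : ∀ s, Continuous (Qx s) := fun s =>
    hQ.cont_x.comp (by fun_prop : Continuous fun y => (s, y))
  have hKC : IsC1 K K₁ P := by
    refine ⟨?_, ?_, hP.cont, fun s b => ?_, fun s b => ?_⟩
    · exact intervalIntegral.continuous_parametric_intervalIntegral_of_continuous
        (f := fun (p : ℝ × ℝ) y => P p.1 y) (s := fun p => p.2)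
        (hP.cont.comp (by fun_prop : Continuous fun q : (ℝ × ℝ) × ℝ => (q.1.1, q.2))) (by fun_prop)
    · exact intervalIntegral.continuous_parametric_intervalIntegral_of_continuous
        (f := fun (p : ℝ × ℝ) y => Pt p.1 y) (s := fun p => p.2)
        (hP.cont_t.comp (by fun_prop : Continuous fun q : (ℝ × ℝ) × ℝ => (q.1.1, q.2)))
          (by fun_prop)
    · obtain ⟨B, hB⟩ := ((isCompact_closedBall s 1).prod
        (isCompact_uIcc (a := x) (b := b))).exists_bound_of_continuousOn
        hP.cont_t.continuousOn
      refine (intervalIntegral.hasDerivAt_integral_of_dominated_loc_of_deriv_le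
        (F := P) (F' := Pt) (bound := fun _ => B)
        (s := Metric.ball s 1) (Metric.ball_mem_nhds s one_pos)
        (Eventually.of_forall fun s => (cP s).aestronglyMeasurable)
        ((cP s).intervalIntegrable _ _) (cPt s).aestronglyMeasurable
        (Eventually.of_forall fun y hy r hr => hB (r, y) ⟨Metric.ball_subset_closedBall hr,
          uIoc_subset_uIcc hy⟩) intervalIntegrable_const
        (Eventually.of_forall fun y _ r _ => hP.dt r y)).2
    · exact intervalIntegral.integral_hasDerivAt_right ((cP s).intervalIntegrable _ _)
        ((cP s).stronglyMeasurableAtFilter _ _) (cP s).continuousAt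
  have hr : HasDerivAt (fun s : ℝ => x + (t - s)) (-1) s := by
    simpa using ((hasDerivAt_id s).const_sub t).const_add x
  have hl : HasDerivAt (fun s : ℝ => x - (t - s)) 1 s := by
    simpa using ((hasDerivAt_id s).const_sub t).const_sub x
  have h := (hKC.hasDerivAt_path hr).sub (hKC.hasDerivAt_path hl)
  have e : (fun s => ∫ y in (x - (t - s))..(x + (t - s)), P s y)
      = fun s => K s (x + (t - s)) - K s (x - (t - s)) := by
    ext s
    rw [hK, intervalIntegral.integral_interval_sub_left ((cP s).intervalIntegrable _ _)
      ((cP s).intervalIntegrable _ _)]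
  rw [e]
  refine h.congr_deriv ?_
  rw [intervalIntegral.integral_add ((cPt s).intervalIntegrable _ _)
    ((cQx s).intervalIntegrable _ _), intervalIntegral.integral_eq_sub_of_hasDerivAt
    (fun y _ => hQ.dx s y) ((cQx s).intervalIntegrable _ _)]
  have e2 : ∫ y in (x - (t - s))..(x + (t - s)), Pt s y
    = K₁ s (x + (t - s)) - K₁ s (x - (t - s)) := by
    rw [hK₁, intervalIntegral.integral_interval_sub_left ((cPt s).intervalIntegrable _ _)
      ((cPt s).intervalIntegrable _ _)]
  rw [e2]
  simp only [neg_smul, one_smul]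
  abel

end Cone

/-- Energy inequality on a truncated backward light cone with apex `(t, x)`: energy at time `t₁`
plus the flux through the two sides is bounded by the initial energy. -/
theorem cone_energy {P Pt Px Q Qt Qx : ℝ → ℝ → ℝ} (hP : IsC1 P Pt Px) (hQ : IsC1 Q Qt Qx)
    {k t t₁ x : ℝ} (ht₁ : 0 ≤ t₁) (ht : t₁ ≤ t)
    (hD : ∀ s ∈ Icc 0 t₁, ∀ y, |y - x| ≤ t - s → Pt s y + Qx s y ≤ k * P s y) :
    Real.exp (-k * t₁) * (∫ y in (x - (t - t₁))..(x + (t - t₁)), P t₁ y)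
      + (∫ s in (0 : ℝ)..t₁, Real.exp (-k * s) *
        ((P s (x + (t - s)) + Q s (x + (t - s))) + (P s (x - (t - s)) - Q s (x - (t - s)))))
      ≤ ∫ y in (x - t)..(x + t), P 0 y := by
  set fl : ℝ → ℝ := fun s => Real.exp (-k * s) *
        ((P s (x + (t - s)) + Q s (x + (t - s))) + (P s (x - (t - s)) - Q s (x - (t - s)))) with hfl
  set I : ℝ → ℝ := fun s => ∫ y in (x - (t - s))..(x + (t - s)), P s y with hI
  have cflP : ∀ {f ft fx : ℝ → ℝ → ℝ}, IsC1 f ft fx →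
      Continuous (fun s => f s (x + (t - s))) ∧ Continuous fun s => f s (x - (t - s)) :=
    fun h => ⟨h.cont.comp (by fun_prop : Continuous fun s => (s, x + (t - s))),
      h.cont.comp (by fun_prop : Continuous fun s => (s, x - (t - s)))⟩
  have hflc : Continuous fl :=
    (by fun_prop : Continuous fun s => Real.exp (-k * s)).mul
      (((cflP hP).1.add (cflP hQ).1).add ((cflP hP).2.sub (cflP hQ).2))
  have cP : ∀ s, Continuous (P s) := fun s =>
    hP.cont.comp (by fun_prop : Continuous fun y => (s, y))
  have cD : ∀ s, Continuous fun y => Pt s y + Qx s y := fun s =>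
    (hP.cont_t.comp (by fun_prop : Continuous fun y => (s, y))).add
      (hQ.cont_x.comp (by fun_prop : Continuous fun y => (s, y)))
  have hder : ∀ s, HasDerivAt (fun s => Real.exp (-k * s) * I s + ∫ r in (0 : ℝ)..s, fl r)
      (Real.exp (-k * s) * ((∫ y in (x - (t - s))..(x + (t - s)), (Pt s y + Qx s y))
        - k * I s)) s := by
    intro s
    have h1 : HasDerivAt (fun s : ℝ => Real.exp (-k * s)) (Real.exp (-k * s) * (-k)) s := by
      simpa using ((hasDerivAt_id s).const_mul (-k)).exp
    have h2 := h1.mul (hasDerivAt_cone_integral hP hQ t x s)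
    have h3 := intervalIntegral.integral_hasDerivAt_right (hflc.intervalIntegrable 0 s)
      (hflc.stronglyMeasurableAtFilter _ _) hflc.continuousAt
    refine (h2.add h3).congr_deriv ?_
    simp only [hfl, hI]
    ring
  have hanti : AntitoneOn (fun s => Real.exp (-k * s) * I s + ∫ r in (0 : ℝ)..s, fl r)
      (Icc 0 t₁) := by
    refine antitoneOn_of_deriv_nonpos (convex_Icc _ _)
      (fun s _ => (hder s).continuousAt.continuousWithinAt)
      (fun s _ => (hder s).differentiableAt.differentiableWithinAt) fun s hs => ?_
    rw [interior_Icc] at hs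
    rw [(hder s).deriv]
    refine mul_nonpos_of_nonneg_of_nonpos (Real.exp_pos _).le (sub_nonpos.2 ?_)
    rw [hI, ← intervalIntegral.integral_const_mul]
    refine intervalIntegral.integral_mono_on (by linarith [hs.2]) ((cD s).intervalIntegrable _ _)
      (((cP s).const_mul k).intervalIntegrable _ _) fun y hy => ?_
    exact hD s ⟨hs.1.le, hs.2.le⟩ y (abs_le.2 ⟨by linarith [hy.1], by linarith [hy.2]⟩)
  have := hanti (left_mem_Icc.2 ht₁) (right_mem_Icc.2 ht₁) ht₁
  simpa [hI] using this

section System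
variable {ι : Type*} [Fintype ι]

theorem IsC1.norm_sq {f ft fx : ℝ → ℝ → ℂ} (h : IsC1 f ft fx) :
    IsC1 (fun t x => ‖f t x‖ ^ 2) (fun t x => 2 * inner ℝ (f t x) (ft t x))
      (fun t x => 2 * inner ℝ (f t x) (fx t x)) where
  cont := h.cont.norm.pow 2
  cont_t := (h.cont.inner h.cont_t).const_mul 2
  cont_x := (h.cont.inner h.cont_x).const_mul 2
  dt t x := (h.dt t x).norm_sq
  dx t x := (h.dx t x).norm_sq

theorem IsC1.sum_smul {f ft fx : ι → ℝ → ℝ → ℝ} (h : ∀ j, IsC1 (f j) (ft j) (fx j)) (c : ι → ℝ) :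
    IsC1 (fun t x => ∑ j, c j * f j t x) (fun t x => ∑ j, c j * ft j t x)
      (fun t x => ∑ j, c j * fx j t x) where
  cont := continuous_finsetSum _ fun j _ => (h j).cont.const_mul (c j)
  cont_t := continuous_finsetSum _ fun j _ => (h j).cont_t.const_mul (c j)
  cont_x := continuous_finsetSum _ fun j _ => (h j).cont_x.const_mul (c j)
  dt t x := HasDerivAt.fun_sum fun j _ => ((h j).dt t x).const_mul (c j)
  dx t x := HasDerivAt.fun_sum fun j _ => ((h j).dx t x).const_mul (c j)

/-- `L²` energy inequality for diagonal first-order systems on backward light cones. -/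
theorem system_cone_energy {w wt wx : ι → ℝ → ℝ → ℂ} (h : ∀ j, IsC1 (w j) (wt j) (wx j))
    {c : ι → ℝ} (hc : ∀ j, |c j| ≤ 1) {k t t₁ x : ℝ} (ht₁ : 0 ≤ t₁) (ht : t₁ ≤ t)
    (hN : ∀ s ∈ Icc 0 t₁, ∀ y, |y - x| ≤ t - s →
      ∑ j, ‖wt j s y + (c j : ℂ) * wx j s y‖ ^ 2 ≤ k * ∑ j, ‖w j s y‖ ^ 2) :
    ∫ y in (x - (t - t₁))..(x + (t - t₁)), ∑ j, ‖w j t₁ y‖ ^ 2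
      ≤ Real.exp ((1 + k) * t₁) * ∫ y in (x - t)..(x + t), ∑ j, ‖w j 0 y‖ ^ 2 := by
  have hP := IsC1.sum_smul (fun j => (h j).norm_sq) (fun _ => 1)
  have hQ := IsC1.sum_smul (fun j => (h j).norm_sq) c
  have key := cone_energy hP hQ (k := 1 + k) (x := x) ht₁ ht (fun s hs y hy => by
    have hn := hN s hs y hy
    rw [← Finset.sum_add_distrib]
    calc _ ≤ ∑ j, (‖w j s y‖ ^ 2 + ‖wt j s y + (c j : ℂ) * wx j s y‖ ^ 2) := by
          refine Finset.sum_le_sum fun j _ => ?_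
          have e : 1 * (2 * inner ℝ (w j s y) (wt j s y)) + c j * (2 * inner ℝ (w j s y) (wx j s y))
              = 2 * inner ℝ (w j s y) (wt j s y + (c j : ℂ) * wx j s y) := by
            rw [← Complex.real_smul, inner_add_right, inner_smul_right]; ring
          rw [e]
          have h1 := real_inner_le_norm (w j s y) (wt j s y + (c j : ℂ) * wx j s y)
          nlinarith [sq_nonneg (‖w j s y‖ - ‖wt j s y + (c j : ℂ) * wx j s y‖)]
      _ ≤ _ := by
          rw [Finset.sum_add_distrib]
          simp only [one_mul]
          linarith)
  have hfl : 0 ≤ ∫ s in (0 : ℝ)..t₁, Real.exp (-(1 + k) * s) *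
        ((∑ j, 1 * ‖w j s (x + (t - s))‖ ^ 2 + ∑ j, c j * ‖w j s (x + (t - s))‖ ^ 2)
          + (∑ j, 1 * ‖w j s (x - (t - s))‖ ^ 2 - ∑ j, c j * ‖w j s (x - (t - s))‖ ^ 2)) := by
    refine intervalIntegral.integral_nonneg ht₁ fun s _ => mul_nonneg (Real.exp_pos _).le ?_
    rw [← Finset.sum_add_distrib, ← Finset.sum_sub_distrib]
    refine add_nonneg (Finset.sum_nonneg fun j _ => ?_) (Finset.sum_nonneg fun j _ => ?_)
    · rw [← add_mul]; exact mul_nonneg (by linarith [(abs_le.1 (hc j)).1]) (by positivity)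
    · rw [← sub_mul]; exact mul_nonneg (by linarith [(abs_le.1 (hc j)).2]) (by positivity)
  simp only [one_mul] at key hfl
  have h2 : Real.exp (-(1 + k) * t₁) * (∫ y in (x - (t - t₁))..(x + (t - t₁)), ∑ j, ‖w j t₁ y‖ ^ 2)
      ≤ ∫ y in (x - t)..(x + t), ∑ j, ‖w j 0 y‖ ^ 2 := by linarith
  have h3 : Real.exp ((1 + k) * t₁) * Real.exp (-(1 + k) * t₁) = 1 := by
    rw [← Real.exp_add, show (1 + k) * t₁ + -(1 + k) * t₁ = 0 by ring, Real.exp_zero]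
  calc _ = Real.exp ((1 + k) * t₁) * (Real.exp (-(1 + k) * t₁) *
        (∫ y in (x - (t - t₁))..(x + (t - t₁)), ∑ j, ‖w j t₁ y‖ ^ 2)) := by
        rw [← mul_assoc, h3, one_mul]
    _ ≤ _ := by gcongr

end System

/-! ### Charge for the Dirac equation with complex potential -/

theorem IsC1.add {E : Type*} [NormedAddCommGroup E] [NormedSpace ℝ E] {f ft fx g gt gx : ℝ → ℝ → E}
    (h : IsC1 f ft fx) (h' : IsC1 g gt gx) :
    IsC1 (fun t x => f t x + g t x) (fun t x => ft t x + gt t x) (fun t x => fx t x + gx t x) where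
  cont := h.cont.add h'.cont
  cont_t := h.cont_t.add h'.cont_t
  cont_x := h.cont_x.add h'.cont_x
  dt t x := (h.dt t x).add (h'.dt t x)
  dx t x := (h.dx t x).add (h'.dx t x)

theorem IsC1.mul {f ft fx g gt gx : ℝ → ℝ → ℂ} (h : IsC1 f ft fx) (h' : IsC1 g gt gx) :
    IsC1 (fun t x => f t x * g t x) (fun t x => ft t x * g t x + f t x * gt t x)
      (fun t x => fx t x * g t x + f t x * gx t x) where
  cont := h.cont.mul h'.cont
  cont_t := (h.cont_t.mul h'.cont).add (h.cont.mul h'.cont_t)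
  cont_x := (h.cont_x.mul h'.cont).add (h.cont.mul h'.cont_x)
  dt t x := (h.dt t x).mul (h'.dt t x)
  dx t x := (h.dx t x).mul (h'.dx t x)

section Dirac

/-- An imaginary `κ` conserves the charge density; only its real part contributes to the growth. -/
theorem dirac_charge_density (U V κ : ℂ) {η : ℝ} (hκ : |κ.re| ≤ η) :
    2 * inner ℝ U (κ * V) + 2 * inner ℝ V (κ * U) ≤ 2 * η * (‖U‖ ^ 2 + ‖V‖ ^ 2) := by
  have e : 2 * inner ℝ U (κ * V) + 2 * inner ℝ V (κ * U)
      = 4 * (κ.re * (U.re * V.re + U.im * V.im)) := by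
    simp only [Complex.inner, Complex.mul_re, Complex.mul_im, Complex.conj_re, Complex.conj_im]
    ring
  rw [e, Complex.sq_norm, Complex.sq_norm, Complex.normSq_apply, Complex.normSq_apply]
  have h1 : |U.re * V.re + U.im * V.im| ≤
      (U.re * U.re + U.im * U.im + (V.re * V.re + V.im * V.im)) / 2 := by
    rw [abs_le]
    constructor <;> nlinarith [sq_nonneg (U.re - V.re), sq_nonneg (U.im - V.im),
      sq_nonneg (U.re + V.re), sq_nonneg (U.im + V.im)]
  have h2 : κ.re * (U.re * V.re + U.im * V.im) ≤ η * |U.re * V.re + U.im * V.im| := by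
    refine (le_abs_self _).trans ?_
    rw [abs_mul]
    gcongr
  have hη : 0 ≤ η := (abs_nonneg _).trans hκ
  nlinarith

variable {U Ut Ux V Vt Vx κ : ℝ → ℝ → ℂ}

/-- The case `0 ≤ t` of `dirac_charge_bound`. All three bounds come from one cone inequality: the
base of a truncated cone gives the charge, and the two sides of a full cone the fluxes. -/
theorem dirac_forward (hU : IsC1 U Ut Ux) (hV : IsC1 V Vt Vx)
    (eU : ∀ s y, Ut s y + Ux s y = κ s y * V s y) (eV : ∀ s y, Vt s y - Vx s y = κ s y * U s y)
    {η T Q₀ : ℝ} (hη : 0 ≤ η) (hκ : ∀ s, |s| ≤ T → ∀ y, |(κ s y).re| ≤ η)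
    (h₀ : ∀ a b, a ≤ b → ∫ y in a..b, (‖U 0 y‖ ^ 2 + ‖V 0 y‖ ^ 2) ≤ Q₀) {t : ℝ} (ht : 0 ≤ t)
    (htT : t ≤ T) :
    (∀ a b, a ≤ b → ∫ y in a..b, (‖U t y‖ ^ 2 + ‖V t y‖ ^ 2) ≤ Real.exp (2 * η * T) * Q₀) ∧
    (∀ x, ∫ s in (0 : ℝ)..t, ‖U s (x + (t - s))‖ ^ 2 ≤ Real.exp (2 * η * T) * Q₀) ∧
    (∀ x, ∫ s in (0 : ℝ)..t, ‖V s (x - (t - s))‖ ^ 2 ≤ Real.exp (2 * η * T) * Q₀) := by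
  -- charge density and current
  have hP := hU.norm_sq.add hV.norm_sq
  have hQ := hU.norm_sq.sub hV.norm_sq
  have cU : Continuous fun p : ℝ × ℝ => ‖U p.1 p.2‖ ^ 2 := hU.cont.norm.pow 2
  have cV : Continuous fun p : ℝ × ℝ => ‖V p.1 p.2‖ ^ 2 := hV.cont.norm.pow 2
  have key : ∀ (τ x : ℝ), t ≤ τ →
      Real.exp (-(2 * η) * t) * (∫ y in (x - (τ - t))..(x + (τ - t)), (‖U t y‖ ^ 2 + ‖V t y‖ ^ 2))
      + (∫ s in (0 : ℝ)..t, Real.exp (-(2 * η) * s) *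
        (2 * ‖U s (x + (τ - s))‖ ^ 2 + 2 * ‖V s (x - (τ - s))‖ ^ 2)) ≤ Q₀ := by
    intro τ x hτ
    have h := cone_energy hP hQ (k := 2 * η) (x := x) ht hτ (fun s hs y _ => by
      have h1 := dirac_charge_density (U s y) (V s y) (κ s y)
        (hκ s (by rw [abs_of_nonneg hs.1]; exact hs.2.trans htT) y)
      rw [← eU, ← eV, inner_add_right, inner_sub_right] at h1
      linarith)
    refine le_trans (le_of_eq ?_) (h.trans (h₀ _ _ (by linarith)))
    congr 1
    refine intervalIntegral.integral_congr fun s _ => ?_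
    ring
  have hexp : ∀ s, s ≤ t → 1 ≤ Real.exp (2 * η * T) * Real.exp (-(2 * η) * s) := by
    intro s hs
    rw [← Real.exp_add]
    refine Real.one_le_exp ?_
    nlinarith
  have hE := Real.exp_pos (2 * η * T)
  have hint : ∀ (τ x : ℝ) (a b : ℝ), 0 ≤ a → 0 ≤ b → 0 ≤ ∫ s in (0 : ℝ)..t,
    Real.exp (-(2 * η) * s) *
      (a * ‖U s (x + (τ - s))‖ ^ 2 + b * ‖V s (x - (τ - s))‖ ^ 2) := fun τ x a b ha hb =>
    intervalIntegral.integral_nonneg ht fun s _ => by positivity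
  refine ⟨fun a b hab => ?_, fun x => ?_, fun x => ?_⟩
  · have h1 := key (t + (b - a) / 2) ((a + b) / 2) (by linarith)
    have h2 := hint (t + (b - a) / 2) ((a + b) / 2) 2 2 (by norm_num) (by norm_num)
    have ea : (a + b) / 2 - (t + (b - a) / 2 - t) = a := by ring
    have eb : (a + b) / 2 + (t + (b - a) / 2 - t) = b := by ring
    rw [ea, eb] at h1
    have h3 : 0 ≤ ∫ y in a..b, (‖U t y‖ ^ 2 + ‖V t y‖ ^ 2) :=
      intervalIntegral.integral_nonneg hab fun y _ => by positivity
    have h4 := hexp t le_rfl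
    nlinarith [mul_le_mul_of_nonneg_left h1 hE.le]
  · have h1 := key t x le_rfl
    simp only [sub_self, sub_zero, add_zero, intervalIntegral.integral_same, mul_zero,
      zero_add] at h1
    have c1 : Continuous fun s => ‖U s (x + (t - s))‖ ^ 2 :=
      cU.comp (by fun_prop : Continuous fun s => (s, x + (t - s)))
    have c2 : Continuous fun s => ‖V s (x - (t - s))‖ ^ 2 :=
      cV.comp (by fun_prop : Continuous fun s => (s, x - (t - s)))
    calc ∫ s in (0 : ℝ)..t, ‖U s (x + (t - s))‖ ^ 2
        ≤ ∫ s in (0 : ℝ)..t, Real.exp (2 * η * T) * (Real.exp (-(2 * η) * s) *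
          (2 * ‖U s (x + (t - s))‖ ^ 2 + 2 * ‖V s (x - (t - s))‖ ^ 2)) := by
          refine intervalIntegral.integral_mono_on ht (c1.intervalIntegrable _ _)
            (Continuous.intervalIntegrable (by fun_prop) _ _) fun s hs => ?_
          rw [← mul_assoc]
          have := hexp s hs.2
          have h5 : 0 ≤ ‖U s (x + (t - s))‖ ^ 2 := by positivity
          have h6 : 0 ≤ ‖V s (x - (t - s))‖ ^ 2 := by positivity
          nlinarith
      _ ≤ _ := by
          rw [intervalIntegral.integral_const_mul]
          gcongr
  · have h1 := key t x le_rfl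
    simp only [sub_self, sub_zero, add_zero, intervalIntegral.integral_same, mul_zero,
      zero_add] at h1
    have c1 : Continuous fun s => ‖U s (x + (t - s))‖ ^ 2 :=
      cU.comp (by fun_prop : Continuous fun s => (s, x + (t - s)))
    have c2 : Continuous fun s => ‖V s (x - (t - s))‖ ^ 2 :=
      cV.comp (by fun_prop : Continuous fun s => (s, x - (t - s)))
    calc ∫ s in (0 : ℝ)..t, ‖V s (x - (t - s))‖ ^ 2
        ≤ ∫ s in (0 : ℝ)..t, Real.exp (2 * η * T) * (Real.exp (-(2 * η) * s) *
          (2 * ‖U s (x + (t - s))‖ ^ 2 + 2 * ‖V s (x - (t - s))‖ ^ 2)) := by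
          refine intervalIntegral.integral_mono_on ht (c2.intervalIntegrable _ _)
            (Continuous.intervalIntegrable (by fun_prop) _ _) fun s hs => ?_
          rw [← mul_assoc]
          have := hexp s hs.2
          have h5 : 0 ≤ ‖U s (x + (t - s))‖ ^ 2 := by positivity
          have h6 : 0 ≤ ‖V s (x - (t - s))‖ ^ 2 := by positivity
          nlinarith
      _ ≤ _ := by
          rw [intervalIntegral.integral_const_mul]
          gcongr

theorem integral_zero_neg_reflect {E : Type*} [NormedAddCommGroup E] [NormedSpace ℝ E] (g : ℝ → E)
    (t : ℝ) : ∫ s in (0 : ℝ)..t, g s = -∫ s in (0 : ℝ)..(-t), g (-s) := by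
  rw [intervalIntegral.integral_comp_neg, neg_neg, neg_zero, intervalIntegral.integral_symm]

/-- Approximate charge conservation for a Dirac equation on the line with complex potential:
the growth of the charge on time slices, and of its flux through characteristics, is governed by
the real part of `κ` alone. -/
theorem dirac_charge_bound (hU : IsC1 U Ut Ux) (hV : IsC1 V Vt Vx)
    (eU : ∀ s y, Ut s y + Ux s y = κ s y * V s y) (eV : ∀ s y, Vt s y - Vx s y = κ s y * U s y)
    {η T Q₀ : ℝ} (hη : 0 ≤ η) (hκ : ∀ s, |s| ≤ T → ∀ y, |(κ s y).re| ≤ η)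
    (h₀ : ∀ a b, a ≤ b → ∫ y in a..b, (‖U 0 y‖ ^ 2 + ‖V 0 y‖ ^ 2) ≤ Q₀) {t : ℝ} (htT : |t| ≤ T) :
    (∀ a b, a ≤ b → ∫ y in a..b, (‖U t y‖ ^ 2 + ‖V t y‖ ^ 2) ≤ Real.exp (2 * η * T) * Q₀) ∧
    (∀ x, |∫ s in (0 : ℝ)..t, ‖U s (x + (t - s))‖ ^ 2| ≤ Real.exp (2 * η * T) * Q₀) ∧
    (∀ x, |∫ s in (0 : ℝ)..t, ‖V s (x - (t - s))‖ ^ 2| ≤ Real.exp (2 * η * T) * Q₀) := by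
  rcases le_total 0 t with ht | ht
  · obtain ⟨h1, h2, h3⟩ := dirac_forward hU hV eU eV hη hκ h₀ ht ((le_abs_self t).trans htT)
    refine ⟨h1, fun x => ?_, fun x => ?_⟩
    · rw [abs_of_nonneg (intervalIntegral.integral_nonneg ht fun s _ => by positivity)]
      exact h2 x
    · rw [abs_of_nonneg (intervalIntegral.integral_nonneg ht fun s _ => by positivity)]
      exact h3 x
  · obtain ⟨h1, h2, h3⟩ := dirac_forward (κ := fun s y => -κ (-s) (-y)) hU.reflect hV.reflect
      (fun s y => by have := eU (-s) (-y); linear_combination -this)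
      (fun s y => by have := eV (-s) (-y); linear_combination -this) hη
      (fun s hs y => by
        rw [Complex.neg_re, abs_neg]; exact hκ (-s) (by rwa [abs_neg]) (-y))
      (fun a b hab => by
        have := h₀ (-b) (-a) (by linarith)
        rwa [← intervalIntegral.integral_comp_neg, neg_zero.symm] at this)
      (t := -t) (by linarith) ((neg_le_abs t).trans htT)
    simp only [neg_neg] at h1 h2 h3
    refine ⟨fun a b hab => ?_, fun x => ?_, fun x => ?_⟩
    · have := h1 (-b) (-a) (by linarith)
      rwa [intervalIntegral.integral_comp_neg (fun y => ‖U t y‖ ^ 2 + ‖V t y‖ ^ 2), neg_neg,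
        neg_neg] at this
    · rw [integral_zero_neg_reflect, abs_neg,
        abs_of_nonneg (intervalIntegral.integral_nonneg (by linarith) fun s _ => by positivity)]
      refine le_trans (le_of_eq ?_) (h2 (-x))
      refine intervalIntegral.integral_congr fun s _ => ?_
      ring_nf
    · rw [integral_zero_neg_reflect, abs_neg,
        abs_of_nonneg (intervalIntegral.integral_nonneg (by linarith) fun s _ => by positivity)]
      refine le_trans (le_of_eq ?_) (h3 (-x))
      refine intervalIntegral.integral_congr fun s _ => ?_
      ring_nf

end Dirac

/-! ### The Riemann function of the Klein–Gordon equation -/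

/-- The entire functions `∑ₖ (-w)^k / (k! (k+n)!)`; up to elementary factors and the substitution
`w = x² / 4` these are the Bessel functions `J_n`. -/
noncomputable def besselAux (n : ℕ) (w : ℝ) : ℝ := ∑' k : ℕ,
    (-w) ^ k / (k.factorial * (k + n).factorial)

theorem besselAux_summable (n : ℕ) (w : ℝ) :
    Summable fun k : ℕ => (-w) ^ k / ((k.factorial : ℝ) * (k + n).factorial) := by
  refine Summable.of_norm_bounded (Real.summable_pow_div_factorial |w|) fun k => ?_
  rw [norm_div, norm_pow, norm_neg, Real.norm_eq_abs, Real.norm_of_nonneg (by positivity)]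
  have : (1 : ℝ) ≤ (k + n).factorial := by exact_mod_cast Nat.factorial_pos _
  gcongr
  exact le_mul_of_one_le_right (by positivity) this

theorem hasDerivAt_besselAux (n : ℕ) (w : ℝ) :
    HasDerivAt (besselAux n) (-besselAux (n + 1) w) w := by
  set g : ℕ → ℝ → ℝ := fun k w => (-w) ^ k / (k.factorial * (k + n).factorial) with hg
  set g' : ℕ → ℝ → ℝ := fun k w => k * (-w) ^ (k - 1) * (-1) / (k.factorial * (k + n).factorial)
    with hg'
  set u : ℕ → ℝ := fun k => k * (|w| + 1) ^ (k - 1) / k.factorial with hu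
  have hus : Summable u := by
    rw [← summable_nat_add_iff 1]
    refine (Real.summable_pow_div_factorial (|w| + 1)).congr fun k => ?_
    simp only [hu, Nat.add_sub_cancel, Nat.factorial_succ]
    push_cast
    field_simp
  have hd : ∀ k y, HasDerivAt (g k) (g' k y) y := fun k y => by
    have := ((hasDerivAt_neg y).pow k).div_const ((k.factorial : ℝ) * (k + n).factorial)
    refine this.congr_deriv ?_
    simp only [hg']
  have h := hasDerivAt_tsum_of_isPreconnected (t := Metric.ball (0 : ℝ) (|w| + 1)) (g := g)
    (g' := g') (y₀ := w) (y := w) hus Metric.isOpen_ball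
    (convex_ball (0 : ℝ) (|w| + 1)).isPreconnected (fun k y _ => hd k y)
    (fun k y hy => by
      have hy' : |y| ≤ |w| + 1 := by
        simpa [Real.norm_eq_abs] using (mem_ball_zero_iff.1 hy).le
      have h1 : (1 : ℝ) ≤ (k + n).factorial := by exact_mod_cast Nat.factorial_pos _
      simp only [hg', hu, norm_div, norm_mul, norm_pow, norm_neg, Real.norm_eq_abs, abs_one,
        mul_one, Nat.abs_cast]
      gcongr
      exact le_mul_of_one_le_right (by positivity) h1)
    (by simp) (besselAux_summable n w) (by simp)
  refine h.congr_deriv ?_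
  have hs : Summable fun k => g' k w := hus.of_norm_bounded fun k => by
      have h1 : (1 : ℝ) ≤ (k + n).factorial := by exact_mod_cast Nat.factorial_pos _
      simp only [hg', hu, norm_div, norm_mul, norm_pow, norm_neg, Real.norm_eq_abs, abs_one,
        mul_one, Nat.abs_cast]
      gcongr
      · linarith
      · exact le_mul_of_one_le_right (by positivity) h1
  rw [hs.tsum_eq_zero_add, besselAux, ← tsum_neg]
  simp only [hg', Nat.cast_zero, zero_mul, zero_div, zero_add, Nat.add_sub_cancel]
  refine tsum_congr fun k => ?_
  rw [show k + 1 + n = k + (n + 1) by ring, Nat.factorial_succ k]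
  push_cast
  field_simp

/-- Bessel's equation, as a recurrence. -/
theorem besselAux_rec (n : ℕ) (w : ℝ) :
    besselAux n w = (n + 1) * besselAux (n + 1) w - w * besselAux (n + 2) w := by
  have h0 := besselAux_summable n w
  have h1 := (besselAux_summable (n + 1) w).mul_left ((n : ℝ) + 1)
  have e : besselAux n w - (n + 1) * besselAux (n + 1) w
      = ∑' k : ℕ, (k : ℝ) * ((-w) ^ k / (k.factorial * (k + (n + 1)).factorial)) := by
    rw [besselAux, besselAux, ← tsum_mul_left, ← h0.tsum_sub h1]
    refine tsum_congr fun k => ?_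
    rw [show k + (n + 1) = (k + n) + 1 by ring, Nat.factorial_succ (k + n)]
    push_cast
    field_simp
    ring
  have hs : Summable fun k : ℕ => (k : ℝ)
    * ((-w) ^ k / (k.factorial * (k + (n + 1)).factorial)) := by
    refine (h0.sub h1).congr fun k => ?_
    rw [show k + (n + 1) = (k + n) + 1 by ring, Nat.factorial_succ (k + n)]
    push_cast
    field_simp
    ring
  rw [hs.tsum_eq_zero_add] at e
  have e2 : ∑' k : ℕ, ((k + 1 : ℕ) : ℝ)
    * ((-w) ^ (k + 1) / ((k + 1).factorial * (k + 1 + (n + 1)).factorial))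
      = -w * besselAux (n + 2) w := by
    rw [besselAux, ← tsum_mul_left]
    refine tsum_congr fun k => ?_
    rw [show k + 1 + (n + 1) = k + (n + 2) by ring, Nat.factorial_succ k, pow_succ]
    push_cast
    field_simp
  rw [e2] at e
  simp only [Nat.cast_zero, zero_mul, zero_add] at e
  linarith

theorem besselAux_zero_right (n : ℕ) : besselAux n 0 = 1 / n.factorial := by
  rw [besselAux, tsum_eq_single 0]
  · simp
  · intro k hk; simp [hk]

/-- On `[0, ∞)` the quantity `b_n² + w b_{n+1}²` is nonincreasing, whence the bound. -/
theorem abs_besselAux_le_one (n : ℕ) {w : ℝ} (hw : 0 ≤ w) : |besselAux n w| ≤ 1 := by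
  have hd : ∀ v : ℝ, HasDerivAt (fun v => besselAux n v ^ 2 + v * besselAux (n + 1) v ^ 2)
      (-(2 * n + 1) * besselAux (n + 1) v ^ 2) v := by
    intro v
    have := ((hasDerivAt_besselAux n v).pow 2).add
      ((hasDerivAt_id v).mul ((hasDerivAt_besselAux (n + 1) v).pow 2))
    refine this.congr_deriv ?_
    rw [besselAux_rec n v]
    simp only [id_eq, Pi.pow_apply]
    push_cast
    ring
  have hanti : AntitoneOn (fun v => besselAux n v ^ 2 + v * besselAux (n + 1) v ^ 2) (Ici 0) := by
    refine antitoneOn_of_deriv_nonpos (convex_Ici 0)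
      (fun s _ => (hd s).continuousAt.continuousWithinAt)
      (fun s _ => (hd s).differentiableAt.differentiableWithinAt) fun s _ => ?_
    rw [(hd s).deriv]
    have : 0 ≤ besselAux (n + 1) s ^ 2 := sq_nonneg _
    have hn : (0 : ℝ) ≤ n := Nat.cast_nonneg n
    nlinarith
  have h := hanti (mem_Ici.2 le_rfl) (mem_Ici.2 hw) hw
  simp only [zero_mul, add_zero, besselAux_zero_right] at h
  have h1 : (1 : ℝ) / n.factorial ≤ 1 := by
    rw [div_le_one (by positivity)]
    exact_mod_cast Nat.factorial_pos n
  have h2 : (0 : ℝ) ≤ 1 / n.factorial := by positivity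
  rw [← sq_le_one_iff_abs_le_one]
  have h3 : 0 ≤ w * besselAux (n + 1) w ^ 2 := by positivity
  nlinarith

theorem continuous_besselAux (n : ℕ) : Continuous (besselAux n) :=
  continuous_iff_continuousAt.2 fun w => (hasDerivAt_besselAux n w).continuousAt

section KG
variable {φ φt φx p pt px q qt qx F : ℝ → ℝ → ℂ}

/-- Riemann's method for the Klein–Gordon equation, with the bounded Riemann function
`J₀(m √(τ² - y²))`: a sup bound for the solution in terms of the space integrals of the source. The
bound grows only polynomially in `T`, which is what makes the radius of analyticity decay like a
power of `T`. -/
theorem kleinGordon_forward {m : ℝ} (hφ : IsC1 φ φt φx) (hp : IsC1 p pt px) (hq : IsC1 q qt qx)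
    (hF : Continuous (Function.uncurry F)) (e1 : ∀ s y, φt s y = (p s y + q s y) / 2)
    (e2 : ∀ s y, φx s y = (p s y - q s y) / 2)
    (e3 : ∀ s y, pt s y - px s y = F s y - m ^ 2 * φ s y)
    (e4 : ∀ s y, qt s y + qx s y = F s y - m ^ 2 * φ s y) {T C D : ℝ}
    (hFC : ∀ s, |s| ≤ T → ∀ a b, a ≤ b → ∫ y in a..b, ‖F s y‖ ≤ C)
    (h1 : ∀ y, ‖φ 0 y‖ ≤ D) (h2 : ∀ y, ‖p 0 y‖ ≤ D) (h3 : ∀ y, ‖q 0 y‖ ≤ D)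
    {t : ℝ} (ht : 0 ≤ t) (htT : t ≤ T) (x : ℝ) :
    ‖φ t x‖ ≤ D * (1 + T + m ^ 2 * T ^ 2 / 2) + C * T / 2 := by
  have hD : 0 ≤ D := (norm_nonneg _).trans (h1 0)
  have hT : 0 ≤ T := ht.trans htT
  -- with `ρ = m² (τ² - y²) / 4` the Riemann function is `besselAux 0 ρ = J₀(m √(τ² - y²))`
  set μ : ℝ := m ^ 2 / 4 with hμ
  set ρ : ℝ → ℝ → ℝ := fun s y => μ * ((t - s) ^ 2 - (y - x) ^ 2) with hrho
  have hrhos : ∀ s y, HasDerivAt (fun s => ρ s y) (-2 * μ * (t - s)) s := fun s y => by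
    have := ((((hasDerivAt_id s).const_sub t).pow 2).sub_const ((y - x) ^ 2)).const_mul μ
    refine this.congr_deriv ?_
    simp only [id_eq]; push_cast; ring
  have hrhoy : ∀ s y, HasDerivAt (fun y => ρ s y) (-2 * μ * (y - x)) y := fun s y => by
    have := ((((hasDerivAt_id y).sub_const x).pow 2).const_sub ((t - s) ^ 2)).const_mul μ
    refine this.congr_deriv ?_
    simp only [id_eq]; push_cast; ring
  have hrhoc : Continuous fun z : ℝ × ℝ => ρ z.1 z.2 := by simp only [hrho]; fun_prop
  -- the Riemann function `G` and its derivatives, as complex-valued functions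
  have hB : ∀ n : ℕ, IsC1 (fun s y => (besselAux n (ρ s y) : ℂ))
      (fun s y => ((2 * μ * (t - s) * besselAux (n + 1) (ρ s y) : ℝ) : ℂ))
      (fun s y => ((2 * μ * (y - x) * besselAux (n + 1) (ρ s y) : ℝ) : ℂ)) := fun n =>
    { cont := Complex.continuous_ofReal.comp ((continuous_besselAux n).comp hrhoc)
      cont_t := Complex.continuous_ofReal.comp
        ((by fun_prop : Continuous fun z : ℝ × ℝ => 2 * μ * (t - z.1)).mul
          ((continuous_besselAux (n + 1)).comp hrhoc))
      cont_x := Complex.continuous_ofReal.comp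
        ((by fun_prop : Continuous fun z : ℝ × ℝ => 2 * μ * (z.2 - x)).mul
          ((continuous_besselAux (n + 1)).comp hrhoc))
      dt := fun s y => by
        have := ((hasDerivAt_besselAux n (ρ s y)).comp s (hrhos s y)).ofReal_comp
        refine this.congr_deriv ?_
        push_cast; ring
      dx := fun s y => by
        have := ((hasDerivAt_besselAux n (ρ s y)).comp y (hrhoy s y)).ofReal_comp
        refine this.congr_deriv ?_
        push_cast; ring }
  have hlin_s : IsC1 (fun s _ => ((-2 * μ * (t - s) : ℝ) : ℂ)) (fun _ _ => ((2 * μ : ℝ) : ℂ))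
      (fun _ _ => 0) :=
    { cont := by unfold Function.uncurry; fun_prop
      cont_t := continuous_const
      cont_x := continuous_const
      dt := fun s y => by
        have := (((hasDerivAt_id s).const_sub t).const_mul (-2 * μ)).ofReal_comp
        refine this.congr_deriv ?_
        push_cast; ring
      dx := fun s y => hasDerivAt_const _ _ }
  have hlin_y : IsC1 (fun _ y => ((2 * μ * (y - x) : ℝ) : ℂ)) (fun _ _ => 0)
      (fun _ _ => ((2 * μ : ℝ) : ℂ)) :=
    { cont := by unfold Function.uncurry; fun_prop
      cont_t := continuous_const
      cont_x := continuous_const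
      dt := fun s y => hasDerivAt_const _ _
      dx := fun s y => by
        have := (((hasDerivAt_id y).sub_const x).const_mul (2 * μ)).ofReal_comp
        refine this.congr_deriv ?_
        push_cast; ring }
  have hhalf : IsC1 (fun _ _ => (1 / 2 : ℂ)) (fun _ _ => 0) (fun _ _ => 0) :=
    { cont := continuous_const
      cont_t := continuous_const
      cont_x := continuous_const
      dt := fun s y => hasDerivAt_const _ _
      dx := fun s y => hasDerivAt_const _ _ }
  have hP := ((hB 0).mul (hhalf.mul (hp.add hq))).add ((hlin_s.mul (hB 1)).mul hφ)
  have hQ := ((hlin_y.mul (hB 1)).mul hφ).sub ((hB 0).mul (hhalf.mul (hp.sub hq)))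
  -- `J` interpolates between the data at `s = 0` and `2 φ(t, x)` at `s = t`, where the interval of
  -- integration shrinks to a point; `J'` involves only the source.
  set I : ℝ → ℂ := fun s => ∫ y in (x - (t - s))..(x + (t - s)),
    ((besselAux 0 (ρ s y) : ℂ) * (1 / 2 * (p s y + q s y)) +
      ((-2 * μ * (t - s) : ℝ) : ℂ) * (besselAux 1 (ρ s y) : ℂ) * φ s y) with hI
  set J : ℝ → ℂ := fun s => I s + φ s (x + (t - s)) + φ s (x - (t - s)) with hJ
  have hJd : ∀ s, HasDerivAt J (∫ y in (x - (t - s))..(x + (t - s)),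
      (besselAux 0 (ρ s y) : ℂ) * F s y) s := by
    intro s
    have d1 := hasDerivAt_cone_integral hP hQ t x s
    have hr : HasDerivAt (fun s : ℝ => x + (t - s)) (-1) s := by
      simpa using ((hasDerivAt_id s).const_sub t).const_add x
    have hl : HasDerivAt (fun s : ℝ => x - (t - s)) 1 s := by
      simpa using ((hasDerivAt_id s).const_sub t).const_sub x
    have d2 := (d1.add (hφ.hasDerivAt_path hr)).add (hφ.hasDerivAt_path hl)
    refine d2.congr_deriv ?_
    have w1 : ρ s (x + (t - s)) = 0 := by simp only [hrho]; ring
    have w2 : ρ s (x - (t - s)) = 0 := by simp only [hrho]; ring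
    have ei : ∀ y, (besselAux 0 (ρ s y) : ℂ) * F s y
        = (((2 * μ * (t - s) * besselAux (0 + 1) (ρ s y) : ℝ) : ℂ) * (1 / 2 * (p s y + q s y)) +
            (besselAux 0 (ρ s y) : ℂ) * (0 * (p s y + q s y) + 1 / 2 * (pt s y + qt s y)) +
          ((((2 * μ : ℝ) : ℂ) * (besselAux 1 (ρ s y) : ℂ) + ((-2 * μ * (t - s) : ℝ) : ℂ) *
            ((2 * μ * (t - s) * besselAux (1 + 1) (ρ s y) : ℝ) : ℂ)) * φ s y +
            ((-2 * μ * (t - s) : ℝ) : ℂ) * (besselAux 1 (ρ s y) : ℂ) * φt s y)) +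
        ((((2 * μ : ℝ) : ℂ) * (besselAux 1 (ρ s y) : ℂ) + ((2 * μ * (y - x) : ℝ) : ℂ) *
            ((2 * μ * (y - x) * besselAux (1 + 1) (ρ s y) : ℝ) : ℂ)) * φ s y +
            ((2 * μ * (y - x) : ℝ) : ℂ) * (besselAux 1 (ρ s y) : ℂ) * φx s y -
          (((2 * μ * (y - x) * besselAux (0 + 1) (ρ s y) : ℝ) : ℂ) * (1 / 2 * (p s y - q s y)) +
            (besselAux 0 (ρ s y) : ℂ) * (0 * (p s y - q s y) + 1 / 2 * (px s y - qx s y)))) := by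
      intro y
      have hrec := congrArg (fun r : ℝ => (r : ℂ)) (besselAux_rec 0 (ρ s y))
      have hrhov : ρ s y = μ * ((t - s) ^ 2 - (y - x) ^ 2) := rfl
      have hm : (m : ℂ) ^ 2 = 4 * (μ : ℂ) := by rw [hμ]; push_cast; ring
      simp only [Nat.cast_zero, zero_add] at hrec
      rw [e1, e2]
      have h3 := e3 s y
      have h4 := e4 s y
      rw [hm] at h3 h4
      push_cast at hrec ⊢
      have hrhoc' : (ρ s y : ℂ) = μ * (((t : ℂ) - s) ^ 2 - ((y : ℂ) - x) ^ 2) := by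
        rw [hrhov]; push_cast; ring
      rw [hrhoc'] at hrec
      norm_num at hrec ⊢
      linear_combination (-(1/2 : ℂ)) * (besselAux 0 (ρ s y) : ℂ) * (h3 + h4)
        + 4 * (μ : ℂ) * φ s y * hrec
    rw [intervalIntegral.integral_congr fun y _ => ei y]
    rw [w1, w2, e1, e1, e2, e2, besselAux_zero_right, besselAux_zero_right]
    simp only [Nat.factorial, neg_smul, one_smul]
    push_cast
    ring
  have hJt : J t = 2 * φ t x := by simp [hJ, hI]; ring
  have hg1 : ∀ s ∈ Icc 0 t, ∀ y, |y - x| ≤ t - s → ∀ n, ‖(besselAux n (ρ s y) : ℂ)‖ ≤ 1 := by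
    intro s hs y hy n
    rw [Complex.norm_real, Real.norm_eq_abs]
    refine abs_besselAux_le_one n ?_
    have : (y - x) ^ 2 ≤ (t - s) ^ 2 := by rw [← sq_abs (y - x)]; gcongr
    simp only [hrho, hμ]
    have h0 : 0 ≤ m ^ 2 / 4 := by positivity
    nlinarith
  have hJb : ‖J t - J 0‖ ≤ C * (t - 0) := by
    refine norm_image_sub_le_of_norm_deriv_le_segment' (f' := fun s =>
      ∫ y in (x - (t - s))..(x + (t - s)), (besselAux 0 (ρ s y) : ℂ) * F s y)
      (fun s _ => (hJd s).hasDerivWithinAt) (fun s hs => ?_) t (right_mem_Icc.2 ht)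
    have hs' : s ∈ Icc 0 t := ⟨hs.1, hs.2.le⟩
    have cF : Continuous fun y => ‖F s y‖ :=
      (hF.comp (by fun_prop : Continuous fun y => (s, y))).norm
    refine (intervalIntegral.norm_integral_le_of_norm_le (by linarith [hs.2])
      (g := fun y => ‖F s y‖) (Eventually.of_forall fun y hy => ?_)
      (cF.intervalIntegrable _ _)).trans
      (hFC s (by rw [abs_of_nonneg hs.1]; exact hs.2.le.trans htT) _ _ (by linarith [hs.2]))
    rw [norm_mul]
    have := hg1 s hs' y (abs_le.2 ⟨by linarith [hy.1], by linarith [hy.2]⟩) 0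
    exact mul_le_of_le_one_left (norm_nonneg _) this
  have hI0 : ‖I 0‖ ≤ (D + m ^ 2 / 2 * T * D) * |x + (t - 0) - (x - (t - 0))| := by
    refine intervalIntegral.norm_integral_le_of_norm_le_const fun y hy => ?_
    have hy' : y ∈ Icc (x - t) (x + t) := by
      have := uIoc_subset_uIcc hy
      rwa [uIcc_of_le (by linarith), sub_zero] at this
    have hb := hg1 0 ⟨le_rfl, ht⟩ y (abs_le.2 ⟨by linarith [hy'.1], by linarith [hy'.2]⟩)
    refine (norm_add_le _ _).trans (add_le_add ?_ ?_)
    · rw [norm_mul, norm_mul]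
      have h5 : ‖p 0 y + q 0 y‖ ≤ D + D := (norm_add_le _ _).trans (add_le_add (h2 y) (h3 y))
      have h6 := hb 0
      have h7 : ‖(1 / 2 : ℂ)‖ = 1 / 2 := by norm_num
      rw [h7]
      calc _ ≤ 1 * (1 / 2 * (D + D)) := by gcongr
        _ = D := by ring
    · rw [norm_mul, norm_mul, Complex.norm_real, Real.norm_eq_abs]
      have h5 : |-2 * μ * (t - 0)| ≤ m ^ 2 / 2 * T := by
        rw [abs_mul, abs_mul, sub_zero, abs_of_nonneg ht, hμ,
          abs_of_nonneg (by positivity : 0 ≤ m ^ 2 / 4)]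
        norm_num
        nlinarith [sq_nonneg m]
      have h6 := hb 1
      calc _ ≤ (m ^ 2 / 2 * T) * 1 * D := by
            gcongr
            exact h1 y
        _ = _ := by ring
  have hJ0 : ‖J 0‖ ≤ (D + m ^ 2 / 2 * T * D) * (2 * t) + D + D := by
    have : |x + (t - 0) - (x - (t - 0))| = 2 * t := by
      rw [abs_of_nonneg (by linarith)]; ring
    rw [this] at hI0
    exact (norm_add₃_le).trans (add_le_add (add_le_add hI0 (h1 _)) (h1 _))
  have hC : 0 ≤ C := by
    have := hFC 0 (by simpa using hT) 0 0 le_rfl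
    simpa using this
  have h9 : 2 * ‖φ t x‖ ≤ C * t + ((D + m ^ 2 / 2 * T * D) * (2 * t) + D + D) := by
    have e : 2 * φ t x = (J t - J 0) + J 0 := by rw [← hJt]; ring
    have : ‖2 * φ t x‖ ≤ _ := (congrArg norm e).le.trans (norm_add_le _ _)
    rw [norm_mul, Complex.norm_ofNat] at this
    simp only [sub_zero] at hJb
    linarith
  have h10 : C * t ≤ C * T := by gcongr
  have h11 : (D + m ^ 2 / 2 * T * D) * (2 * t) ≤ (D + m ^ 2 / 2 * T * D) * (2 * T) := by gcongr
  nlinarith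

/-- `kleinGordon_forward` in both directions of time. -/
theorem kleinGordon_bound {m : ℝ} (hφ : IsC1 φ φt φx) (hp : IsC1 p pt px) (hq : IsC1 q qt qx)
    (hF : Continuous (Function.uncurry F)) (e1 : ∀ s y, φt s y = (p s y + q s y) / 2)
    (e2 : ∀ s y, φx s y = (p s y - q s y) / 2)
    (e3 : ∀ s y, pt s y - px s y = F s y - m ^ 2 * φ s y)
    (e4 : ∀ s y, qt s y + qx s y = F s y - m ^ 2 * φ s y) {T C D : ℝ}
    (hFC : ∀ s, |s| ≤ T → ∀ a b, a ≤ b → ∫ y in a..b, ‖F s y‖ ≤ C)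
    (h1 : ∀ y, ‖φ 0 y‖ ≤ D) (h2 : ∀ y, ‖p 0 y‖ ≤ D) (h3 : ∀ y, ‖q 0 y‖ ≤ D)
    {t : ℝ} (htT : |t| ≤ T) (x : ℝ) :
    ‖φ t x‖ ≤ D * (1 + T + m ^ 2 * T ^ 2 / 2) + C * T / 2 := by
  rcases le_total 0 t with ht | ht
  · exact kleinGordon_forward hφ hp hq hF e1 e2 e3 e4 hFC h1 h2 h3 ht ((le_abs_self t).trans htT) x
  · have h := kleinGordon_forward (m := m) (F := fun s y => F (-s) (-y)) hφ.reflect hp.reflect.neg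
      hq.reflect.neg (hF.comp (by fun_prop : Continuous fun z : ℝ × ℝ => (-z.1, -z.2)))
      (fun s y => by rw [e1]; ring) (fun s y => by rw [e2]; ring)
      (fun s y => by have := e3 (-s) (-y); linear_combination this)
      (fun s y => by have := e4 (-s) (-y); linear_combination this)
      (T := T) (C := C) (D := D)
      (fun s hs a b hab => by
        have := hFC (-s) (by rwa [abs_neg]) (-b) (-a) (by linarith)
        rwa [← intervalIntegral.integral_comp_neg] at this)
      (fun y => by rw [neg_zero]; exact h1 _) (fun y => by rw [neg_zero, norm_neg]; exact h2 _)
      (fun y => by rw [neg_zero, norm_neg]; exact h3 _) (t := -t) (by linarith)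
      ((neg_le_abs t).trans htT) (-x)
    simpa using h

end KG

/-! ### The Dirac and Klein–Gordon equations in the strip -/

section Solutions
variable {σ : ℝ}

theorem hasDerivAt_of_eq_mild {w f : ℝ → ℂ → ℂ} {w₀ : ℂ → ℂ} {c : ℝ}
    (hw₀ : DifferentiableOn ℂ w₀ (strip σ)) (hf : StripHol σ f)
    (h : ∀ t, ∀ z ∈ strip σ, w t z = mild c w₀ f t z) (t : ℝ) {z : ℂ} (hz : z ∈ strip σ) :
    HasDerivAt (fun t => w t z) (f t z - c * deriv (w t) z) t := by
  have e1 : (fun t => w t z) = fun t => mild c w₀ f t z := funext fun t => h t z hz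
  have e2 : deriv (w t) z = deriv (mild c w₀ f t) z :=
    Filter.EventuallyEq.deriv_eq
      ((eventually_of_mem ((isOpen_strip σ).mem_nhds hz) fun z hz => h t z hz))
  rw [e1, e2]
  exact hasDerivAt_mild hw₀ hf t hz

/-- The potential `i (Φ - M)` of the Dirac equation in diagonal form. -/
def diracPot (M : ℝ) (Φ : ℝ → ℂ → ℂ) (t : ℝ) (z : ℂ) : ℂ := Complex.I * (Φ t z - M)

theorem StripHol.diracPot {Φ : ℝ → ℂ → ℂ} (h : StripHol σ Φ) (M : ℝ) :
    StripHol σ (diracPot M Φ) := (h.sub (StripHol.const (M : ℂ))).const_mul Complex.I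

/-- The quadratic source `u* v + v* u`, which equals `ψ* γ⁰ ψ` on the real line. -/
def dkgSource (u v : ℝ → ℂ → ℂ) (t : ℝ) (z : ℂ) : ℂ :=
  conjRefl u t z * v t z + conjRefl v t z * u t z

theorem StripHol.dkgSource {u v : ℝ → ℂ → ℂ} (hu : StripHol σ u) (hv : StripHol σ v) :
    StripHol σ (dkgSource u v) := (hu.conjRefl.mul hv).add (hv.conjRefl.mul hu)

/-- `(u, v)` solves the Dirac equation with potential `Φ` in the strip, in integrated form. -/
structure DiracSol (σ M : ℝ) (u₀ v₀ : ℂ → ℂ) (Φ u v : ℝ → ℂ → ℂ) : Prop where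
  hu : StripHol σ u
  hv : StripHol σ v
  eu : ∀ t, ∀ z ∈ strip σ, u t z = mild 1 u₀ (fun s ζ => diracPot M Φ s ζ * v s ζ) t z
  ev : ∀ t, ∀ z ∈ strip σ, v t z = mild (-1) v₀ (fun s ζ => diracPot M Φ s ζ * u s ζ) t z

/-- `φ` with `p = (∂ₜ + ∂ₓ) φ` and `q = (∂ₜ - ∂ₓ) φ` solves the Klein–Gordon equation with source
`F` in the strip, in integrated form. -/
structure KGSol (σ m : ℝ) (φ₀ p₀ q₀ : ℂ → ℂ) (F φ p q : ℝ → ℂ → ℂ) : Prop where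
  hφ : StripHol σ φ
  hp : StripHol σ p
  hq : StripHol σ q
  eφ : ∀ t, ∀ z ∈ strip σ, φ t z = mild 0 φ₀ (fun s ζ => (1 / 2 : ℂ) * (p s ζ + q s ζ)) t z
  ep : ∀ t, ∀ z ∈ strip σ, p t z = mild (-1) p₀ (fun s ζ => F s ζ - (m ^ 2 : ℂ) * φ s ζ) t z
  eq : ∀ t, ∀ z ∈ strip σ, q t z = mild 1 q₀ (fun s ζ => F s ζ - (m ^ 2 : ℂ) * φ s ζ) t z

/-- Initial data in the strip of half-width `σ`, bounded by `D` pointwise and in `L²` on horizontal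
lines. The fields `sφ`, `sp`, `sq` say that the scalar data are real on the real line, and `compat`
that `p₀ - q₀ = 2 ∂ₓ φ₀`. -/
structure DKGData (σ D : ℝ) (u₀ v₀ φ₀ p₀ q₀ : ℂ → ℂ) : Prop where
  hu : DifferentiableOn ℂ u₀ (strip σ)
  hv : DifferentiableOn ℂ v₀ (strip σ)
  hφ : DifferentiableOn ℂ φ₀ (strip σ)
  hp : DifferentiableOn ℂ p₀ (strip σ)
  hq : DifferentiableOn ℂ q₀ (strip σ)
  bu : ∀ z ∈ strip σ, ‖u₀ z‖ ≤ D
  bv : ∀ z ∈ strip σ, ‖v₀ z‖ ≤ D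
  bφ : ∀ z ∈ strip σ, ‖φ₀ z‖ ≤ D
  bp : ∀ z ∈ strip σ, ‖p₀ z‖ ≤ D
  bq : ∀ z ∈ strip σ, ‖q₀ z‖ ≤ D
  sφ : ∀ z ∈ strip σ, (starRingEnd ℂ) (φ₀ ((starRingEnd ℂ) z)) = φ₀ z
  sp : ∀ z ∈ strip σ, (starRingEnd ℂ) (p₀ ((starRingEnd ℂ) z)) = p₀ z
  sq : ∀ z ∈ strip σ, (starRingEnd ℂ) (q₀ ((starRingEnd ℂ) z)) = q₀ z
  compat : ∀ z ∈ strip σ, deriv φ₀ z = (p₀ z - q₀ z) / 2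
  charge : ∀ y, |y| < σ → ∀ a b : ℝ, a ≤ b →
    ∫ x in a..b, (‖u₀ (x + y * Complex.I)‖ ^ 2 + ‖v₀ (x + y * Complex.I)‖ ^ 2) ≤ D
  energy : ∀ y, |y| < σ → ∀ a b : ℝ, a ≤ b →
    ∫ x in a..b, (‖φ₀ (x + y * Complex.I)‖ ^ 2 + ‖p₀ (x + y * Complex.I)‖ ^ 2
      + ‖q₀ (x + y * Complex.I)‖ ^ 2) ≤ D

/-- For a bounded potential the Dirac equation is a linear system in diagonal form. -/
theorem exists_diracSol {M A D : ℝ} {u₀ v₀ : ℂ → ℂ} {Φ : ℝ → ℂ → ℂ}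
    (hu : DifferentiableOn ℂ u₀ (strip σ)) (hv : DifferentiableOn ℂ v₀ (strip σ))
    (bu : ∀ z ∈ strip σ, ‖u₀ z‖ ≤ D) (bv : ∀ z ∈ strip σ, ‖v₀ z‖ ≤ D) (hD : 0 ≤ D) (hA : 0 ≤ A)
    (hΦ : StripHol σ Φ) (bΦ : ∀ t, ∀ z ∈ strip σ, ‖Φ t z‖ ≤ A) :
    ∃ u v, DiracSol σ M u₀ v₀ Φ u v := by
  obtain ⟨w, hw, ew, -⟩ := exists_linear_solution (σ := σ) (K := A + |M|) (B := 0) (D := D)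
    (ι := Fin 2) ![1, -1] (fun j k => if j = k then fun _ _ => 0 else diracPot M Φ)
    (fun _ _ _ => 0) ![u₀, v₀] (by positivity) le_rfl hD
    (fun j k => by
      split_ifs
      · exact StripHol.zero
      · exact hΦ.diracPot M)
    (fun _ => StripHol.zero)
    (fun j => by fin_cases j <;> simpa)
    (fun j k t z hz => by
      split_ifs
      · simp; positivity
      · rw [diracPot, norm_mul, Complex.norm_I, one_mul]
        refine (norm_sub_le _ _).trans (add_le_add (bΦ t z hz) ?_)
        simp)
    (fun _ _ _ _ => by simp)
    (fun j => by fin_cases j <;> simpa)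
  refine ⟨w 0, w 1, hw 0, hw 1, fun t z hz => ?_, fun t z hz => ?_⟩
  · simpa [Fin.sum_univ_two] using ew 0 t z hz
  · simpa [Fin.sum_univ_two] using ew 1 t z hz

/-- For a bounded source the Klein–Gordon equation is a linear system in diagonal form. -/
theorem exists_kgSol {m B D : ℝ} {φ₀ p₀ q₀ : ℂ → ℂ} {F : ℝ → ℂ → ℂ}
    (hφ : DifferentiableOn ℂ φ₀ (strip σ)) (hp : DifferentiableOn ℂ p₀ (strip σ))
    (hq : DifferentiableOn ℂ q₀ (strip σ)) (bφ : ∀ z ∈ strip σ, ‖φ₀ z‖ ≤ D)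
    (bp : ∀ z ∈ strip σ, ‖p₀ z‖ ≤ D) (bq : ∀ z ∈ strip σ, ‖q₀ z‖ ≤ D) (hD : 0 ≤ D) (hB : 0 ≤ B)
    (hF : StripHol σ F) (bF : ∀ t, ∀ z ∈ strip σ, ‖F t z‖ ≤ B) :
    ∃ φ p q, KGSol σ m φ₀ p₀ q₀ F φ p q ∧ ∃ C lam : ℝ, 0 ≤ C ∧ 0 ≤ lam ∧ ∀ t, ∀ z ∈ strip σ,
      ‖φ t z‖ ≤ C * Real.exp (lam * |t|) ∧ ‖p t z‖ ≤ C * Real.exp (lam * |t|) ∧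
        ‖q t z‖ ≤ C * Real.exp (lam * |t|) := by
  set a : Fin 3 → Fin 3 → ℂ := ![![0, 1 / 2, 1 / 2], ![-(m : ℂ) ^ 2, 0, 0], ![-(m : ℂ) ^ 2, 0, 0]]
    with ha
  obtain ⟨w, hw, ew, C, lam, hC, hlam, hb⟩ := exists_linear_solution (σ := σ)
    (K := ∑ j, ∑ k, ‖a j k‖) (B := B)
    (D := D) (ι := Fin 3) ![0, -1, 1] (fun j k _ _ => a j k) ![fun _ _ => 0, F, F] ![φ₀, p₀, q₀]
    (by positivity) hB hD (fun j k => StripHol.const _)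
    (fun j => by
      fin_cases j
      · exact StripHol.zero
      · exact hF
      · exact hF)
    (fun j => by fin_cases j <;> simpa)
    (fun j k t z hz => (Finset.single_le_sum (f := fun k => ‖a j k‖) (fun _ _ => norm_nonneg _)
      (Finset.mem_univ k)).trans (Finset.single_le_sum (f := fun j => ∑ k, ‖a j k‖)
        (fun _ _ => Finset.sum_nonneg fun _ _ => norm_nonneg _) (Finset.mem_univ j)))
    (fun j t z hz => by
      fin_cases j
      · simpa using hB
      · exact bF t z hz
      · exact bF t z hz)
    (fun j => by fin_cases j <;> simpa)
  refine ⟨w 0, w 1, w 2, ⟨hw 0, hw 1, hw 2, fun t z hz => ?_, fun t z hz => ?_, fun t z hz => ?_⟩,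
    C, lam, hC, hlam, fun t z hz => ⟨hb 0 t z hz, hb 1 t z hz, hb 2 t z hz⟩⟩
  · have := ew 0 t z hz
    simp only [Fin.sum_univ_three, ha, Matrix.cons_val_zero, Matrix.cons_val_one,
      Matrix.cons_val_two] at this
    rw [this]
    congr 1
    ext s ζ
    simp; ring
  · have := ew 1 t z hz
    simp only [Fin.sum_univ_three, ha, Matrix.cons_val_zero, Matrix.cons_val_one] at this
    rw [this]
    congr 1
    ext s ζ
    simp; ring
  · have := ew 2 t z hz
    simp only [Fin.sum_univ_three, ha] at this
    rw [this]
    congr 1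
    ext s ζ
    simp; ring

theorem DiracSol.dt_u {M : ℝ} {u₀ v₀ : ℂ → ℂ} {Φ u v : ℝ → ℂ → ℂ} (h : DiracSol σ M u₀ v₀ Φ u v)
    (hu : DifferentiableOn ℂ u₀ (strip σ)) (hΦ : StripHol σ Φ) (t : ℝ) {z : ℂ} (hz : z ∈ strip σ) :
    HasDerivAt (fun t => u t z) (diracPot M Φ t z * v t z - deriv (u t) z) t := by
  simpa using hasDerivAt_of_eq_mild hu ((hΦ.diracPot M).mul h.hv) h.eu t hz

theorem DiracSol.dt_v {M : ℝ} {u₀ v₀ : ℂ → ℂ} {Φ u v : ℝ → ℂ → ℂ} (h : DiracSol σ M u₀ v₀ Φ u v)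
    (hv : DifferentiableOn ℂ v₀ (strip σ)) (hΦ : StripHol σ Φ) (t : ℝ) {z : ℂ} (hz : z ∈ strip σ) :
    HasDerivAt (fun t => v t z) (diracPot M Φ t z * u t z + deriv (v t) z) t := by
  simpa using hasDerivAt_of_eq_mild hv ((hΦ.diracPot M).mul h.hu) h.ev t hz

section KGSol
variable {m : ℝ} {φ₀ p₀ q₀ : ℂ → ℂ} {F φ p q : ℝ → ℂ → ℂ}

theorem KGSol.dt_φ (h : KGSol σ m φ₀ p₀ q₀ F φ p q) (hφ : DifferentiableOn ℂ φ₀ (strip σ)) (t : ℝ)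
    {z : ℂ} (hz : z ∈ strip σ) : HasDerivAt (fun t => φ t z) ((1 / 2 : ℂ) * (p t z + q t z)) t := by
  simpa using hasDerivAt_of_eq_mild hφ ((h.hp.add h.hq).const_mul (1 / 2)) h.eφ t hz

theorem KGSol.dt_p (h : KGSol σ m φ₀ p₀ q₀ F φ p q) (hp : DifferentiableOn ℂ p₀ (strip σ))
    (hF : StripHol σ F) (t : ℝ) {z : ℂ} (hz : z ∈ strip σ) :
    HasDerivAt (fun t => p t z) (F t z - (m ^ 2 : ℂ) * φ t z + deriv (p t) z) t := by
  simpa using hasDerivAt_of_eq_mild hp (hF.sub (h.hφ.const_mul (m ^ 2 : ℂ))) h.ep t hz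

theorem KGSol.dt_q (h : KGSol σ m φ₀ p₀ q₀ F φ p q) (hq : DifferentiableOn ℂ q₀ (strip σ))
    (hF : StripHol σ F) (t : ℝ) {z : ℂ} (hz : z ∈ strip σ) :
    HasDerivAt (fun t => q t z) (F t z - (m ^ 2 : ℂ) * φ t z - deriv (q t) z) t := by
  simpa using hasDerivAt_of_eq_mild hq (hF.sub (h.hφ.const_mul (m ^ 2 : ℂ))) h.eq t hz

/-- The constraint `∂_z φ = (p - q) / 2` propagates from the data. -/
theorem KGSol.deriv_φ (h : KGSol σ m φ₀ p₀ q₀ F φ p q) (hφ : DifferentiableOn ℂ φ₀ (strip σ))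
    (hp : DifferentiableOn ℂ p₀ (strip σ)) (hq : DifferentiableOn ℂ q₀ (strip σ))
    (hF : StripHol σ F) (hc : ∀ z ∈ strip σ, deriv φ₀ z = (p₀ z - q₀ z) / 2) (t : ℝ) {z : ℂ}
    (hz : z ∈ strip σ) : deriv (φ t) z = (1 / 2 : ℂ) * (p t z - q t z) := by
  have hpq : StripHol σ fun s ζ => (1 / 2 : ℂ) * (p s ζ + q s ζ) := (h.hp.add h.hq).const_mul _
  have e1 : ∀ t, deriv (φ t) z
      = mild 0 (deriv φ₀) (fun s ζ => deriv (fun ζ => (1 / 2 : ℂ) * (p s ζ + q s ζ)) ζ) t z :=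
        fun t => by
    rw [← (hasDerivAt_mild_space hφ hpq t hz).deriv]
    exact Filter.EventuallyEq.deriv_eq
      ((eventually_of_mem ((isOpen_strip σ).mem_nhds hz) fun z hz => h.eφ t z hz))
  have d1 : ∀ t, HasDerivAt (fun t => deriv (φ t) z)
      ((1 / 2 : ℂ) * (deriv (p t) z + deriv (q t) z)) t := fun t => by
    have e2 : (fun t => deriv (φ t) z) = fun t => mild 0 (deriv φ₀)
        (fun s ζ => deriv (fun ζ => (1 / 2 : ℂ) * (p s ζ + q s ζ)) ζ) t z := funext e1
    rw [e2]
    have := hasDerivAt_mild (c := 0) (hφ.deriv (isOpen_strip σ)) hpq.deriv t hz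
    refine this.congr_deriv ?_
    have e3 : deriv (fun ζ => (1 / 2 : ℂ) * (p t ζ + q t ζ)) z
        = (1 / 2 : ℂ) * (deriv (p t) z + deriv (q t) z) :=
      (((h.hp.differentiableAt t hz).hasDerivAt.add
        (h.hq.differentiableAt t hz).hasDerivAt).const_mul _).deriv
    rw [e3]; simp
  have d2 : ∀ t, HasDerivAt (fun t => deriv (φ t) z - (1 / 2 : ℂ) * (p t z - q t z)) 0 t :=
    fun t => by
    refine ((d1 t).sub (((h.dt_p hp hF t hz).sub (h.dt_q hq hF t hz)).const_mul
      (1 / 2))).congr_deriv ?_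
    ring
  have hconst := is_const_of_deriv_eq_zero (fun t => (d2 t).differentiableAt)
    (fun t => (d2 t).deriv) t 0
  have h0 : deriv (φ 0) z - (1 / 2 : ℂ) * (p 0 z - q 0 z) = 0 := by
    rw [e1 0, mild_zero, hc z hz, h.ep 0 z hz, h.eq 0 z hz, mild_zero, mild_zero]
    ring
  simp only [h0] at hconst
  exact sub_eq_zero.1 hconst

end KGSol

/-- Grönwall's inequality for Duhamel integrals in the weighted norm. -/
theorem duhamel_gronwall {ι : Type*} {δ h : ι → ℝ → ℂ → ℂ} {c : ι → ℝ} {K d lam T C : ℝ}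
    (hK : 0 ≤ K) (hd : 0 ≤ d) (hlam : 0 < lam) (hKl : 2 * K ≤ lam) (hC : 0 ≤ C)
    (hbd : ∀ j t, |t| ≤ T → ∀ z ∈ strip σ, ‖δ j t z‖ ≤ C)
    (hδ : ∀ j t, |t| ≤ T → ∀ z ∈ strip σ, ‖δ j t z‖ ≤ ‖duhamel (c j) (h j) t z‖)
    (hh : ∀ s, |s| ≤ T → ∀ B : ℝ, 0 ≤ B → (∀ j, ∀ z ∈ strip σ, ‖δ j s z‖ ≤ B) →
      ∀ j, ∀ z ∈ strip σ, ‖h j s z‖ ≤ K * B + d * Real.exp (lam * |s|)) :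
    ∀ j t, |t| ≤ T → ∀ z ∈ strip σ, ‖δ j t z‖ ≤ 2 * (d / lam) * Real.exp (lam * |t|) := by
  have key := le_two_mul_of_contraction (X := ι × ℝ × ℂ)
    (s := {x | |x.2.1| ≤ T ∧ x.2.2 ∈ strip σ}) (f := fun x => ‖δ x.1 x.2.1 x.2.2‖)
    (g := fun x => Real.exp (lam * |x.2.1|)) (C := C) (d := d / lam) hC (by positivity)
    (fun x hx => (hbd _ _ hx.1 _ hx.2).trans (le_mul_of_one_le_right hC
      (Real.one_le_exp (by positivity))))
    (fun B hB hx ⟨j, t, z⟩ ⟨ht, hz⟩ => by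
      refine (hδ j t ht z hz).trans ((norm_duhamel_le_exp (σ := σ) (H := K * B + d) (lam := lam)
        (by positivity) hlam (fun s hs ζ hζ => ?_) hz).trans ?_)
      · have hs' : |s| ≤ T := hs.trans ht
        have := hh s hs' (B * Real.exp (lam * |s|)) (by positivity)
          (fun j z hz => hx (j, s, z) ⟨hs', hz⟩) j ζ hζ
        refine this.trans (le_of_eq (by ring))
      · refine mul_le_mul_of_nonneg_right ?_ (Real.exp_pos _).le
        rw [add_div]
        refine add_le_add ?_ le_rfl
        rw [div_le_div_iff₀ hlam (by norm_num)]
        nlinarith)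
  intro j t ht z hz
  exact key (j, t, z) ⟨ht, hz⟩

end Solutions

/-! ### A priori bounds in the strip -/

section Bounds
variable {σ : ℝ}

theorem convex_strip (σ : ℝ) : Convex ℝ (strip σ) := by
  have : strip σ = Complex.imLm ⁻¹' Ioo (-σ) σ := by
    ext z; simp [strip, abs_lt]
  rw [this]
  exact (convex_Ioo _ _).linear_preimage _

theorem conj_line (x y : ℝ) :
    (starRingEnd ℂ) (x + y * Complex.I) = (x : ℂ) + ((-y : ℝ) : ℂ) * Complex.I := by
  simp

/-- Cauchy–Schwarz on an interval of length at most `T`, in the form used for fluxes. -/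
theorem norm_integral_le_of_sq {f g h : ℝ → ℂ} {K Q T t : ℝ} (hK : 0 ≤ K) (hT : 0 < T)
    (htT : |t| ≤ T) (hg : Continuous g) (hh : Continuous h)
    (hf : ∀ s, |s| ≤ |t| → ‖f s‖ ≤ K * (‖g s‖ + ‖h s‖))
    (hgQ : |∫ s in (0 : ℝ)..t, ‖g s‖ ^ 2| ≤ Q) (hhQ : |∫ s in (0 : ℝ)..t, ‖h s‖ ^ 2| ≤ Q) :
    ‖∫ s in (0 : ℝ)..t, f s‖ ≤ K * ((Q + 1) * √T) := by
  set L := √T with hL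
  have hL0 : 0 < L := Real.sqrt_pos.2 hT
  have hLT : L * L = T := Real.mul_self_sqrt hT.le
  have hyoung : ∀ a : ℝ, a ≤ (L * a ^ 2 + L⁻¹) / 2 := fun a => by
    have h1 : 0 ≤ L * (a - L⁻¹) ^ 2 := by positivity
    have h2 : L * (a - L⁻¹) ^ 2 = L * a ^ 2 + L⁻¹ - 2 * a := by field_simp; ring
    linarith
  have hi : ∀ k : ℝ → ℂ, Continuous k → IntervalIntegrable (fun s => ‖k s‖ ^ 2) volume 0 t :=
    fun k hk => (hk.norm.pow 2).intervalIntegrable _ _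
  refine (intervalIntegral.norm_integral_le_abs_of_norm_le
    (g := fun s => K * ((L / 2) * (‖g s‖ ^ 2 + ‖h s‖ ^ 2) + L⁻¹)) ?_
    (Continuous.intervalIntegrable (by fun_prop) _ _)).trans ?_
  · refine (ae_restrict_iff' measurableSet_uIoc).2 (Eventually.of_forall fun s hs => ?_)
    have hs' : |s| ≤ |t| := by
      have := abs_sub_left_of_mem_uIcc (uIoc_subset_uIcc hs)
      simpa using this
    refine (hf s hs').trans (mul_le_mul_of_nonneg_left ?_ hK)
    linarith [hyoung ‖g s‖, hyoung ‖h s‖]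
  · have e : ∫ s in (0 : ℝ)..t, K * ((L / 2) * (‖g s‖ ^ 2 + ‖h s‖ ^ 2) + L⁻¹)
        = K * ((L / 2) * ((∫ s in (0 : ℝ)..t, ‖g s‖ ^ 2) + ∫ s in (0 : ℝ)..t, ‖h s‖ ^ 2)
          + L⁻¹ * t) := by
      rw [intervalIntegral.integral_const_mul, intervalIntegral.integral_add
        (((hi g hg).add (hi h hh)).const_mul _) intervalIntegrable_const,
        intervalIntegral.integral_const_mul, intervalIntegral.integral_add (hi g hg) (hi h hh),
        intervalIntegral.integral_const, sub_zero, smul_eq_mul, mul_comm t]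
    rw [e, abs_mul, abs_of_nonneg hK]
    refine mul_le_mul_of_nonneg_left ?_ hK
    refine (abs_add_le _ _).trans ?_
    rw [abs_mul, abs_mul, abs_of_pos (by positivity : 0 < L / 2),
      abs_of_pos (by positivity : 0 < L⁻¹)]
    have h1 := (abs_add_le (∫ s in (0 : ℝ)..t, ‖g s‖ ^ 2) (∫ s in (0 : ℝ)..t, ‖h s‖ ^ 2))
    have h2 : L⁻¹ * |t| ≤ L := by
      rw [inv_mul_le_iff₀ hL0, hLT]; exact htT
    have h3 : (L / 2) * |(∫ s in (0 : ℝ)..t, ‖g s‖ ^ 2) + ∫ s in (0 : ℝ)..t, ‖h s‖ ^ 2|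
        ≤ (L / 2) * (Q + Q) :=
      mul_le_mul_of_nonneg_left (by linarith) (by positivity)
    linarith

/-- Charge grows only through the imaginary part of the potential. -/
theorem diracPot_re (M : ℝ) (Φ : ℝ → ℂ → ℂ) (t : ℝ) (z : ℂ) :
    (diracPot M Φ t z).re = -(Φ t z).im := by
  simp [diracPot]

theorem norm_diracPot_le {M A : ℝ} {Φ : ℝ → ℂ → ℂ} {t : ℝ} {z : ℂ} (h : ‖Φ t z‖ ≤ A) :
    ‖diracPot M Φ t z‖ ≤ A + |M| := by
  rw [diracPot, norm_mul, Complex.norm_I, one_mul]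
  refine (norm_sub_le _ _).trans (add_le_add h ?_)
  simp

section Dirac
variable {M D η T : ℝ} {u₀ v₀ : ℂ → ℂ} {Φ u v : ℝ → ℂ → ℂ}

theorem DiracSol.zero_u (h : DiracSol σ M u₀ v₀ Φ u v) {z : ℂ} (hz : z ∈ strip σ) :
    u 0 z = u₀ z := by rw [h.eu 0 z hz, mild_zero]

theorem DiracSol.zero_v (h : DiracSol σ M u₀ v₀ Φ u v) {z : ℂ} (hz : z ∈ strip σ) :
    v 0 z = v₀ z := by rw [h.ev 0 z hz, mild_zero]

theorem DiracSol.isC1_u (h : DiracSol σ M u₀ v₀ Φ u v) (hu : DifferentiableOn ℂ u₀ (strip σ))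
    (hΦ : StripHol σ Φ) {y : ℝ} (hy : |y| < σ) :
    IsC1 (fun t x : ℝ => u t (x + y * Complex.I))
      (fun t x : ℝ => diracPot M Φ t (x + y * Complex.I) * v t (x + y * Complex.I)
        - deriv (u t) (x + y * Complex.I))
      (fun t x : ℝ => deriv (u t) (x + y * Complex.I)) :=
  h.hu.isC1 (g := fun t z => diracPot M Φ t z * v t z - deriv (u t) z)
    (((hΦ.diracPot M).mul h.hv).sub h.hu.deriv) (fun t _ hz => h.dt_u hu hΦ t hz) hy

theorem DiracSol.isC1_v (h : DiracSol σ M u₀ v₀ Φ u v) (hv : DifferentiableOn ℂ v₀ (strip σ))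
    (hΦ : StripHol σ Φ) {y : ℝ} (hy : |y| < σ) :
    IsC1 (fun t x : ℝ => v t (x + y * Complex.I))
      (fun t x : ℝ => diracPot M Φ t (x + y * Complex.I) * u t (x + y * Complex.I)
        + deriv (v t) (x + y * Complex.I))
      (fun t x : ℝ => deriv (v t) (x + y * Complex.I)) :=
  h.hv.isC1 (g := fun t z => diracPot M Φ t z * u t z + deriv (v t) z)
    (((hΦ.diracPot M).mul h.hu).add h.hv.deriv) (fun t _ hz => h.dt_v hv hΦ t hz) hy

/-- While the imaginary part of the potential is at most `η` with `e^{2ηT} ≤ 2`, the charge at most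
doubles, on horizontal lines and through complexified characteristics. -/
theorem DiracSol.charge_le (h : DiracSol σ M u₀ v₀ Φ u v)
    (hu : DifferentiableOn ℂ u₀ (strip σ)) (hv : DifferentiableOn ℂ v₀ (strip σ))
    (hΦ : StripHol σ Φ) (hη : 0 ≤ η) (hηT : Real.exp (2 * η * T) ≤ 2) (hD : 0 ≤ D)
    (hΦη : ∀ t, ∀ z ∈ strip σ, |(Φ t z).im| ≤ η)
    (hc : ∀ y, |y| < σ → ∀ a b : ℝ, a ≤ b →
      ∫ x in a..b, (‖u₀ (x + y * Complex.I)‖ ^ 2 + ‖v₀ (x + y * Complex.I)‖ ^ 2) ≤ D)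
    {t : ℝ} (ht : |t| ≤ T) {y : ℝ} (hy : |y| < σ) :
    (∀ a b : ℝ, a ≤ b →
      ∫ x in a..b, (‖u t (x + y * Complex.I)‖ ^ 2 + ‖v t (x + y * Complex.I)‖ ^ 2) ≤ 2 * D) ∧
    (∀ x : ℝ, |∫ s in (0 : ℝ)..t, ‖u s ((x + (t - s) : ℝ) + y * Complex.I)‖ ^ 2| ≤ 2 * D) ∧
    (∀ x : ℝ, |∫ s in (0 : ℝ)..t, ‖v s ((x - (t - s) : ℝ) + y * Complex.I)‖ ^ 2| ≤ 2 * D) := by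
  have key := dirac_charge_bound (h.isC1_u hu hΦ hy) (h.isC1_v hv hΦ hy)
    (κ := fun s x => diracPot M Φ s (x + y * Complex.I)) (η := η) (T := T) (Q₀ := D)
    (fun s x => by ring) (fun s x => by ring) hη
    (fun s _ x => by rw [diracPot_re, abs_neg]; exact hΦη s _ (line_mem_strip hy x))
    (fun a b hab => by
      refine le_trans (le_of_eq (intervalIntegral.integral_congr fun x _ => ?_)) (hc y hy a b hab)
      rw [h.zero_u (line_mem_strip hy x), h.zero_v (line_mem_strip hy x)]) ht
  have h2 : Real.exp (2 * η * T) * D ≤ 2 * D := mul_le_mul_of_nonneg_right hηT hD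
  exact ⟨fun a b hab => (key.1 a b hab).trans h2, fun x => (key.2.1 x).trans h2,
    fun x => (key.2.2 x).trans h2⟩

/-- The flux bounds through the characteristics ending at a point of the strip. -/
theorem DiracSol.flux_le (h : DiracSol σ M u₀ v₀ Φ u v)
    (hu : DifferentiableOn ℂ u₀ (strip σ)) (hv : DifferentiableOn ℂ v₀ (strip σ))
    (hΦ : StripHol σ Φ) (hη : 0 ≤ η) (hηT : Real.exp (2 * η * T) ≤ 2) (hD : 0 ≤ D)
    (hΦη : ∀ t, ∀ z ∈ strip σ, |(Φ t z).im| ≤ η)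
    (hc : ∀ y, |y| < σ → ∀ a b : ℝ, a ≤ b →
      ∫ x in a..b, (‖u₀ (x + y * Complex.I)‖ ^ 2 + ‖v₀ (x + y * Complex.I)‖ ^ 2) ≤ D)
    {t : ℝ} (ht : |t| ≤ T) {z : ℂ} (hz : z ∈ strip σ) :
    |∫ s in (0 : ℝ)..t, ‖u s (z - (-1 * (t - s) : ℝ))‖ ^ 2| ≤ 2 * D ∧
    |∫ s in (0 : ℝ)..t, ‖v s (z - (1 * (t - s) : ℝ))‖ ^ 2| ≤ 2 * D := by
  obtain ⟨-, h1, h2⟩ := h.charge_le hu hv hΦ hη hηT hD hΦη hc ht (y := z.im) hz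
  constructor
  · refine le_trans (le_of_eq ?_) (h1 z.re)
    congr 1
    refine intervalIntegral.integral_congr fun s _ => ?_
    congr 3
    nth_rw 1 [← Complex.re_add_im z]
    push_cast; ring
  · refine le_trans (le_of_eq ?_) (h2 z.re)
    congr 1
    refine intervalIntegral.integral_congr fun s _ => ?_
    congr 3
    nth_rw 1 [← Complex.re_add_im z]
    push_cast; ring

/-- Pointwise bound for the Dirac fields: integrate along a characteristic and use that the other
field, which crosses it, has bounded flux. By
Cauchy–Schwarz the length `T` of the characteristic enters only through its square root. -/
theorem DiracSol.norm_le (h : DiracSol σ M u₀ v₀ Φ u v) {A : ℝ}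
    (hu : DifferentiableOn ℂ u₀ (strip σ)) (hv : DifferentiableOn ℂ v₀ (strip σ))
    (bu : ∀ z ∈ strip σ, ‖u₀ z‖ ≤ D) (bv : ∀ z ∈ strip σ, ‖v₀ z‖ ≤ D)
    (hΦ : StripHol σ Φ) (hη : 0 ≤ η) (hηT : Real.exp (2 * η * T) ≤ 2) (hD : 0 ≤ D) (hA : 0 ≤ A)
    (hT : 0 < T)
    (hΦη : ∀ t, ∀ z ∈ strip σ, |(Φ t z).im| ≤ η) (hΦA : ∀ t, ∀ z ∈ strip σ, ‖Φ t z‖ ≤ A)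
    (hc : ∀ y, |y| < σ → ∀ a b : ℝ, a ≤ b →
      ∫ x in a..b, (‖u₀ (x + y * Complex.I)‖ ^ 2 + ‖v₀ (x + y * Complex.I)‖ ^ 2) ≤ D)
    {t : ℝ} (ht : |t| ≤ T) {z : ℂ} (hz : z ∈ strip σ) :
    ‖u t z‖ ≤ D + (A + |M|) / 2 * ((2 * D + 1) * √T) ∧
    ‖v t z‖ ≤ D + (A + |M|) / 2 * ((2 * D + 1) * √T) := by
  obtain ⟨h1, h2⟩ := h.flux_le hu hv hΦ hη hηT hD hΦη hc ht hz
  have hK : 0 ≤ (A + |M|) / 2 := by positivity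
  constructor
  · rw [h.eu t z hz, mild]
    refine (norm_add_le _ _).trans (add_le_add (bu _ (sub_real_mem_strip hz _)) ?_)
    have cg := h.hv.continuous_char hz continuous_id
      (b := fun s => 1 * (t - s)) (by fun_prop)
    refine norm_integral_le_of_sq hK hT ht cg cg (fun s _ => ?_) h2 h2
    rw [norm_mul]
    have := mul_le_mul_of_nonneg_right (norm_diracPot_le (M := M)
      (hΦA s _ (sub_real_mem_strip hz (1 * (t - s))))) (norm_nonneg (v s (z - (1 * (t - s) : ℝ))))
    refine this.trans (le_of_eq ?_)
    simp only [id_eq]; ring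
  · rw [h.ev t z hz, mild]
    refine (norm_add_le _ _).trans (add_le_add (bv _ (sub_real_mem_strip hz _)) ?_)
    have cg := h.hu.continuous_char hz continuous_id
      (b := fun s => -1 * (t - s)) (by fun_prop)
    refine norm_integral_le_of_sq hK hT ht cg cg (fun s _ => ?_) h1 h1
    rw [norm_mul]
    have := mul_le_mul_of_nonneg_right (norm_diracPot_le (M := M)
      (hΦA s _ (sub_real_mem_strip hz (-1 * (t - s))))) (norm_nonneg (u s (z - (-1 * (t - s) : ℝ))))
    refine this.trans (le_of_eq ?_)
    simp only [id_eq]; ring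

theorem norm_dkgSource_le (u v : ℝ → ℂ → ℂ) (t : ℝ) (z : ℂ) :
    ‖dkgSource u v t z‖ ≤ ‖u t ((starRingEnd ℂ) z)‖ * ‖v t z‖
      + ‖v t ((starRingEnd ℂ) z)‖ * ‖u t z‖ := by
  refine (norm_add_le _ _).trans ?_
  simp [conjRefl]

end Dirac

/-- Truncation of time to `[-T, T]`. It turns bounds for `|t| ≤ T` into bounds for all times, so
that all function spaces are over `ℝ × strip σ`. -/
def timeClamp (T t : ℝ) : ℝ := max (-T) (min T t)

theorem continuous_timeClamp (T : ℝ) : Continuous (timeClamp T) := by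
  unfold timeClamp; fun_prop

theorem abs_timeClamp_le {T : ℝ} (hT : 0 ≤ T) (t : ℝ) : |timeClamp T t| ≤ T := by
  rw [abs_le, timeClamp]
  exact ⟨le_max_left _ _, max_le (by linarith) (min_le_left _ _)⟩

theorem abs_timeClamp_le_abs {T : ℝ} (hT : 0 ≤ T) (t : ℝ) : |timeClamp T t| ≤ |t| := by
  rw [timeClamp]
  rcases le_total 0 t with h | h
  · rw [abs_of_nonneg h, abs_of_nonneg (le_max_of_le_right (le_min hT h))]
    exact max_le (by linarith) (min_le_right _ _)
  · rw [abs_of_nonpos h, abs_of_nonpos (max_le (by linarith) ((min_le_right _ _).trans h)),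
      neg_le_neg_iff]
    exact le_max_of_le_right (le_min (h.trans hT) le_rfl)

theorem timeClamp_of_abs_le {T t : ℝ} (h : |t| ≤ T) : timeClamp T t = t := by
  rw [abs_le] at h
  rw [timeClamp, min_eq_right h.2, max_eq_right h.1]

section KG
variable {m : ℝ} {φ₀ p₀ q₀ : ℂ → ℂ} {F φ p q F' φ' p' q' : ℝ → ℂ → ℂ}

theorem KGSol.isC1_φ (h : KGSol σ m φ₀ p₀ q₀ F φ p q) (hφ : DifferentiableOn ℂ φ₀ (strip σ)) {y : ℝ}
    (hy : |y| < σ) :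
    IsC1 (fun t x : ℝ => φ t (x + y * Complex.I))
      (fun t x : ℝ => (1 / 2 : ℂ) * (p t (x + y * Complex.I) + q t (x + y * Complex.I)))
      (fun t x : ℝ => deriv (φ t) (x + y * Complex.I)) :=
  h.hφ.isC1 (g := fun t z => (1 / 2 : ℂ) * (p t z + q t z)) ((h.hp.add h.hq).const_mul _)
    (fun t _ hz => h.dt_φ hφ t hz) hy

theorem KGSol.isC1_p (h : KGSol σ m φ₀ p₀ q₀ F φ p q) (hp : DifferentiableOn ℂ p₀ (strip σ))
    (hF : StripHol σ F) {y : ℝ} (hy : |y| < σ) :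
    IsC1 (fun t x : ℝ => p t (x + y * Complex.I))
      (fun t x : ℝ => F t (x + y * Complex.I) - (m ^ 2 : ℂ) * φ t (x + y * Complex.I)
        + deriv (p t) (x + y * Complex.I))
      (fun t x : ℝ => deriv (p t) (x + y * Complex.I)) :=
  h.hp.isC1 (g := fun t z => F t z - (m ^ 2 : ℂ) * φ t z + deriv (p t) z)
    ((hF.sub (h.hφ.const_mul _)).add h.hp.deriv) (fun t _ hz => h.dt_p hp hF t hz) hy

theorem KGSol.isC1_q (h : KGSol σ m φ₀ p₀ q₀ F φ p q) (hq : DifferentiableOn ℂ q₀ (strip σ))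
    (hF : StripHol σ F) {y : ℝ} (hy : |y| < σ) :
    IsC1 (fun t x : ℝ => q t (x + y * Complex.I))
      (fun t x : ℝ => F t (x + y * Complex.I) - (m ^ 2 : ℂ) * φ t (x + y * Complex.I)
        - deriv (q t) (x + y * Complex.I))
      (fun t x : ℝ => deriv (q t) (x + y * Complex.I)) :=
  h.hq.isC1 (g := fun t z => F t z - (m ^ 2 : ℂ) * φ t z - deriv (q t) z)
    ((hF.sub (h.hφ.const_mul _)).sub h.hq.deriv) (fun t _ hz => h.dt_q hq hF t hz) hy

/-- Two solutions of the Klein–Gordon equation with the same data differ by at most the difference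
of their sources, with a gain of `1 / λ`, in the norm with weight `e^{-λ|t|}`. -/
theorem KGSol.norm_sub_le {lam T d C : ℝ} (h : KGSol σ m φ₀ p₀ q₀ F φ p q)
    (h' : KGSol σ m φ₀ p₀ q₀ F' φ' p' q') (hF : StripHol σ F) (hF' : StripHol σ F') (hd : 0 ≤ d)
    (hC : 0 ≤ C) (hlam : 2 * (1 + m ^ 2) ≤ lam)
    (b : ∀ t, |t| ≤ T → ∀ z ∈ strip σ, ‖φ t z‖ ≤ C ∧ ‖p t z‖ ≤ C ∧ ‖q t z‖ ≤ C)
    (b' : ∀ t, |t| ≤ T → ∀ z ∈ strip σ, ‖φ' t z‖ ≤ C ∧ ‖p' t z‖ ≤ C ∧ ‖q' t z‖ ≤ C)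
    (hFd : ∀ t, |t| ≤ T → ∀ z ∈ strip σ, ‖F t z - F' t z‖ ≤ d * Real.exp (lam * |t|))
    {t : ℝ} (ht : |t| ≤ T) {z : ℂ} (hz : z ∈ strip σ) :
    ‖φ t z - φ' t z‖ ≤ 2 * (d / lam) * Real.exp (lam * |t|) := by
  have key := duhamel_gronwall (σ := σ) (ι := Fin 3)
    (δ := ![fun t z => φ t z - φ' t z, fun t z => p t z - p' t z, fun t z => q t z - q' t z])
    (h := ![fun s ζ => (1 / 2 : ℂ) * (p s ζ + q s ζ) - (1 / 2 : ℂ) * (p' s ζ + q' s ζ),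
      fun s ζ => (F s ζ - (m ^ 2 : ℂ) * φ s ζ) - (F' s ζ - (m ^ 2 : ℂ) * φ' s ζ),
      fun s ζ => (F s ζ - (m ^ 2 : ℂ) * φ s ζ) - (F' s ζ - (m ^ 2 : ℂ) * φ' s ζ)])
    (c := ![0, -1, 1]) (K := 1 + m ^ 2) (d := d) (lam := lam) (T := T) (C := C + C)
      (by positivity) hd
    (lt_of_lt_of_le (by positivity) hlam) hlam (by positivity)
    (fun j t ht z hz => by
      obtain ⟨b1, b2, b3⟩ := b t ht z hz
      obtain ⟨c1, c2, c3⟩ := b' t ht z hz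
      fin_cases j
      · exact (_root_.norm_sub_le _ _).trans (add_le_add b1 c1)
      · exact (_root_.norm_sub_le _ _).trans (add_le_add b2 c2)
      · exact (_root_.norm_sub_le _ _).trans (add_le_add b3 c3))
    (fun j t ht z hz => by
      fin_cases j
      · refine le_of_eq (congrArg _ ?_)
        change φ t z - φ' t z = _
        rw [h.eφ t z hz, h'.eφ t z hz]
        exact mild_sub ((h.hp.add h.hq).const_mul _) ((h'.hp.add h'.hq).const_mul _) t hz
      · refine le_of_eq (congrArg _ ?_)
        change p t z - p' t z = _
        rw [h.ep t z hz, h'.ep t z hz]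
        exact mild_sub (hF.sub (h.hφ.const_mul _)) (hF'.sub (h'.hφ.const_mul _)) t hz
      · refine le_of_eq (congrArg _ ?_)
        change q t z - q' t z = _
        rw [h.eq t z hz, h'.eq t z hz]
        exact mild_sub (hF.sub (h.hφ.const_mul _)) (hF'.sub (h'.hφ.const_mul _)) t hz)
    (fun s hs B hB hb j ζ hζ => by
      have b0 : ‖φ s ζ - φ' s ζ‖ ≤ B := hb 0 ζ hζ
      have b1 : ‖p s ζ - p' s ζ‖ ≤ B := hb 1 ζ hζ
      have b2 : ‖q s ζ - q' s ζ‖ ≤ B := hb 2 ζ hζ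
      have hm : ‖(m ^ 2 : ℂ)‖ = m ^ 2 := by simp
      have hS : ‖(F s ζ - (m ^ 2 : ℂ) * φ s ζ) - (F' s ζ - (m ^ 2 : ℂ) * φ' s ζ)‖
          ≤ (1 + m ^ 2) * B + d * Real.exp (lam * |s|) := by
        have e : (F s ζ - (m ^ 2 : ℂ) * φ s ζ) - (F' s ζ - (m ^ 2 : ℂ) * φ' s ζ)
            = (F s ζ - F' s ζ) - (m ^ 2 : ℂ) * (φ s ζ - φ' s ζ) := by ring
        rw [e]
        refine (_root_.norm_sub_le _ _).trans ?_
        rw [norm_mul, hm]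
        have := hFd s hs ζ hζ
        nlinarith [mul_le_mul_of_nonneg_left b0 (sq_nonneg m)]
      fin_cases j
      · change ‖(1 / 2 : ℂ) * (p s ζ + q s ζ) - (1 / 2 : ℂ) * (p' s ζ + q' s ζ)‖ ≤ _
        have e : (1 / 2 : ℂ) * (p s ζ + q s ζ) - (1 / 2 : ℂ) * (p' s ζ + q' s ζ)
            = (1 / 2 : ℂ) * ((p s ζ - p' s ζ) + (q s ζ - q' s ζ)) := by ring
        rw [e, norm_mul]
        have h2 : ‖(1 / 2 : ℂ)‖ = 1 / 2 := by norm_num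
        rw [h2]
        have h3 := norm_add_le (p s ζ - p' s ζ) (q s ζ - q' s ζ)
        have h4 : 0 ≤ d * Real.exp (lam * |s|) := by positivity
        nlinarith [mul_nonneg (sq_nonneg m) hB]
      · exact hS
      · exact hS)
  exact key 0 t ht z hz

theorem intervalIntegral_conj (f : ℝ → ℂ) (a b : ℝ) :
    (starRingEnd ℂ) (∫ s in a..b, f s) = ∫ s in a..b, (starRingEnd ℂ) (f s) := by
  simp only [intervalIntegral, map_sub, ← integral_conj]

/-- Reflection commutes with the solution operator because the speeds are real. -/
theorem conjRefl_mild {c : ℝ} {w₀ : ℂ → ℂ} {f : ℝ → ℂ → ℂ} (t : ℝ) (z : ℂ) :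
    conjRefl (mild c w₀ f) t z
      = mild c (fun z => (starRingEnd ℂ) (w₀ ((starRingEnd ℂ) z))) (conjRefl f) t z := by
  simp only [conjRefl, mild, duhamel, map_add, map_sub, Complex.conj_ofReal,
    intervalIntegral_conj]

/-- The reflected conjugate of a solution of the Klein–Gordon equation. -/
theorem KGSol.conjRefl (h : KGSol σ m φ₀ p₀ q₀ F φ p q)
    (sφ : ∀ z ∈ strip σ, (starRingEnd ℂ) (φ₀ ((starRingEnd ℂ) z)) = φ₀ z)
    (sp : ∀ z ∈ strip σ, (starRingEnd ℂ) (p₀ ((starRingEnd ℂ) z)) = p₀ z)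
    (sq : ∀ z ∈ strip σ, (starRingEnd ℂ) (q₀ ((starRingEnd ℂ) z)) = q₀ z)
    (sF : ∀ t, ∀ z ∈ strip σ, conjRefl F t z = F t z) :
    KGSol σ m φ₀ p₀ q₀ F (conjRefl φ) (conjRefl p) (conjRefl q) := by
  have key : ∀ {c : ℝ} {w₀ : ℂ → ℂ} {w f g : ℝ → ℂ → ℂ},
      (∀ t, ∀ z ∈ strip σ, w t z = mild c w₀ f t z) →
      (∀ z ∈ strip σ, (starRingEnd ℂ) (w₀ ((starRingEnd ℂ) z)) = w₀ z) →
      (∀ t, ∀ z ∈ strip σ, _root_.conjRefl f t z = g t z) →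
      ∀ t, ∀ z ∈ strip σ, _root_.conjRefl w t z = mild c w₀ g t z := by
    intro c w₀ w f g hw hs hfg t z hz
    have : _root_.conjRefl w t z = _root_.conjRefl (mild c w₀ f) t z := by
      simp only [_root_.conjRefl]; rw [hw t _ (conj_mem_strip hz)]
    rw [this, conjRefl_mild, mild, mild, hs _ (sub_real_mem_strip hz _), duhamel_congr hfg hz]
  refine ⟨h.hφ.conjRefl, h.hp.conjRefl, h.hq.conjRefl, key h.eφ sφ fun t z _ => ?_,
    key h.ep sp fun t z hz => ?_, key h.eq sq fun t z hz => ?_⟩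
  · have h2 : (starRingEnd ℂ) (2 : ℂ) = 2 := Complex.conj_ofNat 2
    simp [_root_.conjRefl, h2]
  · rw [← sF t z hz]; simp [_root_.conjRefl]
  · rw [← sF t z hz]; simp [_root_.conjRefl]

end KG
end Bounds

/-! ### The iteration map -/

section Step
variable {σ : ℝ}

/-- The source of the Klein–Gordon equation, frozen in time outside `[-T, T]`. -/
def clampedSource (T : ℝ) (u v : ℝ → ℂ → ℂ) (t : ℝ) (z : ℂ) : ℂ := dkgSource u v (timeClamp T t) z

theorem StripHol.clampedSource {u v : ℝ → ℂ → ℂ} (hu : StripHol σ u) (hv : StripHol σ v) (T : ℝ) :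
    StripHol σ (clampedSource T u v) :=
  (hu.dkgSource hv).reparam (continuous_timeClamp T)

theorem conjRefl_dkgSource (u v : ℝ → ℂ → ℂ) (t : ℝ) (z : ℂ) :
    conjRefl (dkgSource u v) t z = dkgSource u v t z := by
  simp only [conjRefl, dkgSource, map_add, map_mul, Complex.conj_conj]; ring

/-- The potentials among which the solution is found: holomorphic in the strip, bounded by `A`,
real on the real axis, and with imaginary part at most `η`. -/
structure AdmissiblePotential (σ A η : ℝ) (Φ : ℝ → ℂ → ℂ) : Prop where
  hol : StripHol σ Φ
  bound : ∀ t, ∀ z ∈ strip σ, ‖Φ t z‖ ≤ A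
  im_le : ∀ t, ∀ z ∈ strip σ, |(Φ t z).im| ≤ η
  symm : ∀ t, ∀ z ∈ strip σ, conjRefl Φ t z = Φ t z

section Bounds
variable {M m D A N η T : ℝ} {u₀ v₀ φ₀ p₀ q₀ : ℂ → ℂ} {Φ u v φ p q : ℝ → ℂ → ℂ}

/-- The `L¹` norm of the source on lines is bounded by the charge, with no growth in time. The
source at `x + iy` pairs values on the lines of height `y` and `-y`. -/
theorem integral_norm_dkgSource_le (hu : StripHol σ u) (hv : StripHol σ v) {t : ℝ}
    (hc : ∀ y, |y| < σ → ∀ a b : ℝ, a ≤ b →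
      ∫ x in a..b, (‖u t (x + y * Complex.I)‖ ^ 2 + ‖v t (x + y * Complex.I)‖ ^ 2) ≤ 2 * D)
    {y : ℝ} (hy : |y| < σ) {a b : ℝ} (hab : a ≤ b) :
    ∫ x in a..b, ‖dkgSource u v t (x + y * Complex.I)‖ ≤ 2 * D := by
  have hy' : |-y| < σ := by rwa [abs_neg]
  have cl : ∀ {w : ℝ → ℂ → ℂ} {y : ℝ}, StripHol σ w → |y| < σ →
      Continuous fun x : ℝ => w t (x + y * Complex.I) := fun hw hy =>
    hw.comp_cont continuous_const (by fun_prop) fun x => line_mem_strip hy x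
  have c1 : ∀ {y : ℝ}, |y| < σ → Continuous fun x : ℝ =>
      ‖u t (x + y * Complex.I)‖ ^ 2 + ‖v t (x + y * Complex.I)‖ ^ 2 := fun hy =>
    ((cl hu hy).norm.pow 2).add ((cl hv hy).norm.pow 2)
  have h1 : ∫ x in a..b, ‖dkgSource u v t (x + y * Complex.I)‖ ≤ ∫ x in a..b, (1 / 2 : ℝ) *
      ((‖u t (x + (-y : ℝ) * Complex.I)‖ ^ 2 + ‖v t (x + (-y : ℝ) * Complex.I)‖ ^ 2)
        + (‖u t (x + y * Complex.I)‖ ^ 2 + ‖v t (x + y * Complex.I)‖ ^ 2)) := by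
    refine intervalIntegral.integral_mono hab
      ((cl (hu.dkgSource hv) hy).norm.intervalIntegrable _ _)
      ((((c1 hy').add (c1 hy)).const_mul _).intervalIntegrable _ _) fun x => ?_
    refine (norm_dkgSource_le u v t _).trans ?_
    rw [conj_line]
    nlinarith [sq_nonneg (‖u t (x + (-y : ℝ) * Complex.I)‖ - ‖v t (x + y * Complex.I)‖),
      sq_nonneg (‖v t (x + (-y : ℝ) * Complex.I)‖ - ‖u t (x + y * Complex.I)‖)]
  rw [intervalIntegral.integral_const_mul, intervalIntegral.integral_add
    ((c1 hy').intervalIntegrable _ _) ((c1 hy).intervalIntegrable _ _)] at h1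
  linarith [hc _ hy' a b hab, hc _ hy a b hab]

/-- `kleinGordon_bound` on the horizontal line through a point of the strip. -/
theorem KGSol.norm_le_of_source {F : ℝ → ℂ → ℂ} (h : KGSol σ m φ₀ p₀ q₀ F φ p q)
    (hφ : DifferentiableOn ℂ φ₀ (strip σ)) (hp : DifferentiableOn ℂ p₀ (strip σ))
    (hq : DifferentiableOn ℂ q₀ (strip σ)) (bφ : ∀ z ∈ strip σ, ‖φ₀ z‖ ≤ D)
    (bp : ∀ z ∈ strip σ, ‖p₀ z‖ ≤ D) (bq : ∀ z ∈ strip σ, ‖q₀ z‖ ≤ D)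
    (hc : ∀ z ∈ strip σ, deriv φ₀ z = (p₀ z - q₀ z) / 2) (hF : StripHol σ F) {C : ℝ}
    (hFC : ∀ t, |t| ≤ T → ∀ y, |y| < σ → ∀ a b : ℝ, a ≤ b →
      ∫ x in a..b, ‖F t (x + y * Complex.I)‖ ≤ C)
    {t : ℝ} (ht : |t| ≤ T) {z : ℂ} (hz : z ∈ strip σ) :
    ‖φ t z‖ ≤ D * (1 + T + m ^ 2 * T ^ 2 / 2) + C * T / 2 := by
  have hy : |z.im| < σ := hz
  have key := kleinGordon_bound (m := m) (F := fun t x => F t (x + z.im * Complex.I))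
    (h.isC1_φ hφ hy) (h.isC1_p hp hF hy) (h.isC1_q hq hF hy)
    (hF.continuous_line hy) (fun s y => by ring)
    (fun s y => by
      rw [h.deriv_φ hφ hp hq hF hc s (line_mem_strip hy y)]; ring)
    (fun s y => by ring) (fun s y => by ring)
    (fun s hs a b hab => hFC s hs _ hy a b hab)
    (fun y => by
      rw [h.eφ 0 _ (line_mem_strip hy y), mild_zero]; exact bφ _ (line_mem_strip hy y))
    (fun y => by
      rw [h.ep 0 _ (line_mem_strip hy y), mild_zero]; exact bp _ (line_mem_strip hy y))
    (fun y => by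
      rw [h.eq 0 _ (line_mem_strip hy y), mild_zero]; exact bq _ (line_mem_strip hy y)) ht z.re
  simpa using key

/-- Bound for a solution of a transport equation with source `F - m² φ`, where `F` is controlled by
a field `a` whose flux through the characteristics is bounded. -/
theorem norm_mild_source_le {c : ℝ} {w₀ : ℂ → ℂ} (hT : 0 < T) (hA : 0 ≤ A) (hN : 0 ≤ N)
    {F a : ℝ → ℂ → ℂ} (hF : StripHol σ F) (hφ : StripHol σ φ) (ha : StripHol σ a)
    (hw : ∀ z ∈ strip σ, ‖w₀ z‖ ≤ D) (hφA : ∀ t, |t| ≤ T → ∀ z ∈ strip σ, ‖φ t z‖ ≤ A)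
    (hFa : ∀ t, |t| ≤ T → ∀ z ∈ strip σ, ‖F t z‖ ≤ N * (‖a t ((starRingEnd ℂ) z)‖ + ‖a t z‖))
    {t : ℝ} (ht : |t| ≤ T) {Q : ℝ}
    (hfl : ∀ z ∈ strip σ, |∫ s in (0 : ℝ)..t, ‖a s (z - (c * (t - s) : ℝ))‖ ^ 2| ≤ Q)
    {z : ℂ} (hz : z ∈ strip σ) :
    ‖mild c w₀ (fun s ζ => F s ζ - (m ^ 2 : ℂ) * φ s ζ) t z‖
      ≤ D + N * ((Q + 1) * √T) + m ^ 2 * T * A := by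
  have e : mild c w₀ (fun s ζ => F s ζ - (m ^ 2 : ℂ) * φ s ζ) t z
      = w₀ (z - (c * t : ℝ)) + duhamel c F t z - (m ^ 2 : ℂ) * duhamel c φ t z := by
    rw [mild, duhamel, duhamel, duhamel, intervalIntegral.integral_sub,
      intervalIntegral.integral_const_mul]
    · ring
    · exact (hF.continuous_char hz continuous_id (by fun_prop)).intervalIntegrable _ _
    · exact ((hφ.continuous_char hz continuous_id (by fun_prop)).const_mul _).intervalIntegrable _ _
  rw [e]
  have hz' := conj_mem_strip hz
  have h1 : ‖duhamel c F t z‖ ≤ N * ((Q + 1) * √T) := by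
    refine norm_integral_le_of_sq (g := fun s => a s ((starRingEnd ℂ) z - (c * (t - s) : ℝ)))
      (h := fun s => a s (z - (c * (t - s) : ℝ))) hN hT ht
      (ha.continuous_char hz' continuous_id (b := fun s => c * (t - s)) (by fun_prop))
      (ha.continuous_char hz continuous_id (b := fun s => c * (t - s)) (by fun_prop))
      (fun s hs => ?_) (hfl _ hz') (hfl _ hz)
    have := hFa s (hs.trans ht) _ (sub_real_mem_strip hz (c * (t - s)))
    simpa using this
  have h2 : ‖duhamel c φ t z‖ ≤ A * T := by
    have := intervalIntegral.norm_integral_le_of_norm_le_const (a := 0) (b := t) (C := A)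
      (f := fun s => φ s (z - (c * (t - s) : ℝ))) fun s hs => ?_
    · refine this.trans ?_
      rw [sub_zero]
      exact mul_le_mul_of_nonneg_left ht hA
    · have hs' : |s| ≤ |t| := by
        have := abs_sub_left_of_mem_uIcc (uIoc_subset_uIcc hs)
        simpa using this
      exact hφA s (hs'.trans ht) _ (sub_real_mem_strip hz _)
  have h3 : ‖(m ^ 2 : ℂ) * duhamel c φ t z‖ ≤ m ^ 2 * T * A := by
    rw [norm_mul]
    have hm : ‖(m ^ 2 : ℂ)‖ = m ^ 2 := by simp
    rw [hm]
    nlinarith [mul_le_mul_of_nonneg_left h2 (sq_nonneg m)]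
  refine (norm_sub_le _ _).trans (add_le_add ((norm_add_le _ _).trans (add_le_add ?_ h1)) h3)
  exact hw _ (sub_real_mem_strip hz _)

/-- A function that is real on the real axis has small imaginary part in a thin strip. -/
theorem abs_im_le_of_deriv_le {f : ℂ → ℂ} {B : ℝ} (hf : DifferentiableOn ℂ f (strip σ))
    (hs : ∀ z ∈ strip σ, (starRingEnd ℂ) (f ((starRingEnd ℂ) z)) = f z)
    (hB : ∀ z ∈ strip σ, ‖deriv f z‖ ≤ B) {z : ℂ} (hz : z ∈ strip σ) : |(f z).im| ≤ σ * B := by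
  have hσ : 0 < σ := (abs_nonneg _).trans_lt hz
  have hr : (z.re : ℂ) ∈ strip σ := by simpa [strip] using hσ
  have hB0 : 0 ≤ B := (norm_nonneg _).trans (hB z hz)
  have h1 := (convex_strip σ).norm_image_sub_le_of_norm_deriv_le
    (fun w hw => hf.differentiableAt ((isOpen_strip σ).mem_nhds hw)) hB hr hz
  have h2 : (f z.re).im = 0 := by
    have := hs _ hr
    rw [Complex.conj_ofReal] at this
    exact Complex.conj_eq_iff_im.1 this
  have h3 : |(f z).im| ≤ ‖f z - f z.re‖ := by
    have := Complex.abs_im_le_norm (f z - f z.re)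
    rwa [Complex.sub_im, h2, sub_zero] at this
  have h4 : ‖z - (z.re : ℂ)‖ = |z.im| := by
    have : z - (z.re : ℂ) = (z.im : ℂ) * Complex.I := by
      apply Complex.ext <;> simp
    rw [this]; simp
  rw [h4] at h1
  have hz2 : |z.im| ≤ σ := le_of_lt hz
  nlinarith

/-- The map which solves the Dirac equation with a given potential, and then the Klein–Gordon
equation with the resulting source, preserves the admissible potentials. The hypotheses `hA`, `hN`
and `hB` say that `A` dominates `φ`, that `N` dominates `u` and `v`, and that the strip is so thin
that the bound on `∂_z φ` forces `|Im φ| ≤ η`. -/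
theorem exists_step (hd : DKGData σ D u₀ v₀ φ₀ p₀ q₀) (hD : 0 ≤ D) (hT : 0 < T)
    (hη : 0 ≤ η) (hηT : Real.exp (2 * η * T) ≤ 2)
    (hA : D * (1 + T + m ^ 2 * T ^ 2 / 2) + D * T ≤ A)
    (hN : D + (A + |M|) / 2 * ((2 * D + 1) * √T) ≤ N)
    (hB : σ * (D + N * ((2 * D + 1) * √T) + m ^ 2 * T * A) ≤ η)
    (hΦ : AdmissiblePotential σ A η Φ) :
    ∃ u v φ p q, DiracSol σ M u₀ v₀ Φ u v ∧ KGSol σ m φ₀ p₀ q₀ (clampedSource T u v) φ p q ∧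
      (∀ t, |t| ≤ T → ∀ z ∈ strip σ, ‖u t z‖ ≤ N ∧ ‖v t z‖ ≤ N) ∧
      AdmissiblePotential σ A η (fun t z => φ (timeClamp T t) z) ∧
      ∃ C, 0 ≤ C ∧ ∀ t, |t| ≤ T → ∀ z ∈ strip σ, ‖φ t z‖ ≤ C ∧ ‖p t z‖ ≤ C ∧ ‖q t z‖ ≤ C := by
  have hA0 : 0 ≤ A := le_trans (by positivity) hA
  have hN0 : 0 ≤ N := le_trans (by positivity) hN
  obtain ⟨u, v, huv⟩ := exists_diracSol (M := M) hd.hu hd.hv hd.bu hd.bv hD hA0 hΦ.hol hΦ.bound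
  have buv : ∀ t, |t| ≤ T → ∀ z ∈ strip σ, ‖u t z‖ ≤ N ∧ ‖v t z‖ ≤ N := fun t ht z hz => by
    have := huv.norm_le hd.hu hd.hv hd.bu hd.bv hΦ.hol hη hηT hD hA0 hT hΦ.im_le hΦ.bound hd.charge
      ht hz
    exact ⟨this.1.trans hN, this.2.trans hN⟩
  have hF := huv.hu.clampedSource huv.hv T
  have hcl := abs_timeClamp_le hT.le
  have bF : ∀ t, ∀ z ∈ strip σ, ‖clampedSource T u v t z‖ ≤ N * N + N * N := fun t z hz => by
    refine (norm_dkgSource_le u v _ _).trans (add_le_add ?_ ?_)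
    · exact mul_le_mul (buv _ (hcl t) _ (conj_mem_strip hz)).1 (buv _ (hcl t) _ hz).2
        (norm_nonneg _) hN0
    · exact mul_le_mul (buv _ (hcl t) _ (conj_mem_strip hz)).2 (buv _ (hcl t) _ hz).1
        (norm_nonneg _) hN0
  obtain ⟨φ, p, q, hkg, C, lam, hC, hlam, hb⟩ := exists_kgSol (m := m) hd.hφ hd.hp hd.hq hd.bφ hd.bp
    hd.bq hD (by positivity) hF bF
  have hbT : ∀ t, |t| ≤ T → ∀ z ∈ strip σ, ‖φ t z‖ ≤ C * Real.exp (lam * T) ∧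
      ‖p t z‖ ≤ C * Real.exp (lam * T) ∧ ‖q t z‖ ≤ C * Real.exp (lam * T) := fun t ht z hz => by
    have : C * Real.exp (lam * |t|) ≤ C * Real.exp (lam * T) := by gcongr
    obtain ⟨h1, h2, h3⟩ := hb t z hz
    exact ⟨h1.trans this, h2.trans this, h3.trans this⟩
  have bφ : ∀ t, |t| ≤ T → ∀ z ∈ strip σ, ‖φ t z‖ ≤ A := fun t ht z hz => by
    refine (hkg.norm_le_of_source hd.hφ hd.hp hd.hq hd.bφ hd.bp hd.bq hd.compat hF (C := 2 * D)
      (T := T)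
      (fun s _ y hy a b hab => ?_) ht hz).trans (le_trans (le_of_eq (by ring)) hA)
    exact integral_norm_dkgSource_le huv.hu huv.hv (fun y hy => (huv.charge_le hd.hu hd.hv hΦ.hol hη
      hηT hD hΦ.im_le hd.charge (hcl s) hy).1) hy hab
  have hsymm : ∀ t, |t| ≤ T → ∀ z ∈ strip σ, conjRefl φ t z = φ t z := fun t ht z hz => by
    -- the reflected conjugate solves the same problem, hence is the same solution
    have h' := hkg.conjRefl hd.sφ hd.sp hd.sq fun t z _ => conjRefl_dkgSource u v _ z
    have := h'.norm_sub_le hkg hF hF (T := T) (d := 0) (C := C * Real.exp (lam * T))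
      (lam := 2 * (1 + m ^ 2)) le_rfl
      (by positivity) le_rfl (fun t ht z hz => by
        simpa [conjRefl] using hbT t ht _ (conj_mem_strip hz)) hbT (fun t _ z _ => by simp) ht hz
    rw [zero_div, mul_zero, zero_mul] at this
    exact sub_eq_zero.1 (norm_le_zero_iff.1 this)
  have hflux := fun (t : ℝ) (ht : |t| ≤ T) (z : ℂ) (hz : z ∈ strip σ) =>
    huv.flux_le hd.hu hd.hv hΦ.hol hη hηT hD hΦ.im_le hd.charge ht hz
  have bFu : ∀ t, |t| ≤ T → ∀ z ∈ strip σ, ‖clampedSource T u v t z‖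
      ≤ N * (‖u t ((starRingEnd ℂ) z)‖ + ‖u t z‖) := fun t ht z hz => by
    rw [clampedSource, timeClamp_of_abs_le ht]
    refine (norm_dkgSource_le u v t z).trans ?_
    have h1 := mul_le_mul_of_nonneg_left (buv t ht z hz).2 (norm_nonneg (u t ((starRingEnd ℂ) z)))
    have h2 := mul_le_mul_of_nonneg_right (buv t ht _ (conj_mem_strip hz)).2 (norm_nonneg (u t z))
    linarith
  have bFv : ∀ t, |t| ≤ T → ∀ z ∈ strip σ, ‖clampedSource T u v t z‖
      ≤ N * (‖v t ((starRingEnd ℂ) z)‖ + ‖v t z‖) := fun t ht z hz => by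
    rw [clampedSource, timeClamp_of_abs_le ht]
    refine (norm_dkgSource_le u v t z).trans ?_
    have h1 := mul_le_mul_of_nonneg_left (buv t ht z hz).1 (norm_nonneg (v t ((starRingEnd ℂ) z)))
    have h2 := mul_le_mul_of_nonneg_right (buv t ht _ (conj_mem_strip hz)).1 (norm_nonneg (v t z))
    linarith
  have bp : ∀ t, |t| ≤ T → ∀ z ∈ strip σ, ‖p t z‖
      ≤ D + N * ((2 * D + 1) * √T) + m ^ 2 * T * A := fun t ht z hz => by
    rw [hkg.ep t z hz]
    exact norm_mild_source_le hT hA0 hN0 hF hkg.hφ huv.hu hd.bp bφ bFu ht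
      (fun z hz => (hflux t ht z hz).1) hz
  have bq : ∀ t, |t| ≤ T → ∀ z ∈ strip σ, ‖q t z‖
      ≤ D + N * ((2 * D + 1) * √T) + m ^ 2 * T * A := fun t ht z hz => by
    rw [hkg.eq t z hz]
    exact norm_mild_source_le hT hA0 hN0 hF hkg.hφ huv.hv hd.bq bφ bFv ht
      (fun z hz => (hflux t ht z hz).2) hz
  refine ⟨u, v, φ, p, q, huv, hkg, buv, ⟨hkg.hφ.reparam (continuous_timeClamp T),
    fun t z hz => bφ _ (hcl t) z hz, fun t z hz => ?_, fun t z hz => hsymm _ (hcl t) z hz⟩,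
    C * Real.exp (lam * T), by positivity, hbT⟩
  refine (abs_im_le_of_deriv_le (hkg.hφ.hol _) (fun z hz => hsymm _ (hcl t) z hz)
    (fun z hz => ?_) hz).trans hB
  rw [hkg.deriv_φ hd.hφ hd.hp hd.hq hF hd.compat _ hz, norm_mul]
  have h1 := norm_sub_le (p (timeClamp T t) z) (q (timeClamp T t) z)
  have h2 := bp _ (hcl t) z hz
  have h3 := bq _ (hcl t) z hz
  have h4 : ‖(1 / 2 : ℂ)‖ = 1 / 2 := by norm_num
  rw [h4]
  linarith

end Bounds
end Step

/-! ### Contraction and the coupled system -/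

section FixedPoint
variable {σ M m D A N η T : ℝ} {u₀ v₀ φ₀ p₀ q₀ : ℂ → ℂ} {Φ Φ' u v u' v' φ p q : ℝ → ℂ → ℂ}

/-- Lipschitz dependence of the Dirac field on the potential, with a gain of `1 / λ`, in the norm
with weight `e^{-λ|t|}`. -/
theorem DiracSol.norm_sub_le {lam d : ℝ} (h : DiracSol σ M u₀ v₀ Φ u v)
    (h' : DiracSol σ M u₀ v₀ Φ' u' v') (hΦ : StripHol σ Φ) (hΦ' : StripHol σ Φ') (hd : 0 ≤ d)
    (hA : 0 ≤ A) (hN : 0 ≤ N) (hlam : 2 * (A + |M|) ≤ lam) (hl : 0 < lam)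
    (bΦ : ∀ t, ∀ z ∈ strip σ, ‖Φ t z‖ ≤ A)
    (b : ∀ t, |t| ≤ T → ∀ z ∈ strip σ, ‖u t z‖ ≤ N ∧ ‖v t z‖ ≤ N)
    (b' : ∀ t, |t| ≤ T → ∀ z ∈ strip σ, ‖u' t z‖ ≤ N ∧ ‖v' t z‖ ≤ N)
    (hΦd : ∀ t, ∀ z ∈ strip σ, ‖Φ t z - Φ' t z‖ ≤ d * Real.exp (lam * |t|))
    {t : ℝ} (ht : |t| ≤ T) {z : ℂ} (hz : z ∈ strip σ) :
    ‖u t z - u' t z‖ ≤ 2 * (N * d / lam) * Real.exp (lam * |t|) ∧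
      ‖v t z - v' t z‖ ≤ 2 * (N * d / lam) * Real.exp (lam * |t|) := by
  have hS : ∀ (w w' : ℂ) (s : ℝ), ∀ ζ ∈ strip σ, ∀ B, ‖w - w'‖ ≤ B → ‖w'‖ ≤ N →
      ‖diracPot M Φ s ζ * w - diracPot M Φ' s ζ * w'‖
        ≤ (A + |M|) * B + N * d * Real.exp (lam * |s|) := by
    intro w w' s ζ hζ B hB hw
    have e : diracPot M Φ s ζ * w - diracPot M Φ' s ζ * w'
        = diracPot M Φ s ζ * (w - w') + Complex.I * (Φ s ζ - Φ' s ζ) * w' := by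
      simp only [diracPot]; ring
    rw [e]
    refine (norm_add_le _ _).trans (add_le_add ?_ ?_)
    · rw [norm_mul]
      exact mul_le_mul (norm_diracPot_le (bΦ s ζ hζ)) hB (norm_nonneg _) (by positivity)
    · rw [norm_mul, norm_mul, Complex.norm_I, one_mul]
      refine (mul_le_mul (hΦd s ζ hζ) hw (norm_nonneg _) (by positivity)).trans (le_of_eq ?_)
      ring
  have key := duhamel_gronwall (σ := σ) (ι := Fin 2)
    (δ := ![fun t z => u t z - u' t z, fun t z => v t z - v' t z])
    (h := ![fun s ζ => diracPot M Φ s ζ * v s ζ - diracPot M Φ' s ζ * v' s ζ,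
      fun s ζ => diracPot M Φ s ζ * u s ζ - diracPot M Φ' s ζ * u' s ζ])
    (c := ![1, -1]) (K := A + |M|) (d := N * d) (lam := lam) (T := T) (C := N + N) (by positivity)
    (by positivity) hl hlam (by positivity)
    (fun j t ht z hz => by
      fin_cases j
      · exact (_root_.norm_sub_le _ _).trans (add_le_add (b t ht z hz).1 (b' t ht z hz).1)
      · exact (_root_.norm_sub_le _ _).trans (add_le_add (b t ht z hz).2 (b' t ht z hz).2))
    (fun j t ht z hz => by
      fin_cases j
      · refine le_of_eq (congrArg _ ?_)
        change u t z - u' t z = _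
        rw [h.eu t z hz, h'.eu t z hz]
        exact mild_sub ((hΦ.diracPot M).mul h.hv) ((hΦ'.diracPot M).mul h'.hv) t hz
      · refine le_of_eq (congrArg _ ?_)
        change v t z - v' t z = _
        rw [h.ev t z hz, h'.ev t z hz]
        exact mild_sub ((hΦ.diracPot M).mul h.hu) ((hΦ'.diracPot M).mul h'.hu) t hz)
    (fun s hs B hB hb j ζ hζ => by
      fin_cases j
      · exact hS _ _ s ζ hζ B (hb 1 ζ hζ) (b' s hs ζ hζ).2
      · exact hS _ _ s ζ hζ B (hb 0 ζ hζ) (b' s hs ζ hζ).1)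
  exact ⟨key 0 t ht z hz, key 1 t ht z hz⟩

theorem norm_dkgSource_sub_le {t : ℝ} {e : ℝ} (hN : 0 ≤ N)
    (b : ∀ z ∈ strip σ, ‖u t z‖ ≤ N ∧ ‖v t z‖ ≤ N)
    (b' : ∀ z ∈ strip σ, ‖u' t z‖ ≤ N ∧ ‖v' t z‖ ≤ N)
    (h : ∀ z ∈ strip σ, ‖u t z - u' t z‖ ≤ e ∧ ‖v t z - v' t z‖ ≤ e) {z : ℂ} (hz : z ∈ strip σ) :
    ‖dkgSource u v t z - dkgSource u' v' t z‖ ≤ 4 * N * e := by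
  have hz' := conj_mem_strip hz
  have he : 0 ≤ e := (norm_nonneg _).trans (h z hz).1
  have key : ∀ {a a' w w' : ℂ}, ‖a - a'‖ ≤ e → ‖w - w'‖ ≤ e → ‖a'‖ ≤ N → ‖w‖ ≤ N →
      ‖(starRingEnd ℂ) a * w - (starRingEnd ℂ) a' * w'‖ ≤ 2 * N * e := by
    intro a a' w w' ha hw ha' hw'
    have : (starRingEnd ℂ) a * w - (starRingEnd ℂ) a' * w'
        = (starRingEnd ℂ) (a - a') * w + (starRingEnd ℂ) a' * (w - w') := by rw [map_sub]; ring
    rw [this]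
    refine (norm_add_le _ _).trans ?_
    rw [norm_mul, norm_mul, RCLike.norm_conj, RCLike.norm_conj]
    have h1 := mul_le_mul ha hw' (norm_nonneg _) he
    have h2 := mul_le_mul ha' hw (norm_nonneg _) hN
    linarith
  have e1 : dkgSource u v t z - dkgSource u' v' t z
      = (conjRefl u t z * v t z - conjRefl u' t z * v' t z)
        + (conjRefl v t z * u t z - conjRefl v' t z * u' t z) := by
    simp only [dkgSource]; ring
  rw [e1]
  refine (norm_add_le _ _).trans ?_
  have h1 := key (h _ hz').1 (h z hz).2 (b' _ hz').1 (b z hz).2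
  have h2 := key (h _ hz').2 (h z hz).1 (b' _ hz').2 (b z hz).1
  simp only [conjRefl]
  linarith

/-- Solution of the coupled system in the strip, up to time `T`, as a fixed point of the map of
`exists_step`. The potential `Φ` agrees with the scalar field `φ` only for `|t| ≤ T`. -/
theorem exists_strip_solution (hd : DKGData σ D u₀ v₀ φ₀ p₀ q₀) (hD : 0 ≤ D) (hT : 0 < T)
    (hη : 0 ≤ η) (hηT : Real.exp (2 * η * T) ≤ 2)
    (hA : D * (1 + T + m ^ 2 * T ^ 2 / 2) + D * T ≤ A)
    (hN : D + (A + |M|) / 2 * ((2 * D + 1) * √T) ≤ N)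
    (hB : σ * (D + N * ((2 * D + 1) * √T) + m ^ 2 * T * A) ≤ η) :
    ∃ Φ u v φ p q, AdmissiblePotential σ A η Φ ∧ DiracSol σ M u₀ v₀ Φ u v ∧
      KGSol σ m φ₀ p₀ q₀ (clampedSource T u v) φ p q ∧
      (∀ t, |t| ≤ T → ∀ z ∈ strip σ, ‖u t z‖ ≤ N ∧ ‖v t z‖ ≤ N) ∧
      (∀ t, |t| ≤ T → ∀ z ∈ strip σ, ‖φ t z‖ ≤ A ∧ Φ t z = φ t z) ∧
      ∃ C, ∀ t, |t| ≤ T → ∀ z ∈ strip σ, ‖p t z‖ ≤ C ∧ ‖q t z‖ ≤ C := by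
  classical
  have hA0 : 0 ≤ A := le_trans (by positivity) hA
  have hN0 : 0 ≤ N := le_trans (by positivity) hN
  have step := fun Φ (hΦ : AdmissiblePotential σ A η Φ) =>
    exists_step (M := M) (m := m) hd hD hT hη hηT hA hN hB hΦ
  choose! U V φ P Q hU hK hb hadm C hC0 hC using step
  -- large enough for both Grönwall arguments, and for their composition to contract by `1 / 2`
  set lam : ℝ := 1 + 2 * (A + |M|) + 2 * (1 + m ^ 2) + 32 * N ^ 2 with hlam
  have hl1 : 1 ≤ lam := by
    have : 0 ≤ 2 * (A + |M|) + 2 * (1 + m ^ 2) + 32 * N ^ 2 := by positivity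
    linarith
  have hl : 0 < lam := by linarith
  have hcl := abs_timeClamp_le hT.le
  have hone : ∀ t : ℝ, 1 ≤ Real.exp (lam * |t|) := fun t => Real.one_le_exp (by positivity)
  obtain ⟨Φ, hΦ, hfix⟩ := exists_fixedPoint_weighted (σ := σ) (lam := lam) (C := A)
    {Φ | AdmissiblePotential σ A η Φ} (fun Φ t z => φ Φ (timeClamp T t) z) (w₀ := fun _ _ => 0)
    ⟨StripHol.zero, fun _ _ _ => by simpa, fun _ _ _ => by simpa, fun _ _ _ => by simp [conjRefl]⟩
    (fun Φ hΦ => hadm Φ hΦ) (fun Φ hΦ => hΦ.hol)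
    (fun W w hW hw hlim => ⟨hw,
      fun t z hz => le_of_tendsto' (hlim t z hz).norm fun n => (hW n).bound t z hz,
      fun t z hz => le_of_tendsto' ((Complex.continuous_im.tendsto _).comp (hlim t z hz)).abs
        fun n => (hW n).im_le t z hz,
      fun t z hz => tendsto_nhds_unique
        ((Complex.continuous_conj.tendsto _).comp (hlim t _ (conj_mem_strip hz)))
        ((hlim t z hz).congr fun n => ((hW n).symm t z hz).symm)⟩)
    (fun t z hz => by
      rw [sub_zero]
      have h0 : AdmissiblePotential σ A η fun _ _ => 0 :=
        ⟨StripHol.zero, fun _ _ _ => by simpa, fun _ _ _ => by simpa, fun _ _ _ =>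
          by simp [conjRefl]⟩
      exact ((hadm _ h0).bound t z hz).trans (le_mul_of_one_le_right hA0 (hone t)))
    (fun Φ hΦ Φ' hΦ' d hd0 hdd t z hz => by
      have hdirac := fun t (ht : |t| ≤ T) z (hz : z ∈ strip σ) =>
        (hU Φ hΦ).norm_sub_le (hU Φ' hΦ') hΦ.hol hΦ'.hol (T := T) hd0 hA0 hN0
          (by rw [hlam]; linarith [sq_nonneg m, sq_nonneg N]) hl
          hΦ.bound (hb Φ hΦ) (hb Φ' hΦ') hdd ht hz
      have hsrc : ∀ t, |t| ≤ T → ∀ z ∈ strip σ, ‖clampedSource T (U Φ) (V Φ) t z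
          - clampedSource T (U Φ') (V Φ') t z‖ ≤ 8 * N ^ 2 * d / lam * Real.exp (lam * |t|) := by
        intro t ht z hz
        rw [clampedSource, clampedSource, timeClamp_of_abs_le ht]
        refine (norm_dkgSource_sub_le hN0 (hb Φ hΦ t ht) (hb Φ' hΦ' t ht) (hdirac t ht) hz).trans
          (le_of_eq ?_)
        ring
      have hkg := (hK Φ hΦ).norm_sub_le (hK Φ' hΦ') ((hU Φ hΦ).hu.clampedSource (hU Φ hΦ).hv T)
        ((hU Φ' hΦ').hu.clampedSource (hU Φ' hΦ').hv T) (T := T) (lam := lam)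
        (d := 8 * N ^ 2 * d / lam) (C := max (C Φ) (C Φ')) (by positivity)
        (le_max_of_le_left (hC0 Φ hΦ))
        (by rw [hlam]; linarith [sq_nonneg N, abs_nonneg M])
        (fun t ht z hz => by
          obtain ⟨h1, h2, h3⟩ := hC Φ hΦ t ht z hz
          exact ⟨le_max_of_le_left h1, le_max_of_le_left h2, le_max_of_le_left h3⟩)
        (fun t ht z hz => by
          obtain ⟨h1, h2, h3⟩ := hC Φ' hΦ' t ht z hz
          exact ⟨le_max_of_le_right h1, le_max_of_le_right h2, le_max_of_le_right h3⟩)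
        hsrc (hcl t) hz
      refine hkg.trans ?_
      have h1 : 2 * (8 * N ^ 2 * d / lam / lam) ≤ d / 2 := by
        rw [div_div, ← mul_div_assoc, div_le_div_iff₀ (by positivity) (by norm_num)]
        have h2 : 32 * N ^ 2 ≤ lam * lam := by
          have : 32 * N ^ 2 ≤ lam := by rw [hlam]; linarith [sq_nonneg m, abs_nonneg M]
          nlinarith
        nlinarith [mul_le_mul_of_nonneg_left h2 hd0]
      have h3 := abs_timeClamp_le_abs hT.le t
      gcongr)
  refine ⟨Φ, U Φ, V Φ, φ Φ, P Φ, Q Φ, hΦ, hU Φ hΦ, hK Φ hΦ, hb Φ hΦ, fun t ht z hz => ?_, C Φ,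
    fun t ht z hz => (hC Φ hΦ t ht z hz).2⟩
  have := hfix t z hz
  simp only [timeClamp_of_abs_le ht] at this
  exact ⟨by rw [this]; exact hΦ.bound t z hz, this.symm⟩

end FixedPoint

/-! ### Strip solutions of width `T⁻⁴` -/

/-- Energy bound on lines for diagonal first-order systems, in both directions of time. -/
theorem system_line_energy {ι : Type*} [Fintype ι] {w wt wx : ι → ℝ → ℝ → ℂ}
    (h : ∀ j, IsC1 (w j) (wt j) (wx j)) {c : ι → ℝ} (hc : ∀ j, |c j| ≤ 1) {k T Q : ℝ}
    (hN : ∀ s, |s| ≤ T → ∀ y,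
      ∑ j, ‖wt j s y + (c j : ℂ) * wx j s y‖ ^ 2 ≤ k * ∑ j, ‖w j s y‖ ^ 2)
    (h₀ : ∀ a b, a ≤ b → ∫ y in a..b, ∑ j, ‖w j 0 y‖ ^ 2 ≤ Q) {t : ℝ} (ht : |t| ≤ T) {a b : ℝ}
    (hab : a ≤ b) : ∫ y in a..b, ∑ j, ‖w j t y‖ ^ 2 ≤ Real.exp ((1 + k) * |t|) * Q := by
  have key : ∀ {w wt wx : ι → ℝ → ℝ → ℂ} (_ : ∀ j, IsC1 (w j) (wt j) (wx j))
      (_ : ∀ s, |s| ≤ T → ∀ y,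
        ∑ j, ‖wt j s y + (c j : ℂ) * wx j s y‖ ^ 2 ≤ k * ∑ j, ‖w j s y‖ ^ 2)
      (_ : ∀ a b, a ≤ b → ∫ y in a..b, ∑ j, ‖w j 0 y‖ ^ 2 ≤ Q) {t : ℝ} (_ : 0 ≤ t) (_ : t ≤ T)
      {a b : ℝ} (_ : a ≤ b), ∫ y in a..b, ∑ j, ‖w j t y‖ ^ 2 ≤ Real.exp ((1 + k) * t) * Q := by
    intro w wt wx h hN h₀ t ht0 ht a b hab
    have e := system_cone_energy h hc (k := k) (t := t + (b - a) / 2) (t₁ := t) (x := (a + b) / 2)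
      ht0 (by linarith)
      (fun s hs y _ => hN s (by rw [abs_of_nonneg hs.1]; exact hs.2.trans ht) y)
    have ea : (a + b) / 2 - (t + (b - a) / 2 - t) = a := by ring
    have eb : (a + b) / 2 + (t + (b - a) / 2 - t) = b := by ring
    rw [ea, eb] at e
    exact e.trans (mul_le_mul_of_nonneg_left (h₀ _ _ (by linarith)) (Real.exp_pos _).le)
  rcases le_total 0 t with h0 | h0
  · rw [abs_of_nonneg h0]
    exact key h hN h₀ h0 ((le_abs_self t).trans ht) hab
  · rw [abs_of_nonpos h0]
    have := key (fun j => (h j).reflect) (t := -t) (a := -b) (b := -a)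
      (fun s hs y => by
        have := hN (-s) (by rwa [abs_neg]) (-y)
        refine le_trans (le_of_eq (Finset.sum_congr rfl fun j _ => ?_)) this
        rw [← norm_neg]; congr 2; ring)
      (fun a b hab => by
        have := h₀ (-b) (-a) (by linarith)
        rw [← intervalIntegral.integral_comp_neg] at this
        simpa using this) (by linarith) ((neg_le_abs t).trans ht) (by linarith)
    rw [intervalIntegral.integral_comp_neg (fun y => ∑ j, ‖w j (- -t) y‖ ^ 2)] at this
    simpa using this

/-- `(u, v, φ, p, q)` solves the Dirac–Klein–Gordon system, in diagonal first-order form, for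
`|t| ≤ T` in the strip of half-width `σ`, with bounds that are uniform in the strip. -/
structure DKGStripSol (σ T M m : ℝ) (u v φ p q : ℝ → ℂ → ℂ) : Prop where
  hu : StripHol σ u
  hv : StripHol σ v
  hφ : StripHol σ φ
  hp : StripHol σ p
  hq : StripHol σ q
  dt_u : ∀ t, |t| ≤ T → ∀ z ∈ strip σ, HasDerivAt (fun t => u t z)
    (Complex.I * (φ t z - M) * v t z - deriv (u t) z) t
  dt_v : ∀ t, |t| ≤ T → ∀ z ∈ strip σ, HasDerivAt (fun t => v t z)
    (Complex.I * (φ t z - M) * u t z + deriv (v t) z) t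
  dt_φ : ∀ t, |t| ≤ T → ∀ z ∈ strip σ, HasDerivAt (fun t => φ t z)
    ((1 / 2 : ℂ) * (p t z + q t z)) t
  dt_p : ∀ t, |t| ≤ T → ∀ z ∈ strip σ, HasDerivAt (fun t => p t z)
    (dkgSource u v t z - (m ^ 2 : ℂ) * φ t z + deriv (p t) z) t
  dt_q : ∀ t, |t| ≤ T → ∀ z ∈ strip σ, HasDerivAt (fun t => q t z)
    (dkgSource u v t z - (m ^ 2 : ℂ) * φ t z - deriv (q t) z) t
  dx_φ : ∀ t, |t| ≤ T → ∀ z ∈ strip σ, deriv (φ t) z = (1 / 2 : ℂ) * (p t z - q t z)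
  /-- The fields are differentiable in time also for `|t| > T`, where they need not solve the
  equations. -/
  dt_global : ∃ g : Fin 5 → ℝ → ℂ → ℂ, ∀ j, StripHol σ (g j) ∧ ∀ t, ∀ z ∈ strip σ,
    HasDerivAt (fun t => (![u, v, φ, p, q] : Fin 5 → ℝ → ℂ → ℂ) j t z) (g j t z) t
  symm : ∀ t, |t| ≤ T → ∀ z ∈ strip σ, conjRefl φ t z = φ t z
  bdd : ∃ C, ∀ t, |t| ≤ T → ∀ z ∈ strip σ, ‖u t z‖ ≤ C ∧ ‖v t z‖ ≤ C ∧ ‖φ t z‖ ≤ C ∧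
    ‖p t z‖ ≤ C ∧ ‖q t z‖ ≤ C
  energy : ∃ C, ∀ t, |t| ≤ T → ∀ y, |y| < σ → ∀ a b : ℝ, a ≤ b →
    ∫ x in a..b, (‖u t (x + y * Complex.I)‖ ^ 2 + ‖v t (x + y * Complex.I)‖ ^ 2
      + ‖φ t (x + y * Complex.I)‖ ^ 2 + ‖p t (x + y * Complex.I)‖ ^ 2
      + ‖q t (x + y * Complex.I)‖ ^ 2) ≤ C

section Core
variable {σ M m D A N η T : ℝ} {u₀ v₀ φ₀ p₀ q₀ : ℂ → ℂ} {Φ u v φ p q : ℝ → ℂ → ℂ}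

/-- The five fields stay in `L²` on horizontal lines. The constant is immaterial: it may grow
exponentially in `T`, since only finiteness enters the Gevrey regularity. -/
theorem strip_energy (hd : DKGData σ D u₀ v₀ φ₀ p₀ q₀) (hΦ : AdmissiblePotential σ A η Φ)
    (hA : 0 ≤ A) (hD : 0 ≤ D)
    (huv : DiracSol σ M u₀ v₀ Φ u v) (hkg : KGSol σ m φ₀ p₀ q₀ (clampedSource T u v) φ p q)
    (hb : ∀ t, |t| ≤ T → ∀ z ∈ strip σ, ‖u t z‖ ≤ N ∧ ‖v t z‖ ≤ N)
    {t : ℝ} (ht : |t| ≤ T) {y : ℝ} (hy : |y| < σ) {a b : ℝ} (hab : a ≤ b) :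
    ∫ x in a..b, (‖u t (x + y * Complex.I)‖ ^ 2 + ‖v t (x + y * Complex.I)‖ ^ 2
      + ‖φ t (x + y * Complex.I)‖ ^ 2 + ‖p t (x + y * Complex.I)‖ ^ 2
      + ‖q t (x + y * Complex.I)‖ ^ 2)
      ≤ Real.exp ((1 + ((A + |M|) ^ 2 + 16 * N ^ 2 + 4 * m ^ 4 + 1)) * T) * (2 * D) := by
  set k : ℝ := (A + |M|) ^ 2 + 16 * N ^ 2 + 4 * m ^ 4 + 1 with hk
  have hk0 : 0 ≤ k := by positivity
  have hF := huv.hu.clampedSource huv.hv T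
  have hC : ∀ j : Fin 5, IsC1
      ((![fun t x => u t (x + y * Complex.I), fun t x => v t (x + y * Complex.I),
        fun t x => φ t (x + y * Complex.I), fun t x => p t (x + y * Complex.I),
        fun t x => q t (x + y * Complex.I)] : Fin 5 → ℝ → ℝ → ℂ) j)
      ((![fun t x => diracPot M Φ t (x + y * Complex.I) * v t (x + y * Complex.I)
          - deriv (u t) (x + y * Complex.I),
        fun t x => diracPot M Φ t (x + y * Complex.I) * u t (x + y * Complex.I)
          + deriv (v t) (x + y * Complex.I),
        fun t x => (1 / 2 : ℂ) * (p t (x + y * Complex.I) + q t (x + y * Complex.I)),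
        fun t x => clampedSource T u v t (x + y * Complex.I)
          - (m ^ 2 : ℂ) * φ t (x + y * Complex.I) + deriv (p t) (x + y * Complex.I),
        fun t x => clampedSource T u v t (x + y * Complex.I)
          - (m ^ 2 : ℂ) * φ t (x + y * Complex.I) - deriv (q t) (x + y * Complex.I)] :
          Fin 5 → ℝ → ℝ → ℂ) j)
      ((![fun t x => deriv (u t) (x + y * Complex.I), fun t x => deriv (v t) (x + y * Complex.I),
        fun t x => deriv (φ t) (x + y * Complex.I), fun t x => deriv (p t) (x + y * Complex.I),
        fun t x => deriv (q t) (x + y * Complex.I)] : Fin 5 → ℝ → ℝ → ℂ) j) := by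
    intro j
    fin_cases j
    · exact huv.isC1_u hd.hu hΦ.hol hy
    · exact huv.isC1_v hd.hv hΦ.hol hy
    · exact hkg.isC1_φ hd.hφ hy
    · exact hkg.isC1_p hd.hp hF hy
    · exact hkg.isC1_q hd.hq hF hy
  have key := system_line_energy hC (c := ![1, -1, 0, -1, 1])
    (fun j => by fin_cases j <;> simp) (k := k) (T := T) (Q := 2 * D)
    (fun s hs x => by
      have hz := line_mem_strip hy x
      set z : ℂ := x + y * Complex.I with hz'
      have hn := (hb s hs _ (conj_mem_strip hz))
      have hκ := norm_diracPot_le (M := M) (hΦ.bound s z hz)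
      have hAM : 0 ≤ A + |M| := by positivity
      have hN0 : 0 ≤ N := (norm_nonneg _).trans hn.1
      have s1 : ‖diracPot M Φ s z * v s z‖ ^ 2 ≤ (A + |M|) ^ 2 * ‖v s z‖ ^ 2 := by
        rw [norm_mul, mul_pow]; gcongr
      have s2 : ‖diracPot M Φ s z * u s z‖ ^ 2 ≤ (A + |M|) ^ 2 * ‖u s z‖ ^ 2 := by
        rw [norm_mul, mul_pow]; gcongr
      have s3 : ‖(1 / 2 : ℂ) * (p s z + q s z)‖ ^ 2 ≤ (‖p s z‖ ^ 2 + ‖q s z‖ ^ 2) / 2 := by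
        have h2 : ‖(1 / 2 : ℂ)‖ = 1 / 2 := by norm_num
        rw [norm_mul, h2, mul_pow]
        have := norm_add_le (p s z) (q s z)
        have h3 : ‖p s z + q s z‖ ^ 2 ≤ (‖p s z‖ + ‖q s z‖) ^ 2 := by gcongr
        nlinarith [sq_nonneg (‖p s z‖ - ‖q s z‖)]
      have s4 : ‖clampedSource T u v s z - (m ^ 2 : ℂ) * φ s z‖ ^ 2
          ≤ 4 * N ^ 2 * (‖u s z‖ ^ 2 + ‖v s z‖ ^ 2) + 2 * m ^ 4 * ‖φ s z‖ ^ 2 := by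
        rw [clampedSource, timeClamp_of_abs_le hs]
        have h1 : ‖dkgSource u v s z‖ ≤ N * (‖u s z‖ + ‖v s z‖) := by
          refine (norm_dkgSource_le u v s z).trans ?_
          have h1 := mul_le_mul_of_nonneg_right hn.1 (norm_nonneg (v s z))
          have h2 := mul_le_mul_of_nonneg_right hn.2 (norm_nonneg (u s z))
          linarith
        have hm : ‖(m ^ 2 : ℂ) * φ s z‖ = m ^ 2 * ‖φ s z‖ := by simp
        have h2 : ‖dkgSource u v s z - (m ^ 2 : ℂ) * φ s z‖ ^ 2
            ≤ (N * (‖u s z‖ + ‖v s z‖) + m ^ 2 * ‖φ s z‖) ^ 2 := by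
          have := norm_sub_le (dkgSource u v s z) ((m ^ 2 : ℂ) * φ s z)
          rw [hm] at this
          gcongr
          linarith
        refine h2.trans ?_
        nlinarith [sq_nonneg (N * (‖u s z‖ + ‖v s z‖) - m ^ 2 * ‖φ s z‖),
          sq_nonneg (N * (‖u s z‖ - ‖v s z‖))]
      simp only [Fin.sum_univ_five, Matrix.cons_val]
      rw [show diracPot M Φ s z * v s z - deriv (u s) z + ((1 : ℝ) : ℂ) * deriv (u s) z
          = diracPot M Φ s z * v s z by push_cast; ring,
        show diracPot M Φ s z * u s z + deriv (v s) z + ((-1 : ℝ) : ℂ) * deriv (v s) z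
          = diracPot M Φ s z * u s z by push_cast; ring,
        show (1 / 2 : ℂ) * (p s z + q s z) + ((0 : ℝ) : ℂ) * deriv (φ s) z
          = (1 / 2 : ℂ) * (p s z + q s z) by push_cast; ring,
        show clampedSource T u v s z - (m ^ 2 : ℂ) * φ s z + deriv (p s) z
            + ((-1 : ℝ) : ℂ) * deriv (p s) z
          = clampedSource T u v s z - (m ^ 2 : ℂ) * φ s z by push_cast; ring,
        show clampedSource T u v s z - (m ^ 2 : ℂ) * φ s z - deriv (q s) z
            + ((1 : ℝ) : ℂ) * deriv (q s) z
          = clampedSource T u v s z - (m ^ 2 : ℂ) * φ s z by push_cast; ring]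
      have e1 : 0 ≤ (8 * N ^ 2 + 4 * m ^ 4 + 1) * (‖u s z‖ ^ 2 + ‖v s z‖ ^ 2) := by positivity
      have e2 : 0 ≤ ((A + |M|) ^ 2 + 16 * N ^ 2 + 1) * ‖φ s z‖ ^ 2 := by positivity
      have e3 : 0 ≤ ((A + |M|) ^ 2 + 16 * N ^ 2 + 4 * m ^ 4 + 1 / 2)
        * (‖p s z‖ ^ 2 + ‖q s z‖ ^ 2) := by positivity
      rw [hk]
      linarith)
    (fun a b hab => by
      have h1 := hd.charge y hy a b hab
      have h2 := hd.energy y hy a b hab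
      have cl : ∀ {w : ℂ → ℂ}, DifferentiableOn ℂ w (strip σ) →
          Continuous fun x : ℝ => ‖w (x + y * Complex.I)‖ ^ 2 := fun hw =>
        (hw.continuousOn.comp_continuous (by fun_prop) fun x => line_mem_strip hy x).norm.pow 2
      have e : ∫ x in a..b, ((‖u₀ (x + y * Complex.I)‖ ^ 2 + ‖v₀ (x + y * Complex.I)‖ ^ 2)
          + (‖φ₀ (x + y * Complex.I)‖ ^ 2 + ‖p₀ (x + y * Complex.I)‖ ^ 2
            + ‖q₀ (x + y * Complex.I)‖ ^ 2)) ≤ 2 * D := by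
        exact (intervalIntegral.integral_add
          (((cl hd.hu).add (cl hd.hv)).intervalIntegrable _ _)
          ((((cl hd.hφ).add (cl hd.hp)).add (cl hd.hq)).intervalIntegrable _ _)).le.trans
          ((add_le_add h1 h2).trans (by linarith))
      refine le_trans (le_of_eq (intervalIntegral.integral_congr fun x _ => ?_)) e
      have hz := line_mem_strip hy x
      simp only [Fin.sum_univ_five, Matrix.cons_val]
      rw [huv.zero_u hz, huv.zero_v hz, hkg.eφ 0 _ hz, hkg.ep 0 _ hz, hkg.eq 0 _ hz, mild_zero,
        mild_zero, mild_zero]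
      ring) ht hab
  simp only [Fin.sum_univ_five, Matrix.cons_val] at key
  refine key.trans (mul_le_mul_of_nonneg_right (Real.exp_le_exp.2 ?_) (by positivity))
  exact mul_le_mul_of_nonneg_left ht (by positivity)

/-- Solutions exist up to time `T` in a strip of width comparable to `T⁻⁴`: with `|φ| ≲ T²` and
`|u|, |v| ≲ T^{5/2}` one has `|∂_z φ| ≲ T³`, so that `|Im φ| ≲ σ T³`, and the bounds persist while
`|Im φ| ≲ T⁻¹`. -/
theorem exists_dkgStripSol (M m : ℝ) {D : ℝ} (hD : 0 ≤ D) : ∃ c : ℝ, 0 < c ∧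
    ∀ T σ : ℝ, 1 ≤ T → 0 < σ → σ ≤ c / T ^ 4 → ∀ u₀ v₀ φ₀ p₀ q₀ : ℂ → ℂ,
      DKGData σ D u₀ v₀ φ₀ p₀ q₀ → ∃ u v φ p q, DKGStripSol σ T M m u v φ p q ∧
        ∀ z ∈ strip σ, u 0 z = u₀ z ∧ v 0 z = v₀ z ∧ φ 0 z = φ₀ z ∧ p 0 z = p₀ z ∧ q 0 z
          = q₀ z := by
  -- the bounds are `|φ| ≤ C₁ T²`, `|u|, |v| ≤ C₂ T^{5/2}` and `|∂_z φ| ≤ C₃ T³`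
  set C₁ : ℝ := D * (3 + m ^ 2 / 2) with hC₁
  set C₂ : ℝ := D + (C₁ + |M|) / 2 * (2 * D + 1) with hC₂
  set C₃ : ℝ := D + C₂ * (2 * D + 1) + m ^ 2 * C₁ with hC₃
  have h1 : 0 ≤ C₁ := by positivity
  have h2 : 0 ≤ C₂ := by positivity
  have h3 : 0 ≤ C₃ := by positivity
  have hlog : 0 < Real.log 2 := Real.log_pos (by norm_num)
  refine ⟨Real.log 2 / (2 * (C₃ + 1)), by positivity, fun T σ hT hσ hσc u₀ v₀ φ₀ p₀ q₀ hd => ?_⟩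
  have hT0 : 0 < T := by linarith
  set L : ℝ := √T with hL
  have hL1 : 1 ≤ L := by rw [hL]; exact Real.one_le_sqrt.2 hT
  have hLT : L * L = T := Real.mul_self_sqrt hT0.le
  have hT2 : 1 ≤ T ^ 2 := one_le_pow₀ hT
  have hTT2 : T ≤ T ^ 2 := by nlinarith
  have hT3 : 1 ≤ T ^ 3 := one_le_pow₀ hT
  -- the largest imaginary part for which the charge at most doubles up to time `T`
  set η : ℝ := Real.log 2 / (2 * T) with hη
  have hη0 : 0 ≤ η := by positivity
  have hηT : Real.exp (2 * η * T) ≤ 2 := by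
    have : 2 * η * T = Real.log 2 := by rw [hη]; field_simp
    rw [this, Real.exp_log (by norm_num)]
  have hA : D * (1 + T + m ^ 2 * T ^ 2 / 2) + D * T ≤ C₁ * T ^ 2 := by
    rw [hC₁]
    nlinarith [mul_le_mul_of_nonneg_left hTT2 hD, mul_le_mul_of_nonneg_left hT2 hD]
  have hN : D + (C₁ * T ^ 2 + |M|) / 2 * ((2 * D + 1) * L) ≤ C₂ * T ^ 2 * L := by
    have e1 : D ≤ D * (T ^ 2 * L) :=
      le_mul_of_one_le_right hD (one_le_mul_of_one_le_of_one_le hT2 hL1)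
    have e2 : (C₁ * T ^ 2 + |M|) / 2 * ((2 * D + 1) * L)
        ≤ (C₁ * T ^ 2 + |M| * T ^ 2) / 2 * ((2 * D + 1) * L) := by
      gcongr
      exact le_mul_of_one_le_right (abs_nonneg M) hT2
    rw [hC₂]
    linarith
  have hB : σ * (D + C₂ * T ^ 2 * L * ((2 * D + 1) * L) + m ^ 2 * T * (C₁ * T ^ 2)) ≤ η := by
    have e1 : D + C₂ * T ^ 2 * L * ((2 * D + 1) * L) + m ^ 2 * T * (C₁ * T ^ 2) ≤ C₃ * T ^ 3 := by
      have e2 : C₂ * T ^ 2 * L * ((2 * D + 1) * L) = C₂ * (2 * D + 1) * T ^ 3 := by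
        have : C₂ * T ^ 2 * L * ((2 * D + 1) * L) = C₂ * (2 * D + 1) * T ^ 2 * (L * L) := by ring
        rw [this, hLT]; ring
      rw [e2, hC₃]
      have := le_mul_of_one_le_right hD hT3
      linarith
    have e3 : σ * (C₃ * T ^ 3) ≤ η := by
      have e4 : σ * (C₃ * T ^ 3) ≤ Real.log 2 / (2 * (C₃ + 1)) / T ^ 4 * (C₃ * T ^ 3) := by gcongr
      refine e4.trans ?_
      have e5 : Real.log 2 / (2 * (C₃ + 1)) / T ^ 4 * (C₃ * T ^ 3)
          = Real.log 2 / (2 * T) * (C₃ / (C₃ + 1)) := by field_simp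
      rw [e5, hη]
      exact mul_le_of_le_one_right hη0 ((div_le_one (by positivity)).2 (by linarith))
    exact (mul_le_mul_of_nonneg_left e1 hσ.le).trans e3
  obtain ⟨Φ, u, v, φ, p, q, hΦ, huv, hkg, hb, hφ, C, hC⟩ :=
    exists_strip_solution (M := M) (m := m) hd hD hT0 hη0 hηT hA hN hB
  have hF := huv.hu.clampedSource huv.hv T
  have hsrc : ∀ t, |t| ≤ T → ∀ z, clampedSource T u v t z = dkgSource u v t z := fun t ht z => by
    rw [clampedSource, timeClamp_of_abs_le ht]
  refine ⟨u, v, φ, p, q, ⟨huv.hu, huv.hv, hkg.hφ, hkg.hp, hkg.hq, fun t ht z hz => ?_,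
    fun t ht z hz => ?_, fun t _ z hz => hkg.dt_φ hd.hφ t hz, fun t ht z hz => ?_,
    fun t ht z hz => ?_, fun t _ z hz => hkg.deriv_φ hd.hφ hd.hp hd.hq hF hd.compat t hz,
    ?_, fun t ht z hz => ?_, ?_, ?_⟩, fun z hz => ⟨huv.zero_u hz, huv.zero_v hz, ?_, ?_, ?_⟩⟩
  · rw [← (hφ t ht z hz).2]
    exact huv.dt_u hd.hu hΦ.hol t hz
  · rw [← (hφ t ht z hz).2]
    exact huv.dt_v hd.hv hΦ.hol t hz
  · rw [← hsrc t ht]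
    exact hkg.dt_p hd.hp hF t hz
  · rw [← hsrc t ht]
    exact hkg.dt_q hd.hq hF t hz
  · refine ⟨![fun t z => diracPot M Φ t z * v t z - deriv (u t) z,
      fun t z => diracPot M Φ t z * u t z + deriv (v t) z,
      fun t z => (1 / 2 : ℂ) * (p t z + q t z),
      fun t z => clampedSource T u v t z - (m ^ 2 : ℂ) * φ t z + deriv (p t) z,
      fun t z => clampedSource T u v t z - (m ^ 2 : ℂ) * φ t z - deriv (q t) z], fun j => ?_⟩
    fin_cases j
    · exact ⟨((hΦ.hol.diracPot M).mul huv.hv).sub huv.hu.deriv, fun t z hz =>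
        huv.dt_u hd.hu hΦ.hol t hz⟩
    · exact ⟨((hΦ.hol.diracPot M).mul huv.hu).add huv.hv.deriv, fun t z hz =>
        huv.dt_v hd.hv hΦ.hol t hz⟩
    · exact ⟨(hkg.hp.add hkg.hq).const_mul _, fun t z hz => hkg.dt_φ hd.hφ t hz⟩
    · exact ⟨(hF.sub (hkg.hφ.const_mul _)).add hkg.hp.deriv, fun t z hz => hkg.dt_p hd.hp hF t hz⟩
    · exact ⟨(hF.sub (hkg.hφ.const_mul _)).sub hkg.hq.deriv, fun t z hz => hkg.dt_q hd.hq hF t hz⟩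
  · rw [conjRefl, ← (hφ t ht z hz).2, ← (hφ t ht _ (conj_mem_strip hz)).2]
    exact hΦ.symm t z hz
  · refine ⟨max (C₂ * T ^ 2 * L) (max (C₁ * T ^ 2) C), fun t ht z hz => ?_⟩
    exact ⟨le_max_of_le_left (hb t ht z hz).1, le_max_of_le_left (hb t ht z hz).2,
      le_max_of_le_right (le_max_of_le_left (hφ t ht z hz).1),
      le_max_of_le_right (le_max_of_le_right (hC t ht z hz).1),
      le_max_of_le_right (le_max_of_le_right (hC t ht z hz).2)⟩
  · exact ⟨_, fun t ht y hy a b hab => strip_energy hd hΦ (by positivity) hD huv hkg hb ht hy hab⟩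
  · rw [hkg.eφ 0 z hz, mild_zero]
  · rw [hkg.ep 0 z hz, mild_zero]
  · rw [hkg.eq 0 z hz, mild_zero]

end Core

/-! ### Smoothness -/

/-- `f` has `k` time derivatives for `|t| < T`, all holomorphic in the strip. -/
def StripReg (σ T : ℝ) : ℕ → (ℝ → ℂ → ℂ) → Prop
  | 0, f => StripHol σ f
  | k + 1, f => StripHol σ f ∧ ∃ g, StripReg σ T k g ∧
      ∀ t, |t| < T → ∀ z ∈ strip σ, HasDerivAt (fun t => f t z) (g t z) t

namespace StripReg
variable {σ T : ℝ} {f g : ℝ → ℂ → ℂ} {k : ℕ}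

theorem stripHol (h : StripReg σ T k f) : StripHol σ f := by
  cases k with
  | zero => exact h
  | succ k => exact h.1

theorem of_succ (h : StripReg σ T (k + 1) f) : StripReg σ T k f := by
  induction k generalizing f with
  | zero => exact h.1
  | succ k ih =>
    obtain ⟨h1, g, hg, hd⟩ := h
    exact ⟨h1, g, ih hg, hd⟩

theorem const (c : ℂ) : ∀ k, StripReg σ T k fun _ _ => c
  | 0 => StripHol.const c
  | k + 1 => ⟨StripHol.const c, fun _ _ => 0, const 0 k, fun _ _ _ _ => hasDerivAt_const _ _⟩

theorem add (hf : StripReg σ T k f) (hg : StripReg σ T k g) :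
    StripReg σ T k fun t z => f t z + g t z := by
  induction k generalizing f g with
  | zero => exact StripHol.add hf hg
  | succ k ih =>
    obtain ⟨h1, f', hf', df⟩ := hf
    obtain ⟨h2, g', hg', dg⟩ := hg
    exact ⟨h1.add h2, _, ih hf' hg', fun t ht z hz => (df t ht z hz).add (dg t ht z hz)⟩

theorem mul (hf : StripReg σ T k f) (hg : StripReg σ T k g) :
    StripReg σ T k fun t z => f t z * g t z := by
  induction k generalizing f g with
  | zero => exact StripHol.mul hf hg
  | succ k ih =>
    have hf0 := hf.of_succ
    have hg0 := hg.of_succ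
    obtain ⟨h1, f', hf', df⟩ := hf
    obtain ⟨h2, g', hg', dg⟩ := hg
    exact ⟨h1.mul h2, _, (ih hf' hg0).add (ih hf0 hg'),
      fun t ht z hz => (df t ht z hz).mul (dg t ht z hz)⟩

theorem const_mul (c : ℂ) (hf : StripReg σ T k f) : StripReg σ T k fun t z => c * f t z :=
  (const c k).mul hf

theorem sub (hf : StripReg σ T k f) (hg : StripReg σ T k g) :
    StripReg σ T k fun t z => f t z - g t z := by
  simpa only [neg_one_mul, ← sub_eq_add_neg] using hf.add (hg.const_mul (-1))

theorem conjRefl (hf : StripReg σ T k f) : StripReg σ T k (conjRefl f) := by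
  induction k generalizing f with
  | zero => exact StripHol.conjRefl hf
  | succ k ih =>
    obtain ⟨h1, f', hf', df⟩ := hf
    refine ⟨h1.conjRefl, _, ih hf', fun t ht z hz => ?_⟩
    exact (df t ht _ (conj_mem_strip hz)).star_conj

protected theorem deriv (hf : StripReg σ T k f) : StripReg σ T k fun t z => deriv (f t) z := by
  induction k generalizing f with
  | zero => exact StripHol.deriv hf
  | succ k ih =>
    obtain ⟨h1, f', hf', df⟩ := hf
    refine ⟨h1.deriv, _, ih hf', fun t ht z hz => ?_⟩
    -- interchange of derivatives, through the integrated form of the equation `∂ₜ f = f'`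
    have e : ∀ s, |s| < T → ∀ z ∈ strip σ, f s z = mild 0 (f 0) f' s z := fun s hs z hz => by
      have hsub : ∀ r ∈ uIcc 0 s, |r| < T := fun r hr => by
        have := abs_sub_left_of_mem_uIcc hr
        rw [sub_zero, sub_zero] at this
        exact this.trans_lt hs
      have := intervalIntegral.integral_eq_sub_of_hasDerivAt (f := fun s => f s z)
        (f' := fun s => f' s z)
        (fun r hr => df r (hsub r hr) z hz)
        (Continuous.intervalIntegrable (hf'.stripHol.comp_cont continuous_id continuous_const
          fun _ => hz) _ _)
      simp [mild, duhamel, this]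
    have e2 : ∀ s, |s| < T → deriv (f s) z = mild 0 (deriv (f 0)) (fun s z => deriv (f' s) z) s z :=
      fun s hs => by
        rw [← (hasDerivAt_mild_space (h1.hol 0) hf'.stripHol s hz).deriv]
        exact Filter.EventuallyEq.deriv_eq
          (eventually_of_mem ((isOpen_strip σ).mem_nhds hz) fun z hz => e s hs z hz)
    have h3 := hasDerivAt_mild (c := 0) ((h1.hol 0).deriv (isOpen_strip σ)) hf'.stripHol.deriv t hz
    rw [Complex.ofReal_zero, zero_mul, sub_zero] at h3
    refine h3.congr_of_eventuallyEq ?_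
    filter_upwards [(isOpen_lt continuous_abs continuous_const).mem_nhds ht] with s hs
    exact e2 s hs

theorem contDiffOn (hσ : 0 < σ) (hf : StripReg σ T k f) :
    ContDiffOn ℝ k (fun p : ℝ × ℝ => f p.1 p.2) (Ioo (-T) T ×ˢ univ) := by
  have hr : ∀ x : ℝ, (x : ℂ) ∈ strip σ := fun x => by simpa [strip] using hσ
  have hopen : IsOpen (Ioo (-T) T ×ˢ (univ : Set ℝ)) := isOpen_Ioo.prod isOpen_univ
  induction k generalizing f with
  | zero =>
    rw [Nat.cast_zero, contDiffOn_zero]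
    exact (hf.stripHol.comp_cont (X := ℝ × ℝ) continuous_fst
      (Complex.continuous_ofReal.comp continuous_snd) fun p => hr p.2).continuousOn
  | succ k ih =>
    have hdx : StripReg σ T k fun t z => deriv (f t) z := hf.deriv.of_succ
    obtain ⟨h1, g, hg, df⟩ := hf
    have hfd : ∀ p ∈ Ioo (-T) T ×ˢ (univ : Set ℝ), HasFDerivAt (fun p : ℝ × ℝ => f p.1 p.2)
        ((ContinuousLinearMap.fst ℝ ℝ ℝ).smulRight (g p.1 p.2)
          + (ContinuousLinearMap.snd ℝ ℝ ℝ).smulRight (deriv (f p.1) p.2)) p := by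
      intro p hp
      have cg : ∀ {w : ℝ → ℂ → ℂ}, StripHol σ w →
          Continuous fun p : ℝ × ℝ => ContinuousLinearMap.toSpanSingleton ℝ (w p.1 p.2) := fun hw =>
        (ContinuousLinearMap.toSpanSingletonCLE (𝕜 := ℝ) (E := ℂ)).continuous.comp
          (hw.comp_cont (X := ℝ × ℝ) continuous_fst
            (Complex.continuous_ofReal.comp continuous_snd) fun p => hr p.2)
      have := (hasStrictFDerivAt_uncurry_coprod (𝕜 := ℝ) (u := p)
        (f := fun (t x : ℝ) => f t x)
        (f₁ := fun t x => ContinuousLinearMap.toSpanSingleton ℝ (g t (x : ℂ)))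
        (f₂ := fun t x => ContinuousLinearMap.toSpanSingleton ℝ (deriv (f t) (x : ℂ)))
        (by
          filter_upwards [hopen.mem_nhds hp] with v hv
          exact (df v.1 (abs_lt.2 hv.1) _ (hr v.2)).hasFDerivAt)
        (Eventually.of_forall fun v =>
          ((h1.differentiableAt v.1 (hr v.2)).hasDerivAt.comp_ofReal).hasFDerivAt)
        (cg hg.stripHol).continuousAt (cg h1.deriv).continuousAt).hasFDerivAt
      refine this.congr_fderiv ?_
      ext <;> simp [Function.HasUncurry.uncurry]
    rw [Nat.cast_succ, contDiffOn_succ_iff_fderiv_of_isOpen hopen]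
    refine ⟨fun p hp => (hfd p hp).differentiableAt.differentiableWithinAt, by simp, ?_⟩
    refine ContDiffOn.congr ?_ fun p hp => (hfd p hp).fderiv
    exact (contDiffOn_const.smulRight (ih hg)).add (contDiffOn_const.smulRight (ih hdx))

end StripReg

/-- The equations express a time derivative of the fields through the fields and their space
derivatives, which are again holomorphic; so time derivatives of all orders exist. -/
theorem DKGStripSol.reg {σ T M m : ℝ} {u v φ p q : ℝ → ℂ → ℂ} (h : DKGStripSol σ T M m u v φ p q) :
    ∀ k, StripReg σ T k u ∧ StripReg σ T k v ∧ StripReg σ T k φ ∧ StripReg σ T k p ∧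
      StripReg σ T k q
  | 0 => ⟨h.hu, h.hv, h.hφ, h.hp, h.hq⟩
  | k + 1 => by
    obtain ⟨ru, rv, rφ, rp, rq⟩ := h.reg k
    have rS : StripReg σ T k fun t z => dkgSource u v t z - (m ^ 2 : ℂ) * φ t z :=
      ((ru.conjRefl.mul rv).add (rv.conjRefl.mul ru)).sub (rφ.const_mul _)
    have rκ : StripReg σ T k fun t z => Complex.I * (φ t z - M) :=
      (rφ.sub (StripReg.const _ k)).const_mul _
    exact ⟨⟨h.hu, _, (rκ.mul rv).sub ru.deriv, fun t ht => h.dt_u t ht.le⟩,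
      ⟨h.hv, _, (rκ.mul ru).add rv.deriv, fun t ht => h.dt_v t ht.le⟩,
      ⟨h.hφ, _, (rp.add rq).const_mul _, fun t ht => h.dt_φ t ht.le⟩,
      ⟨h.hp, _, rS.add rp.deriv, fun t ht => h.dt_p t ht.le⟩,
      ⟨h.hq, _, rS.sub rq.deriv, fun t ht => h.dt_q t ht.le⟩⟩

/-! ### Uniqueness for the diagonal system on the line -/

/-- The characteristic speeds of the fields `(u, v, φ, p, q)`. -/
def dkgSpeed : Fin 5 → ℝ := ![1, -1, 0, -1, 1]

/-- The zeroth-order terms of the Dirac–Klein–Gordon system for the fields `(u, v, φ, p, q)`. -/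
noncomputable def dkgTerms (M m : ℝ) (a : Fin 5 → ℂ) : Fin 5 → ℂ :=
  ![Complex.I * (a 2 - M) * a 1, Complex.I * (a 2 - M) * a 0, (1 / 2 : ℂ) * (a 3 + a 4),
    (starRingEnd ℂ) (a 0) * a 1 + (starRingEnd ℂ) (a 1) * a 0 - (m ^ 2 : ℂ) * a 2,
    (starRingEnd ℂ) (a 0) * a 1 + (starRingEnd ℂ) (a 1) * a 0 - (m ^ 2 : ℂ) * a 2]

theorem contDiff_dkgTerms (M m : ℝ) : ContDiff ℝ 1 (dkgTerms M m) := by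
  have hc : ∀ i : Fin 5, ContDiff ℝ 1 fun a : Fin 5 → ℂ => a i := fun i => contDiff_apply _ _ i
  have hs : ∀ i : Fin 5, ContDiff ℝ 1 fun a : Fin 5 → ℂ => (starRingEnd ℂ) (a i) := fun i =>
    Complex.conjCLE.contDiff.comp (hc i)
  rw [contDiff_pi]
  intro j
  fin_cases j
  · exact (contDiff_const.mul ((hc 2).sub contDiff_const)).mul (hc 1)
  · exact (contDiff_const.mul ((hc 2).sub contDiff_const)).mul (hc 0)
  · exact contDiff_const.mul ((hc 3).add (hc 4))
  · exact (((hs 0).mul (hc 1)).add ((hs 1).mul (hc 0))).sub (contDiff_const.mul (hc 2))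
  · exact (((hs 0).mul (hc 1)).add ((hs 1).mul (hc 0))).sub (contDiff_const.mul (hc 2))

/-- The fields `w = (u, v, φ, p, q)` on the line solve the Dirac–Klein–Gordon system for
`|t| ≤ T`. -/
def IsLineSol (T M m : ℝ) (w : Fin 5 → ℝ → ℝ → ℂ) : Prop :=
  ∃ wt wx : Fin 5 → ℝ → ℝ → ℂ, (∀ j, IsC1 (w j) (wt j) (wx j)) ∧
    ∀ t, |t| ≤ T → ∀ x j, wt j t x + (dkgSpeed j : ℂ) * wx j t x = dkgTerms M m (fun i => w i t x) j

theorem abs_dkgSpeed_le (j : Fin 5) : |dkgSpeed j| ≤ 1 := by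
  fin_cases j <;> simp [dkgSpeed]

/-- A Lipschitz diagonal system has finite speed of propagation; here in its most basic form, for
the difference of two solutions that agree initially. -/
theorem eq_zero_of_system {ι : Type*} [Fintype ι] {w wt wx : ι → ℝ → ℝ → ℂ}
    (h : ∀ j, IsC1 (w j) (wt j) (wx j)) {c : ι → ℝ} (hc : ∀ j, |c j| ≤ 1) {k t x : ℝ} (ht : 0 ≤ t)
    (hN : ∀ s ∈ Icc 0 t, ∀ y, |y - x| ≤ t + 1 - s →
      ∑ j, ‖wt j s y + (c j : ℂ) * wx j s y‖ ^ 2 ≤ k * ∑ j, ‖w j s y‖ ^ 2)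
    (h₀ : ∀ j y, w j 0 y = 0) (j : ι) : w j t x = 0 := by
  have e := system_cone_energy h hc (k := k) (t := t + 1) (t₁ := t) (x := x) ht (by linarith) hN
  simp only [h₀, norm_zero, ne_eq, OfNat.ofNat_ne_zero, not_false_eq_true, zero_pow,
    Finset.sum_const_zero, intervalIntegral.integral_zero, mul_zero, add_sub_cancel_left] at e
  have hcont : Continuous fun y => ∑ j, ‖w j t y‖ ^ 2 := continuous_finsetSum _ fun j _ =>
    ((h j).cont.comp (by fun_prop : Continuous fun y => (t, y))).norm.pow 2
  have hx : ∑ j, ‖w j t x‖ ^ 2 = 0 := by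
    by_contra hne
    have hpos : 0 < ∫ y in (x - 1)..(x + 1), ∑ j, ‖w j t y‖ ^ 2 := by
      refine intervalIntegral.integral_pos (by linarith) hcont.continuousOn
        (fun y _ => by positivity) ⟨x, ⟨by linarith, by linarith⟩, ?_⟩
      exact lt_of_le_of_ne (by positivity) (Ne.symm hne)
    linarith
  have := (Finset.sum_eq_zero_iff_of_nonneg fun _ _ => by positivity).1 hx j (Finset.mem_univ j)
  simpa using this

/-- Uniqueness for the Dirac–Klein–Gordon system. -/
theorem IsLineSol.unique {T M m : ℝ} {w w' : Fin 5 → ℝ → ℝ → ℂ} (h : IsLineSol T M m w)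
    (h' : IsLineSol T M m w') (h₀ : ∀ j x, w j 0 x = w' j 0 x) {t : ℝ} (ht : |t| ≤ T) (x : ℝ)
    (j : Fin 5) : w j t x = w' j t x := by
  obtain ⟨wt, wx, hC, he⟩ := h
  obtain ⟨wt', wx', hC', he'⟩ := h'
  -- both solutions are bounded on the compact set where the cone lives
  have hcw : ∀ {w wt wx : Fin 5 → ℝ → ℝ → ℂ}, (∀ j, IsC1 (w j) (wt j) (wx j)) →
      Continuous fun p : ℝ × ℝ => fun i => w i p.1 p.2 := fun h => continuous_pi fun i => (h i).cont
  have hK : IsCompact (Icc (-|t|) |t| ×ˢ Icc (-(|x| + |t| + 1)) (|x| + |t| + 1)) :=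
    isCompact_Icc.prod isCompact_Icc
  obtain ⟨R, hR⟩ := hK.exists_bound_of_continuousOn (hcw hC).continuousOn
  obtain ⟨R', hR'⟩ := hK.exists_bound_of_continuousOn (hcw hC').continuousOn
  obtain ⟨L, hL⟩ := (contDiff_dkgTerms M m).contDiffOn.exists_lipschitzOnWith
    (s := Metric.closedBall 0 (max R R')) one_ne_zero (convex_closedBall _ _)
      (isCompact_closedBall _ _)
  have hest : ∀ s, |s| ≤ |t| → ∀ y, |y| ≤ |x| + |t| + 1 →
      ∑ j, ‖(wt j s y - wt' j s y) + (dkgSpeed j : ℂ) * (wx j s y - wx' j s y)‖ ^ 2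
        ≤ (5 * L ^ 2) * ∑ j, ‖w j s y - w' j s y‖ ^ 2 := by
    intro s hs y hy
    have hmem : (s, y) ∈ Icc (-|t|) |t| ×ˢ Icc (-(|x| + |t| + 1)) (|x| + |t| + 1) :=
      ⟨abs_le.1 hs, abs_le.1 hy⟩
    have hl := hL.dist_le_mul (fun i => w i s y)
      (mem_closedBall_zero_iff.2 ((hR _ hmem).trans (le_max_left _ _))) (fun i => w' i s y)
      (mem_closedBall_zero_iff.2 ((hR' _ hmem).trans (le_max_right _ _)))
    rw [dist_eq_norm, dist_eq_norm] at hl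
    have hsup : ‖(fun i => w i s y) - fun i => w' i s y‖ ^ 2 ≤ ∑ j, ‖w j s y - w' j s y‖ ^ 2 := by
      have hS : 0 ≤ ∑ j, ‖w j s y - w' j s y‖ ^ 2 := by positivity
      rw [← Real.sq_sqrt hS]
      gcongr
      refine (pi_norm_le_iff_of_nonneg (Real.sqrt_nonneg _)).2 fun i => Real.le_sqrt_of_sq_le ?_
      exact Finset.single_le_sum (f := fun j => ‖w j s y - w' j s y‖ ^ 2)
        (fun _ _ => by positivity) (Finset.mem_univ i)
    have hj : ∀ j ∈ Finset.univ,
        ‖(wt j s y - wt' j s y) + (dkgSpeed j : ℂ) * (wx j s y - wx' j s y)‖ ^ 2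
          ≤ L ^ 2 * ∑ j, ‖w j s y - w' j s y‖ ^ 2 := by
      intro j _
      have e : (wt j s y - wt' j s y) + (dkgSpeed j : ℂ) * (wx j s y - wx' j s y)
          = (dkgTerms M m (fun i => w i s y) - dkgTerms M m fun i => w' i s y) j := by
        rw [Pi.sub_apply, ← he s (hs.trans ht), ← he' s (hs.trans ht)]; ring
      rw [e]
      calc _ ≤ (L * ‖(fun i => w i s y) - fun i => w' i s y‖) ^ 2 := by
            have := (norm_le_pi_norm _ j).trans hl
            gcongr
        _ ≤ _ := by rw [mul_pow]; gcongr
    refine (Finset.sum_le_card_nsmul _ _ _ hj).trans (le_of_eq ?_)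
    simp; ring
  have hD := fun j => (hC j).sub (hC' j)
  rcases le_total 0 t with h0 | h0
  · have := eq_zero_of_system hD abs_dkgSpeed_le (k := 5 * L ^ 2) (t := t) (x := x) h0
      (fun s hs y hy => hest s (by rw [abs_of_nonneg hs.1, abs_of_nonneg h0]; exact hs.2) y (by
        have h1 := abs_sub_abs_le_abs_sub y x
        rw [abs_of_nonneg h0]
        linarith [hs.1]))
      (fun j y => sub_eq_zero.2 (h₀ j y)) j
    exact sub_eq_zero.1 this
  · have := eq_zero_of_system (fun j => (hD j).reflect) abs_dkgSpeed_le (k := 5 * L ^ 2) (t := -t)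
      (x := -x) (by linarith)
      (fun s hs y hy => by
        have h2 := hest (-s) (by rw [abs_neg, abs_of_nonneg hs.1, abs_of_nonpos h0]; exact hs.2)
          (-y) (by
          have h1 := abs_sub_abs_le_abs_sub y (-x)
          rw [abs_neg] at h1 ⊢
          rw [abs_of_nonpos h0]
          linarith [hs.1])
        refine le_trans (le_of_eq (Finset.sum_congr rfl fun j _ => ?_)) h2
        rw [← norm_neg]; congr 2; ring)
      (fun j y => by simp [h₀]) j
    simp only [neg_neg] at this
    exact sub_eq_zero.1 this

/-- Restriction to the real line of a solution in the strip. -/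
theorem DKGStripSol.isLineSol {σ T M m : ℝ} {u v φ p q : ℝ → ℂ → ℂ} (hσ : 0 < σ)
    (h : DKGStripSol σ T M m u v φ p q) :
    IsLineSol T M m fun j t x => (![u, v, φ, p, q] : Fin 5 → ℝ → ℂ → ℂ) j t x := by
  obtain ⟨g, hg⟩ := h.dt_global
  have hr : ∀ x : ℝ, (x : ℂ) ∈ strip σ := fun x => by simpa [strip] using hσ
  have hH : ∀ j, StripHol σ ((![u, v, φ, p, q] : Fin 5 → ℝ → ℂ → ℂ) j) := fun j => by
    fin_cases j
    · exact h.hu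
    · exact h.hv
    · exact h.hφ
    · exact h.hp
    · exact h.hq
  refine ⟨fun j t x => g j t x,
    fun j t x => deriv ((![u, v, φ, p, q] : Fin 5 → ℝ → ℂ → ℂ) j t) x, fun j => ?_,
      fun t ht x j => ?_⟩
  · have := (hH j).isC1 (hg j).1 (hg j).2 (y := 0) (by simpa using hσ)
    simpa using this
  · have key : ∀ {d : ℂ}, HasDerivAt (fun t => (![u, v, φ, p, q] : Fin 5 → ℝ → ℂ → ℂ) j t x) d t →
        g j t x = d := fun hd => ((hg j).2 t _ (hr x)).unique hd
    have hconj : dkgSource u v t x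
        = (starRingEnd ℂ) (u t x) * v t x + (starRingEnd ℂ) (v t x) * u t x := by
      simp [dkgSource, conjRefl]
    fin_cases j
    · dsimp only
      rw [key (h.dt_u t ht _ (hr x))]; simp [dkgSpeed, dkgTerms]
    · dsimp only
      rw [key (h.dt_v t ht _ (hr x))]; simp [dkgSpeed, dkgTerms]
    · dsimp only
      rw [key (h.dt_φ t ht _ (hr x))]; simp [dkgSpeed, dkgTerms]
    · dsimp only
      rw [key (h.dt_p t ht _ (hr x)), hconj]; simp [dkgSpeed, dkgTerms]
    · dsimp only
      rw [key (h.dt_q t ht _ (hr x)), hconj]; simp [dkgSpeed, dkgTerms]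

/-! ### The system in the original unknowns -/

section Partial
variable {E : Type*} [NormedAddCommGroup E] [NormedSpace ℝ E] {f : ℝ → ℝ → E}

theorem hasDerivAt_fst_of_contDiff (h : ContDiff ℝ ∞ fun p : ℝ × ℝ => f p.1 p.2) (t x : ℝ) :
    HasDerivAt (fun τ => f τ x) (fderiv ℝ (fun p : ℝ × ℝ => f p.1 p.2) (t, x) (1, 0)) t :=
  ((h.differentiable (by simp)) (t, x)).hasFDerivAt.comp_hasDerivAt (f := fun τ => (τ, x)) t
    ((hasDerivAt_id t).prodMk (hasDerivAt_const t x))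

theorem hasDerivAt_snd_of_contDiff (h : ContDiff ℝ ∞ fun p : ℝ × ℝ => f p.1 p.2) (t x : ℝ) :
    HasDerivAt (f t) (fderiv ℝ (fun p : ℝ × ℝ => f p.1 p.2) (t, x) (0, 1)) x :=
  ((h.differentiable (by simp)) (t, x)).hasFDerivAt.comp_hasDerivAt (f := fun y => (t, y)) x
    ((hasDerivAt_const x t).prodMk (hasDerivAt_id x))

theorem contDiff_deriv_fst (h : ContDiff ℝ ∞ fun p : ℝ × ℝ => f p.1 p.2) :
    ContDiff ℝ ∞ fun p : ℝ × ℝ => deriv (fun τ => f τ p.2) p.1 := by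
  have e : (fun p : ℝ × ℝ => deriv (fun τ => f τ p.2) p.1)
      = fun p => fderiv ℝ (fun p : ℝ × ℝ => f p.1 p.2) p (1, 0) :=
    funext fun p => (hasDerivAt_fst_of_contDiff h p.1 p.2).deriv
  rw [e]
  exact (h.fderiv_right (by simp)).clm_apply contDiff_const

theorem contDiff_deriv_snd (h : ContDiff ℝ ∞ fun p : ℝ × ℝ => f p.1 p.2) :
    ContDiff ℝ ∞ fun p : ℝ × ℝ => deriv (f p.1) p.2 := by
  have e : (fun p : ℝ × ℝ => deriv (f p.1) p.2)
      = fun p => fderiv ℝ (fun p : ℝ × ℝ => f p.1 p.2) p (0, 1) :=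
    funext fun p => (hasDerivAt_snd_of_contDiff h p.1 p.2).deriv
  rw [e]
  exact (h.fderiv_right (by simp)).clm_apply contDiff_const

theorem isC1_of_contDiff (h : ContDiff ℝ ∞ fun p : ℝ × ℝ => f p.1 p.2) :
    IsC1 f (fun t x => deriv (fun τ => f τ x) t) (fun t x => deriv (f t) x) where
  cont := h.continuous
  cont_t := (contDiff_deriv_fst h).continuous
  cont_x := (contDiff_deriv_snd h).continuous
  dt t x := (hasDerivAt_fst_of_contDiff h t x).differentiableAt.hasDerivAt
  dx t x := (hasDerivAt_snd_of_contDiff h t x).differentiableAt.hasDerivAt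

theorem deriv_deriv_comm (h : ContDiff ℝ ∞ fun p : ℝ × ℝ => f p.1 p.2) (t x : ℝ) :
    deriv (fun τ => deriv (f τ) x) t = deriv (fun y => deriv (fun τ => f τ y) t) x := by
  set g := fun p : ℝ × ℝ => f p.1 p.2 with hg
  have hd : DifferentiableAt ℝ (fderiv ℝ g) (t, x) :=
    ((h.fderiv_right (m := ∞) (by simp)).differentiable (by simp)) _
  have hsymm : IsSymmSndFDerivAt ℝ g (t, x) :=
    h.contDiffAt.isSymmSndFDerivAt (by
      rw [minSmoothness_of_isRCLikeNormedField]; exact WithTop.coe_le_coe.2 (le_top : (2 : ℕ∞) ≤ ⊤))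
  have e1 : (fun τ => deriv (f τ) x) = fun τ => fderiv ℝ g (τ, x) (0, 1) :=
    funext fun τ => (hasDerivAt_snd_of_contDiff h τ x).deriv
  have e2 : (fun y => deriv (fun τ => f τ y) t) = fun y => fderiv ℝ g (t, y) (1, 0) :=
    funext fun y => (hasDerivAt_fst_of_contDiff h t y).deriv
  have d1 : HasDerivAt (fun τ => fderiv ℝ g (τ, x) (0, 1))
    (fderiv ℝ (fderiv ℝ g) (t, x) (1, 0) (0, 1)) t := by
    have := (hd.hasFDerivAt.comp_hasDerivAt (f := fun τ => (τ, x)) t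
      ((hasDerivAt_id t).prodMk (hasDerivAt_const t x))).clm_apply
        (hasDerivAt_const t ((0 : ℝ), (1 : ℝ)))
    simpa using this
  have d2 : HasDerivAt (fun y => fderiv ℝ g (t, y) (1, 0))
    (fderiv ℝ (fderiv ℝ g) (t, x) (0, 1) (1, 0)) x := by
    have := (hd.hasFDerivAt.comp_hasDerivAt (f := fun y => (t, y)) x
      ((hasDerivAt_const x t).prodMk (hasDerivAt_id x))).clm_apply
        (hasDerivAt_const x ((1 : ℝ), (0 : ℝ)))
    simpa using this
  rw [e1, e2, d1.deriv, d2.deriv]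
  exact hsymm _ _

end Partial

/-- In components the Dirac equation reads `(∂ₜ + ∂ₓ) ψ₀ = i (φ - M) ψ₁`, `(∂ₜ - ∂ₓ) ψ₁ = i (φ - M)
ψ₀`. -/
theorem dirac_iff_diagonal (M f : ℝ) (a b χ : Spinor) :
    (-Complex.I) • Matrix.toEuclideanCLM (𝕜 := ℂ) diracGamma0 a
        - Complex.I • Matrix.toEuclideanCLM (𝕜 := ℂ) diracGamma1 b + (M : ℂ) • χ = (f : ℂ) • χ ↔
      a 0 + b 0 = Complex.I * (f - M) * χ 1 ∧ a 1 - b 1 = Complex.I * (f - M) * χ 0 := by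
  have hI := Complex.I_mul_I
  rw [← (WithLp.ofLp_injective 2).eq_iff, funext_iff, Fin.forall_fin_two]
  simp only [diracGamma0, diracGamma1, Fin.isValue, PiLp.add_apply, PiLp.sub_apply, PiLp.smul_apply,
    Matrix.ofLp_toEuclideanCLM, Matrix.mulVec, dotProduct, Fin.sum_univ_two, Matrix.of_apply,
    Matrix.cons_val', Matrix.cons_val_zero, Matrix.cons_val_one, Matrix.cons_val_fin_one,
      smul_eq_mul]
  constructor
  · rintro ⟨h1, h2⟩
    constructor
    · linear_combination Complex.I * h2 + (a 0 + b 0) * hI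
    · linear_combination Complex.I * h1 + (a 1 - b 1) * hI
  · rintro ⟨h1, h2⟩
    constructor
    · linear_combination (-Complex.I) * h2 - (f - M) * χ 0 * hI
    · linear_combination (-Complex.I) * h1 - (f - M) * χ 1 * hI

theorem inner_diracGamma0 (χ : Spinor) :
    inner ℂ χ (Matrix.toEuclideanCLM (𝕜 := ℂ) diracGamma0 χ)
      = (starRingEnd ℂ) (χ 0) * χ 1 + (starRingEnd ℂ) (χ 1) * χ 0 := by
  simp only [diracGamma0, PiLp.inner_apply, Fin.sum_univ_two, Matrix.ofLp_toEuclideanCLM,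
    Matrix.mulVec,
    dotProduct, Matrix.of_apply, Matrix.cons_val', Matrix.cons_val_zero, Matrix.cons_val_one,
    Matrix.cons_val_fin_one, RCLike.inner_apply]
  ring

/-- The fields `(ψ₀, ψ₁, φ, (∂ₜ + ∂ₓ) φ, (∂ₜ - ∂ₓ) φ)` of the diagonal first-order system. -/
noncomputable def dkgFields (ψ : ℝ → ℝ → Spinor) (φ : ℝ → ℝ → ℝ) : Fin 5 → ℝ → ℝ → ℂ :=
  ![fun t x => ψ t x 0, fun t x => ψ t x 1, fun t x => (φ t x : ℂ),
    fun t x => ((deriv (fun τ => φ τ x) t + deriv (φ t) x : ℝ) : ℂ),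
    fun t x => ((deriv (fun τ => φ τ x) t - deriv (φ t) x : ℝ) : ℂ)]

theorem IsDKGSolution.isLineSol {M m : ℝ} {ψ₀ : ℝ → Spinor} {φ₀ φ₁ : ℝ → ℝ} {ψ : ℝ → ℝ → Spinor}
    {φ : ℝ → ℝ → ℝ} (h : IsDKGSolution M m ψ₀ φ₀ φ₁ ψ φ) (T : ℝ) :
    IsLineSol T M m (dkgFields ψ φ) := by
  have hψ := isC1_of_contDiff h.smooth_ψ
  have hφ := isC1_of_contDiff h.smooth_φ
  have hφt := isC1_of_contDiff (f := fun t x => deriv (fun τ => φ τ x) t)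
    (contDiff_deriv_fst h.smooth_φ)
  have hφx := isC1_of_contDiff (f := fun t x => deriv (φ t) x) (contDiff_deriv_snd h.smooth_φ)
  let L : Fin 2 → Spinor →L[ℝ] ℂ := fun i =>
    (EuclideanSpace.proj i : Spinor →L[ℂ] ℂ).restrictScalars ℝ
  have comp : ∀ i : Fin 2, IsC1 (fun t x => ψ t x i) (fun t x => (deriv (fun τ => ψ τ x) t) i)
      (fun t x => (deriv (ψ t) x) i) := fun i => by
    exact ⟨(L i).continuous.comp hψ.cont, (L i).continuous.comp hψ.cont_t,
      (L i).continuous.comp hψ.cont_x,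
      fun t x => (L i).hasFDerivAt.comp_hasDerivAt t (hψ.dt t x),
      fun t x => (L i).hasFDerivAt.comp_hasDerivAt x (hψ.dx t x)⟩
  have cplx : ∀ {f ft fx : ℝ → ℝ → ℝ}, IsC1 f ft fx →
      IsC1 (fun t x => (f t x : ℂ)) (fun t x => (ft t x : ℂ)) fun t x => (fx t x : ℂ) := fun h =>
    ⟨Complex.continuous_ofReal.comp h.cont, Complex.continuous_ofReal.comp h.cont_t,
      Complex.continuous_ofReal.comp h.cont_x, fun t x => (h.dt t x).ofReal_comp,
      fun t x => (h.dx t x).ofReal_comp⟩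
  have hp := cplx (hφt.add hφx)
  have hq := cplx (hφt.sub hφx)
  refine ⟨![fun t x => (deriv (fun τ => ψ τ x) t) 0, fun t x => (deriv (fun τ => ψ τ x) t) 1,
    fun t x => ((deriv (fun τ => φ τ x) t : ℝ) : ℂ),
    fun t x => ((deriv (fun τ => deriv (fun τ => φ τ x) τ) t
      + deriv (fun τ => deriv (φ τ) x) t : ℝ) : ℂ),
    fun t x => ((deriv (fun τ => deriv (fun τ => φ τ x) τ) t
      - deriv (fun τ => deriv (φ τ) x) t : ℝ) : ℂ)],
    ![fun t x => (deriv (ψ t) x) 0, fun t x => (deriv (ψ t) x) 1,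
    fun t x => ((deriv (φ t) x : ℝ) : ℂ),
    fun t x => ((deriv (fun y => deriv (fun τ => φ τ y) t) x
      + deriv (fun y => deriv (φ t) y) x : ℝ) : ℂ),
    fun t x => ((deriv (fun y => deriv (fun τ => φ τ y) t) x
      - deriv (fun y => deriv (φ t) y) x : ℝ) : ℂ)], fun j => ?_, fun t _ x j => ?_⟩
  rotate_left
  · have hd := (dirac_iff_diagonal M (φ t x) _ _ _).1 (h.dirac t x)
    have hk := h.kleinGordon t x
    rw [inner_diracGamma0, iteratedDeriv_succ, iteratedDeriv_one, iteratedDeriv_succ,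
      iteratedDeriv_one] at hk
    have hcomm := deriv_deriv_comm h.smooth_φ t x
    push_cast at hk
    fin_cases j
    · simpa [dkgSpeed, dkgTerms, dkgFields] using hd.1
    · simpa [dkgSpeed, dkgTerms, dkgFields, ← sub_eq_add_neg] using hd.2
    · simp [dkgSpeed, dkgTerms, dkgFields]; ring
    · simp [dkgSpeed, dkgTerms, dkgFields]
      rw [hcomm]
      linear_combination hk
    · simp [dkgSpeed, dkgTerms, dkgFields]
      rw [hcomm]
      linear_combination hk
  · fin_cases j
    · exact comp 0
    · exact comp 1
    · exact cplx hφ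
    · exact hp
    · exact hq

/-! ### Global solutions -/

/-- Solutions are determined by their data. The data are attained almost everywhere, hence
everywhere by continuity; those of `∂ₓ φ` follow from those of `φ`. -/
theorem IsDKGSolution.unique {M m : ℝ} {ψ₀ : ℝ → Spinor} {φ₀ φ₁ : ℝ → ℝ} {ψ ψ' : ℝ → ℝ → Spinor}
    {φ φ' : ℝ → ℝ → ℝ} (h : IsDKGSolution M m ψ₀ φ₀ φ₁ ψ φ)
      (h' : IsDKGSolution M m ψ₀ φ₀ φ₁ ψ' φ') :
    ψ = ψ' ∧ φ = φ' := by
  have cline : ∀ {E : Type} [TopologicalSpace E] {f : ℝ × ℝ → E}, Continuous f →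
      Continuous fun x : ℝ => f (0, x) := fun hf => hf.comp (by fun_prop)
  have e1 : ψ 0 = ψ' 0 := ((cline h.smooth_ψ.continuous).ae_eq_iff_eq volume
    (cline h'.smooth_ψ.continuous)).1 (by
      filter_upwards [h.initial_ψ, h'.initial_ψ] with x hx hx'; exact hx.trans hx'.symm)
  have e2 : φ 0 = φ' 0 := ((cline h.smooth_φ.continuous).ae_eq_iff_eq volume
    (cline h'.smooth_φ.continuous)).1 (by
      filter_upwards [h.initial_φ, h'.initial_φ] with x hx hx'; exact hx.trans hx'.symm)
  have e3 : (fun x => deriv (fun τ => φ τ x) 0) = fun x => deriv (fun τ => φ' τ x) 0 :=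
    ((cline (contDiff_deriv_fst h.smooth_φ).continuous).ae_eq_iff_eq volume
      (cline (contDiff_deriv_fst h'.smooth_φ).continuous)).1 (by
      filter_upwards [h.initial_dtφ, h'.initial_dtφ] with x hx hx'; exact hx.trans hx'.symm)
  have key : ∀ t x j, dkgFields ψ φ j t x = dkgFields ψ' φ' j t x := fun t x j => by
    refine (h.isLineSol |t|).unique (h'.isLineSol |t|) (fun j x => ?_) le_rfl x j
    have e3' := congrFun e3 x
    fin_cases j <;> simp [dkgFields, e1, e2, e3']
  constructor
  · funext t x
    ext i
    fin_cases i
    · exact key t x 0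
    · exact key t x 1
  · funext t x
    have := key t x 2
    simpa [dkgFields] using this

theorem IsLineSol.mono {T T' M m : ℝ} {w : Fin 5 → ℝ → ℝ → ℂ} (h : IsLineSol T M m w)
    (hT : T' ≤ T) :
    IsLineSol T' M m w := by
  obtain ⟨wt, wx, hC, he⟩ := h
  exact ⟨wt, wx, hC, fun t ht => he t (ht.trans hT)⟩

/-- The strip solutions for different times `T` fit together to a smooth solution on the plane. -/
theorem exists_global_fields {M m : ℝ} {σ : ℝ → ℝ} (hσ : ∀ T, 1 ≤ T → 0 < σ T) {w₀ : Fin 5 → ℝ → ℂ}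
    {w : ℝ → Fin 5 → ℝ → ℂ → ℂ}
    (hw : ∀ T, 1 ≤ T → DKGStripSol (σ T) T M m (w T 0) (w T 1) (w T 2) (w T 3) (w T 4))
    (h₀ : ∀ T, 1 ≤ T → ∀ j (x : ℝ), w T j 0 x = w₀ j x) :
    ∃ W : Fin 5 → ℝ → ℝ → ℂ, (∀ j, ContDiff ℝ ∞ fun p : ℝ × ℝ => W j p.1 p.2) ∧
      (∀ T, 1 ≤ T → ∀ t, |t| ≤ T → ∀ j (x : ℝ), W j t x = w T j t x) ∧
      ∀ t x j, deriv (fun τ => W j τ x) t + (dkgSpeed j : ℂ) * deriv (W j t) x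
        = dkgTerms M m (fun i => W i t x) j := by
  have hline : ∀ T, 1 ≤ T → IsLineSol T M m fun j t x => w T j t x := fun T hT => by
    have := (hw T hT).isLineSol (hσ T hT)
    convert this using 3 with j
    fin_cases j <;> rfl
  have hpos : ∀ t : ℝ, 1 ≤ |t| + 1 := fun t => by linarith [abs_nonneg t]
  have hcons : ∀ T, 1 ≤ T → ∀ t, |t| ≤ T → ∀ j (x : ℝ), w (|t| + 1) j t x = w T j t x := by
    intro T hT t ht j x
    exact ((hline _ (hpos t)).mono (by linarith)).unique ((hline T hT).mono ht)
      (fun j x => (h₀ _ (hpos t) j x).trans (h₀ T hT j x).symm) le_rfl x j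
  -- the fields are smooth because near each time they agree with one strip solution
  have hsm : ∀ j, ContDiff ℝ ∞ fun p : ℝ × ℝ => w (|p.1| + 1) j p.1 p.2 := by
    intro j
    rw [contDiff_infty]
    intro k
    rw [contDiff_iff_contDiffAt]
    rintro ⟨t, x⟩
    have hT : 1 ≤ |t| + 1 := hpos t
    have hmem : Ioo (-(|t| + 1)) (|t| + 1) ×ˢ (univ : Set ℝ) ∈ 𝓝 (t, x) :=
      (isOpen_Ioo.prod isOpen_univ).mem_nhds ⟨abs_lt.1 (by linarith), mem_univ _⟩
    have hreg : StripReg (σ (|t| + 1)) (|t| + 1) k (w (|t| + 1) j) := by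
      obtain ⟨r0, r1, r2, r3, r4⟩ := (hw _ hT).reg k
      fin_cases j <;> assumption
    refine ((hreg.contDiffOn (hσ _ hT)).contDiffAt hmem).congr_of_eventuallyEq ?_
    filter_upwards [hmem] with p hp
    exact hcons _ hT p.1 (abs_lt.2 hp.1).le j p.2
  refine ⟨fun j t x => w (|t| + 1) j t x, hsm, hcons, fun t x j => ?_⟩
  obtain ⟨wt, wx, hC, he⟩ := hline (|t| + 1) (hpos t)
  have e1 : deriv (fun τ => w (|τ| + 1) j τ x) t = wt j t x := by
    rw [← ((hC j).dt t x).deriv]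
    refine Filter.EventuallyEq.deriv_eq ?_
    filter_upwards [(isOpen_lt continuous_abs continuous_const).mem_nhds
      (by linarith : |t| < |t| + 1)] with τ hτ
    exact hcons _ (hpos t) τ (le_of_lt hτ) j x
  rw [e1, ((hC j).dx t x).deriv]
  exact he t (by linarith) x j

/-- Passage from the fields of the first-order system to the original unknowns. -/
theorem isDKGSolution_of_fields {M m : ℝ} {ψ₀ : ℝ → Spinor} {φ₀ φ₁ : ℝ → ℝ}
    {W : Fin 5 → ℝ → ℝ → ℂ} (hW : ∀ j, ContDiff ℝ ∞ fun p : ℝ × ℝ => W j p.1 p.2)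
    (he : ∀ t x j, deriv (fun τ => W j τ x) t + (dkgSpeed j : ℂ) * deriv (W j t) x
        = dkgTerms M m (fun i => W i t x) j)
    (hc : ∀ t x, deriv (W 2 t) x = (1 / 2 : ℂ) * (W 3 t x - W 4 t x))
    (hreal : ∀ t x, (starRingEnd ℂ) (W 2 t x) = W 2 t x)
    (i1 : ∀ᵐ x, W 0 0 x = ψ₀ x 0 ∧ W 1 0 x = ψ₀ x 1) (i2 : ∀ᵐ x, W 2 0 x = φ₀ x)
    (i3 : ∀ᵐ x, (1 / 2 : ℂ) * (W 3 0 x + W 4 0 x) = φ₁ x) :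
    IsDKGSolution M m ψ₀ φ₀ φ₁ (fun t x => !₂[W 0 t x, W 1 t x]) (fun t x => (W 2 t x).re) ∧
      ∀ t x, ((deriv (fun τ => (W 2 τ x).re) t : ℝ) : ℂ) = (1 / 2 : ℂ) * (W 3 t x + W 4 t x) := by
  have hC := fun j => isC1_of_contDiff (hW j)
  have hre : ∀ t x, (((W 2 t x).re : ℝ) : ℂ) = W 2 t x := fun t x =>
    Complex.conj_eq_iff_re.1 (hreal t x)
  have reD : ∀ {f : ℝ → ℂ} {f' : ℂ} {t : ℝ}, HasDerivAt f f' t →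
      HasDerivAt (fun t => (f t).re) f'.re t := fun h =>
    Complex.reCLM.hasFDerivAt.comp_hasDerivAt _ h
  have ht : ∀ t x, HasDerivAt (fun τ => W 2 τ x) ((1 / 2 : ℂ) * (W 3 t x + W 4 t x)) t :=
    fun t x => by
    have h1 := (hC 2).dt t x
    have h2 := he t x 2
    simp only [dkgSpeed, dkgTerms, Matrix.cons_val, Complex.ofReal_zero, zero_mul, add_zero] at h2
    rwa [h2] at h1
  have hx : ∀ t x, HasDerivAt (W 2 t) ((1 / 2 : ℂ) * (W 3 t x - W 4 t x)) x := fun t x => by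
    rw [← hc]; exact (hC 2).dx t x
  have ofre : ∀ {f : ℝ → ℂ} {f' : ℂ} {s : ℝ}, (∀ s, (((f s).re : ℝ) : ℂ) = f s)
    → HasDerivAt f f' s →
      ((f'.re : ℝ) : ℂ) = f' := fun {f f' s} hf h => by
    have h1 := (reD h).ofReal_comp
    rw [funext hf] at h1
    exact h1.unique h
  have hφt : ∀ t x, ((deriv (fun τ => (W 2 τ x).re) t : ℝ) : ℂ)
      = (1 / 2 : ℂ) * (W 3 t x + W 4 t x) := fun t x => by
    rw [(reD (ht t x)).deriv]
    exact ofre (fun s => hre s x) (ht t x)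
  have sψ : ContDiff ℝ ∞ fun p : ℝ × ℝ => (!₂[W 0 p.1 p.2, W 1 p.1 p.2] : Spinor) := by
    rw [contDiff_piLp]
    intro i
    fin_cases i
    · exact hW 0
    · exact hW 1
  refine ⟨⟨sψ, Complex.reCLM.contDiff.comp (hW 2), fun t x => ?_, fun t x => ?_, ?_, ?_, ?_⟩, hφt⟩
  · rw [dirac_iff_diagonal]
    have dψ : ∀ {a b : ℝ → ℂ} {a' b' : ℂ} {s : ℝ}, HasDerivAt a a' s → HasDerivAt b b' s →
        deriv (fun s => (!₂[a s, b s] : Spinor)) s = !₂[a', b'] := by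
      intro a b a' b' s ha hb
      refine HasDerivAt.deriv ?_
      have hab : HasDerivAt (fun s => ![a s, b s]) ![a', b'] s := by
        rw [hasDerivAt_pi]
        intro i
        fin_cases i
        · exact ha
        · exact hb
      exact (PiLp.hasFDerivAt_toLp (𝕜 := ℝ) 2 ![a s, b s]).comp_hasDerivAt s hab
    rw [dψ ((hC 0).dt t x) ((hC 1).dt t x), dψ ((hC 0).dx t x) ((hC 1).dx t x), hre]
    have h0 := he t x 0
    have h1 := he t x 1
    simp only [dkgSpeed, dkgTerms, Matrix.cons_val] at h0 h1
    constructor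
    · simpa using h0
    · simpa [← sub_eq_add_neg] using h1
  · have eT : deriv (fun τ => (W 2 τ x).re) = fun t => ((1 / 2 : ℂ) * (W 3 t x + W 4 t x)).re :=
      funext fun t => (reD (ht t x)).deriv
    have eX : deriv (fun y => (W 2 t y).re) = fun y => ((1 / 2 : ℂ) * (W 3 t y - W 4 t y)).re :=
      funext fun y => (reD (hx t y)).deriv
    have dT : HasDerivAt (fun t => (1 / 2 : ℂ) * (W 3 t x + W 4 t x)) _ t :=
      (((hC 3).dt t x).add ((hC 4).dt t x)).const_mul (1 / 2 : ℂ)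
    have dX : HasDerivAt (fun y => (1 / 2 : ℂ) * (W 3 t y - W 4 t y)) _ x :=
      (((hC 3).dx t x).sub ((hC 4).dx t x)).const_mul (1 / 2 : ℂ)
    have rT := ofre (fun s => ofre (fun r => hre r x) (ht s x)) dT
    have rX := ofre (fun y => ofre (fun r => hre t r) (hx t y)) dX
    rw [inner_diracGamma0, iteratedDeriv_succ, iteratedDeriv_one, iteratedDeriv_succ,
      iteratedDeriv_one,
      eT, eX]
    have d1 := (reD dT).deriv
    have d2 := (reD dX).deriv
    rw [d1, d2]
    push_cast
    rw [rT, rX, hre]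
    have h3 := he t x 3
    have h4 := he t x 4
    simp only [dkgSpeed, dkgTerms, Matrix.cons_val] at h3 h4
    push_cast at h3 h4
    change _ = (starRingEnd ℂ) (W 0 t x) * W 1 t x + (starRingEnd ℂ) (W 1 t x) * W 0 t x
    linear_combination (1 / 2 : ℂ) * h3 + (1 / 2 : ℂ) * h4
  · filter_upwards [i1] with x hx
    ext i
    fin_cases i
    · exact hx.1
    · exact hx.2
  · filter_upwards [i2] with x hx
    rw [hx, Complex.ofReal_re]
  · filter_upwards [i3] with x hx
    have := (hφt 0 x).trans hx
    exact_mod_cast this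

/-! ### Extension of the data -/

section Data
variable {σ : ℝ}

/-- A holomorphic function in the strip with real values on the real line is symmetric under
reflection. -/
theorem conj_symm_of_real {f : ℂ → ℂ} (hf : DifferentiableOn ℂ f (strip σ))
    (h : ∀ᵐ x : ℝ, (f x).im = 0) {z : ℂ} (hz : z ∈ strip σ) :
    (starRingEnd ℂ) (f ((starRingEnd ℂ) z)) = f z := by
  have hσ : 0 < σ := (abs_nonneg _).trans_lt hz
  have hr : ∀ x : ℝ, (x : ℂ) ∈ strip σ := fun x => by simpa [strip] using hσ
  have hc : Continuous fun x : ℝ => f x :=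
    hf.continuousOn.comp_continuous Complex.continuous_ofReal hr
  have him : (fun x : ℝ => (f x).im) = fun _ => 0 :=
    ((Complex.continuous_im.comp hc).ae_eq_iff_eq volume continuous_const).1 h
  have h1 : DifferentiableOn ℂ (conjRefl (fun _ => f) 0) (strip σ) :=
    (StripHol.conjRefl (σ := σ) (f := fun _ => f)
      ⟨hf.continuousOn.comp continuousOn_snd fun p hp => hp.2, fun _ => hf⟩).hol 0
  have h2 := AnalyticOnNhd.eqOn_of_preconnected_of_frequently_eq
    (h1.analyticOnNhd (isOpen_strip σ)) (hf.analyticOnNhd (isOpen_strip σ))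
    (convex_strip σ).isPreconnected (z₀ := 0) (by simpa using hr 0) (by
      have ht : Tendsto (fun x : ℝ => (x : ℂ)) (𝓝[≠] 0) (𝓝[≠] 0) := by
        refine tendsto_nhdsWithin_iff.2 ⟨?_, ?_⟩
        · exact (Complex.continuous_ofReal.tendsto' 0 0 (by simp)).mono_left nhdsWithin_le_nhds
        · filter_upwards [self_mem_nhdsWithin] with x hx
          simpa using hx
      refine ht.frequently (Eventually.frequently (Eventually.of_forall fun x => ?_))
      simp only [conjRefl, Complex.conj_ofReal]
      exact Complex.conj_eq_iff_im.2 (congrFun him x))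
  exact h2 hz

theorem deriv_conj_symm {f : ℂ → ℂ} (hf : DifferentiableOn ℂ f (strip σ))
    (h : ∀ z ∈ strip σ, (starRingEnd ℂ) (f ((starRingEnd ℂ) z)) = f z) {z : ℂ} (hz : z ∈ strip σ) :
    (starRingEnd ℂ) (deriv f ((starRingEnd ℂ) z)) = deriv f z := by
  have h1 := (hf.differentiableAt
    ((isOpen_strip σ).mem_nhds (conj_mem_strip hz))).hasDerivAt.conj_conj
  rw [Complex.conj_conj] at h1
  refine (h1.congr_of_eventuallyEq ?_).deriv.symm
  filter_upwards [(isOpen_strip σ).mem_nhds hz] with w hw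
  exact (h w hw).symm

theorem DKGData.mono {σ' D : ℝ} {u₀ v₀ φ₀ p₀ q₀ : ℂ → ℂ} (h : DKGData σ D u₀ v₀ φ₀ p₀ q₀)
    (hσ : σ' ≤ σ) : DKGData σ' D u₀ v₀ φ₀ p₀ q₀ := by
  have hs : strip σ' ⊆ strip σ := fun _ hz => lt_of_lt_of_le hz hσ
  exact ⟨h.hu.mono hs, h.hv.mono hs, h.hφ.mono hs, h.hp.mono hs, h.hq.mono hs,
    fun z hz => h.bu z (hs hz), fun z hz => h.bv z (hs hz), fun z hz => h.bφ z (hs hz),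
    fun z hz => h.bp z (hs hz), fun z hz => h.bq z (hs hz), fun z hz => h.sφ z (hs hz),
    fun z hz => h.sp z (hs hz), fun z hz => h.sq z (hs hz), fun z hz => h.compat z (hs hz),
    fun y hy => h.charge y (hy.trans_le hσ), fun y hy => h.energy y (hy.trans_le hσ)⟩

theorem intervalIntegral_le_of_le {h g : ℝ → ℝ} (h0 : ∀ x, 0 ≤ h x) (hh : Continuous h)
    (hg : Integrable g) (hle : ∀ x, h x ≤ g x) {C : ℝ} (hC : ∫ x, g x ≤ C) {a b : ℝ} (hab : a ≤ b) :
    ∫ x in a..b, h x ≤ C := by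
  have hi : Integrable h := hg.mono' hh.aestronglyMeasurable
    (Eventually.of_forall fun x => by rw [Real.norm_of_nonneg (h0 x)]; exact hle x)
  rw [intervalIntegral.integral_of_le hab]
  exact ((setIntegral_le_integral hi (Eventually.of_forall h0)).trans
    (integral_mono hi hg hle)).trans hC

/-- Data in the Gevrey spaces extend to the strip, with bounds in terms of their norms. -/
theorem exists_dkgData {σ₀ : ℝ} (hσ₀ : 0 < σ₀) (r s R : ℝ) : ∃ D : ℝ, 0 ≤ D ∧
    ∀ (ψ₀ : ℝ → Spinor) (φ₀ φ₁ : ℝ → ℝ), MemGevrey σ₀ s ψ₀ → MemGevrey σ₀ r (complexify φ₀) →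
      MemGevrey σ₀ (r - 1) (complexify φ₁) →
      gevreyNorm σ₀ s ψ₀ + gevreyNorm σ₀ r (complexify φ₀)
        + gevreyNorm σ₀ (r - 1) (complexify φ₁) ≤ R →
      ∃ u₀ v₀ f₀ p₀ q₀ : ℂ → ℂ, DKGData (σ₀ / 2) D u₀ v₀ f₀ p₀ q₀ ∧
        (∀ᵐ x : ℝ, u₀ x = ψ₀ x 0 ∧ v₀ x = ψ₀ x 1) ∧ (∀ᵐ x : ℝ, f₀ x = φ₀ x) ∧
        ∀ᵐ x : ℝ, (1 / 2 : ℂ) * (p₀ x + q₀ x) = φ₁ x := by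
  have hσ₁ : 0 < σ₀ / 2 := by linarith
  have hσ₁' : σ₀ / 2 < σ₀ := by linarith
  have hnn : ∀ {F : Type} [NormedAddCommGroup F] [InnerProductSpace ℂ F] [CompleteSpace F]
      (s : ℝ) (f : ℝ → F), 0 ≤ gevreyNorm σ₀ s f := fun s f => by
    rw [gevreyNorm]; split_ifs <;> positivity
  obtain ⟨D₁, hD₁, H₁⟩ := MemGevrey.exists_extension (F := Spinor) hσ₁ hσ₁' s R
  obtain ⟨D₂, hD₂, H₂⟩ := MemGevrey.exists_extension (F := ℂ) hσ₁ hσ₁' r R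
  obtain ⟨D₃, hD₃, H₃⟩ := MemGevrey.exists_extension (F := ℂ) hσ₁ hσ₁' (r - 1) R
  refine ⟨D₁ + 5 * D₂ + 4 * D₃, by positivity, fun ψ₀ φ₀ φ₁ m1 m2 m3 hR => ?_⟩
  have n1 := hnn s ψ₀
  have n2 := hnn r (complexify φ₀)
  have n3 := hnn (r - 1) (complexify φ₁)
  obtain ⟨g, hg, ag, bg, lg⟩ := H₁ ψ₀ m1 (by linarith)
  obtain ⟨f, hf, af, bf, lf⟩ := H₂ _ m2 (by linarith)
  obtain ⟨e, he, ae, be, le⟩ := H₃ _ m3 (by linarith)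
  have hf' := hf.deriv (isOpen_strip _)
  have sf : ∀ z ∈ strip (σ₀ / 2), (starRingEnd ℂ) (f ((starRingEnd ℂ) z)) = f z := fun z hz =>
    conj_symm_of_real hf (by filter_upwards [af] with x hx; simp [hx, complexify]) hz
  have se : ∀ z ∈ strip (σ₀ / 2), (starRingEnd ℂ) (e ((starRingEnd ℂ) z)) = e z := fun z hz =>
    conj_symm_of_real he (by filter_upwards [ae] with x hx; simp [hx, complexify]) hz
  have sf' := fun z (hz : z ∈ strip (σ₀ / 2)) => deriv_conj_symm hf sf hz
  have cl : ∀ {F : Type} [NormedAddCommGroup F] [NormedSpace ℂ F] {w : ℂ → F} {y : ℝ},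
      DifferentiableOn ℂ w (strip (σ₀ / 2)) → |y| < σ₀ / 2 →
      Continuous fun x : ℝ => ‖w (x + y * Complex.I)‖ ^ 2 := fun hw hy =>
    (hw.continuousOn.comp_continuous (by fun_prop) fun x => line_mem_strip hy x).norm.pow 2
  have hg2 : ∀ z, ‖g z‖ ^ 2 = ‖g z 0‖ ^ 2 + ‖g z 1‖ ^ 2 := fun z => by
    rw [EuclideanSpace.norm_sq_eq, Fin.sum_univ_two]
  have hgi : ∀ z i, ‖g z i‖ ≤ ‖g z‖ := fun z i => PiLp.norm_apply_le (g z) i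
  have hg0 : ∀ i, DifferentiableOn ℂ (fun z => g z i) (strip (σ₀ / 2)) := fun i =>
    (differentiableOn_piLp 2).1 hg i
  refine ⟨fun z => g z 0, fun z => g z 1, f, fun z => e z + deriv f z, fun z => e z - deriv f z,
    ⟨hg0 0, hg0 1, hf, he.add hf', he.sub hf',
      fun z hz => ?_, fun z hz => ?_, fun z hz => ?_, fun z hz => ?_, fun z hz => ?_, sf,
      fun z hz => ?_, fun z hz => ?_, fun z hz => ?_, fun y hy a b hab => ?_,
      fun y hy a b hab => ?_⟩, ?_, ?_, ?_⟩
  · exact (hgi z 0).trans ((bg z hz).1.trans (by linarith))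
  · exact (hgi z 1).trans ((bg z hz).1.trans (by linarith))
  · exact (bf z hz).1.trans (by linarith)
  · exact (norm_add_le _ _).trans (by linarith [(be z hz).1, (bf z hz).2])
  · exact (norm_sub_le _ _).trans (by linarith [(be z hz).1, (bf z hz).2])
  · rw [map_add, se z hz, sf' z hz]
  · rw [map_sub, se z hz, sf' z hz]
  · ring
  · exact intervalIntegral_le_of_le
      (h := fun x => ‖g (x + y * Complex.I) 0‖ ^ 2 + ‖g (x + y * Complex.I) 1‖ ^ 2)
      (fun x => by positivity) ((cl (hg0 0) hy).add (cl (hg0 1) hy))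
      (lg y hy).1.1 (fun x => (hg2 _).ge) ((lg y hy).1.2.trans (by linarith)) hab
  · obtain ⟨⟨i1, j1⟩, i2, j2⟩ := lf y hy
    obtain ⟨⟨i3, j3⟩, -⟩ := le y hy
    have hI := (i1.add (i3.const_mul 4)).add (i2.const_mul 4)
    have hle : ∀ z, ‖f z‖ ^ 2 + ‖e z + deriv f z‖ ^ 2 + ‖e z - deriv f z‖ ^ 2
        ≤ ‖f z‖ ^ 2 + 4 * ‖e z‖ ^ 2 + 4 * ‖deriv f z‖ ^ 2 := fun z => by
      have h1 : ‖e z + deriv f z‖ ^ 2 ≤ (‖e z‖ + ‖deriv f z‖) ^ 2 := by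
        gcongr; exact norm_add_le _ _
      have h2 : ‖e z - deriv f z‖ ^ 2 ≤ (‖e z‖ + ‖deriv f z‖) ^ 2 := by
        gcongr; exact norm_sub_le _ _
      nlinarith [sq_nonneg (‖e z‖ - ‖deriv f z‖)]
    refine intervalIntegral_le_of_le
      (h := fun x => ‖f (x + y * Complex.I)‖ ^ 2
        + ‖e (x + y * Complex.I) + deriv f (x + y * Complex.I)‖ ^ 2
        + ‖e (x + y * Complex.I) - deriv f (x + y * Complex.I)‖ ^ 2) (fun x => by positivity)
      (((cl hf hy).add (cl (he.add hf') hy)).add (cl (he.sub hf') hy)) hI (fun x => hle _) ?_ hab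
    · have e1 := integral_add (i1.add (i3.const_mul 4)) (i2.const_mul 4)
      have e2 := integral_add i1 (i3.const_mul 4)
      rw [integral_const_mul] at e1 e2
      refine e1.le.trans ?_
      refine (add_le_add_left e2.le _).trans ?_
      linarith
  · filter_upwards [ag] with x hx
    simp [hx]
  · exact af
  · filter_upwards [ae] with x hx
    have : (e x : ℂ) = φ₁ x := hx
    rw [← this]; ring

end Data

/-! ### Gevrey regularity of the solution -/

section Final

theorem integrable_of_intervalIntegral_le {h : ℝ → ℝ} (h0 : ∀ x, 0 ≤ h x) (hh : Continuous h)
    {C : ℝ}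
    (hC : ∀ a b : ℝ, a ≤ b → ∫ x in a..b, h x ≤ C) : Integrable h ∧ ∫ x, h x ≤ C := by
  have ha : Tendsto (fun n : ℕ => -(n : ℝ)) atTop atBot :=
    tendsto_neg_atTop_atBot.comp tendsto_natCast_atTop_atTop
  have hb : Tendsto (fun n : ℕ => (n : ℝ)) atTop atTop := tendsto_natCast_atTop_atTop
  have hn : ∀ n : ℕ, -(n : ℝ) ≤ n := fun n => by linarith [n.cast_nonneg (α := ℝ)]
  have hi : Integrable h := integrable_of_intervalIntegral_norm_bounded C
    (fun n => (hh.integrableOn_Icc).mono_set Ioc_subset_Icc_self) ha hb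
    (Eventually.of_forall fun n => by
      simp only [Real.norm_of_nonneg (h0 _)]
      exact hC _ _ (hn n))
  exact ⟨hi, le_of_tendsto' (intervalIntegral_tendsto_integral hi ha hb) fun n => hC _ _ (hn n)⟩

/-- Everything that is controlled by the fields of a strip solution is in the Gevrey spaces. -/
theorem DKGStripSol.memGevrey {σ σ' T M m t : ℝ} {u v φ p q : ℝ → ℂ → ℂ} (hσ : 0 < σ) (hσ' : σ' < σ)
    (h : DKGStripSol σ T M m u v φ p q) (ht : |t| ≤ T) (s : ℝ) {F : Type*} [NormedAddCommGroup F]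
    [InnerProductSpace ℂ F] [CompleteSpace F] {g : ℂ → F} (hg : DifferentiableOn ℂ g (strip σ))
    (hle : ∀ z ∈ strip σ, ‖g z‖ ^ 2 ≤ ‖u t z‖ ^ 2 + ‖v t z‖ ^ 2 + ‖φ t z‖ ^ 2 + ‖p t z‖ ^ 2
      + ‖q t z‖ ^ 2) : MemGevrey σ' s fun x : ℝ => g x := by
  obtain ⟨B, hB⟩ := h.bdd
  obtain ⟨C, hC⟩ := h.energy
  refine memGevrey_of_strip (B := 3 * B) (C := C) hσ hσ' s hg (fun z hz => ?_) fun y hy => ?_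
  · obtain ⟨h1, h2, h3, h4, h5⟩ := hB t ht z hz
    have hB0 : 0 ≤ B := (norm_nonneg _).trans h1
    refine le_of_sq_le_sq ?_ (by positivity)
    refine (hle z hz).trans ?_
    have hsq : ∀ {a : ℝ}, 0 ≤ a → a ≤ B → a ^ 2 ≤ B ^ 2 := fun ha hb => pow_le_pow_left₀ ha hb 2
    have := hsq (norm_nonneg _) h1
    have := hsq (norm_nonneg _) h2
    have := hsq (norm_nonneg _) h3
    have := hsq (norm_nonneg _) h4
    have := hsq (norm_nonneg _) h5
    nlinarith [sq_nonneg B]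
  · have cl : ∀ {w : ℝ → ℂ → ℂ}, StripHol σ w → Continuous fun x : ℝ =>
      ‖w t (x + y * Complex.I)‖ ^ 2 :=
      fun hw => (hw.comp_cont continuous_const (by fun_prop) fun x =>
        line_mem_strip hy x).norm.pow 2
    refine integrable_of_intervalIntegral_le (h := fun x : ℝ => ‖g (x + y * Complex.I)‖ ^ 2)
      (fun x => by positivity)
      ((hg.continuousOn.comp_continuous (by fun_prop) fun x => line_mem_strip hy x).norm.pow 2)
      fun a b hab => ?_
    refine le_trans ?_ (hC t ht y hy a b hab)
    refine intervalIntegral.integral_mono hab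
      (((hg.continuousOn.comp_continuous (by fun_prop)
        fun x => line_mem_strip hy x).norm.pow 2).intervalIntegrable _ _)
      (((((cl h.hu).add (cl h.hv)).add (cl h.hφ)).add (cl h.hp)).add
        (cl h.hq) |>.intervalIntegrable _ _)
      fun x => hle _ (line_mem_strip hy x)

end Final

theorem theorem1 (M m : ℝ) (hM : 0 ≤ M) (hm : 0 ≤ m) (σ₀ : ℝ) (hσ₀ : 0 < σ₀) (r s : ℝ)
    (R : ℝ) :
    ∃ c T₀ : ℝ, 0 < c ∧ 0 < T₀ ∧
      ∀ (ψ₀ : ℝ → Spinor) (φ₀ φ₁ : ℝ → ℝ),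
        MemGevrey σ₀ s ψ₀ →
        MemGevrey σ₀ r (complexify φ₀) →
        MemGevrey σ₀ (r - 1) (complexify φ₁) →
        gevreyNorm σ₀ s ψ₀ + gevreyNorm σ₀ r (complexify φ₀)
          + gevreyNorm σ₀ (r - 1) (complexify φ₁) ≤ R →
        (∃! u : (ℝ → ℝ → Spinor) × (ℝ → ℝ → ℝ), IsDKGSolution M m ψ₀ φ₀ φ₁ u.1 u.2) ∧
        ∀ (ψ : ℝ → ℝ → Spinor) (φ : ℝ → ℝ → ℝ), IsDKGSolution M m ψ₀ φ₀ φ₁ ψ φ →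
          ∃ σ : ℝ → ℝ,
            (∀ t : ℝ, 0 < σ t ∧
              MemGevrey (σ t) s (ψ t) ∧
              MemGevrey (σ t) r (complexify (φ t)) ∧
              MemGevrey (σ t) (r - 1) (complexify (fun x => deriv (fun τ => φ τ x) t))) ∧
            ∀ t : ℝ, T₀ ≤ |t| → c / t ^ 4 ≤ σ t := by
  obtain ⟨D, hD, hdata⟩ := exists_dkgData hσ₀ r s R
  obtain ⟨c₀, hc₀, hex⟩ := exists_dkgStripSol M m hD
  -- the strip must be narrow enough for the solution, and lie in the domain of the data
  set c : ℝ := min c₀ (σ₀ / 2) with hc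
  have hc0 : 0 < c := lt_min hc₀ (by linarith)
  refine ⟨c / 32, 1, by positivity, one_pos, fun ψ₀ φ₀ φ₁ m1 m2 m3 hR => ?_⟩
  obtain ⟨u₀, v₀, f₀, p₀, q₀, hd, a1, a2, a3⟩ := hdata ψ₀ φ₀ φ₁ m1 m2 m3 hR
  have hσT : ∀ T : ℝ, 1 ≤ T → 0 < c / T ^ 4 := fun T hT => by
    have : 0 < T := by linarith
    positivity
  have hsol : ∀ T : ℝ, 1 ≤ T → ∃ w : Fin 5 → ℝ → ℂ → ℂ,
      DKGStripSol (c / T ^ 4) T M m (w 0) (w 1) (w 2) (w 3) (w 4) ∧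
      ∀ j (x : ℝ), w j 0 x = (![u₀, v₀, f₀, p₀, q₀] : Fin 5 → ℂ → ℂ) j x := fun T hT => by
    have hT4 : 1 ≤ T ^ 4 := one_le_pow₀ hT
    have hle : c / T ^ 4 ≤ σ₀ / 2 := (div_le_self hc0.le hT4).trans (min_le_right _ _)
    obtain ⟨u, v, φ, p, q, hs, hi⟩ := hex T (c / T ^ 4) hT (hσT T hT)
      (by gcongr; exact min_le_left _ _) u₀ v₀ f₀ p₀ q₀ (hd.mono hle)
    refine ⟨![u, v, φ, p, q], hs, fun j x => ?_⟩
    have hx : (x : ℂ) ∈ strip (c / T ^ 4) := by simpa [strip] using hσT T hT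
    obtain ⟨h1, h2, h3, h4, h5⟩ := hi x hx
    fin_cases j <;> assumption
  choose! w hw hw₀ using hsol
  obtain ⟨W, hW, hWw, he⟩ := exists_global_fields hσT
    (w₀ := fun j x => (![u₀, v₀, f₀, p₀, q₀] : Fin 5 → ℂ → ℂ) j x) hw hw₀
  -- at time `t` the solution is read off from the strip solution for `T = |t| + 1`
  have hpos : ∀ t : ℝ, 1 ≤ |t| + 1 := fun t => by linarith [abs_nonneg t]
  have hWt : ∀ t j (x : ℝ), W j t x = w (|t| + 1) j t x := fun t j x =>
    hWw _ (hpos t) t (by linarith) j x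
  have hr : ∀ t x : ℝ, (x : ℂ) ∈ strip (c / (|t| + 1) ^ 4) := fun t x => by
    simpa [strip] using hσT _ (hpos t)
  have hW0 : ∀ j (x : ℝ), W j 0 x = (![u₀, v₀, f₀, p₀, q₀] : Fin 5 → ℂ → ℂ) j x := fun j x => by
    rw [hWt, hw₀ _ (hpos 0)]
  obtain ⟨hS, hφt⟩ := isDKGSolution_of_fields hW he
    (fun t x => by
      have hs := hw _ (hpos t)
      have h1 := (hs.hφ.differentiableAt t (hr t x)).hasDerivAt.comp_ofReal
      rw [hs.dx_φ t (by linarith) _ (hr t x)] at h1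
      rw [hWt, hWt, ← h1.deriv]
      congr 1
      funext y
      exact hWt t 2 y)
    (fun t x => by
      have := (hw _ (hpos t)).symm t (by linarith) _ (hr t x)
      rw [hWt]
      simpa [conjRefl] using this)
    (by filter_upwards [a1] with x hx; rw [hW0, hW0]; exact hx)
    (by filter_upwards [a2] with x hx; rw [hW0]; exact hx)
    (by filter_upwards [a3] with x hx; rw [hW0, hW0]; exact hx)
  refine ⟨⟨(_, _), hS, fun u hu => ?_⟩, fun ψ φ hψφ => ?_⟩
  · obtain ⟨h1, h2⟩ := hu.unique hS
    exact Prod.ext h1 h2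
  · obtain ⟨rfl, rfl⟩ := hψφ.unique hS
    -- half the width of the strip: the Gevrey index `s` costs a part of the radius
    refine ⟨fun t => c / (|t| + 1) ^ 4 / 2, fun t => ?_, fun t ht => ?_⟩
    · have hσ := hσT _ (hpos t)
      have hs := hw _ (hpos t)
      have hlt : |t| ≤ |t| + 1 := by linarith
      have hhalf := half_lt_self hσ
      refine ⟨by positivity, ?_, ?_, ?_⟩
      · have := hs.memGevrey hσ hhalf hlt s
          (g := fun z => (!₂[w (|t| + 1) 0 t z, w (|t| + 1) 1 t z] : Spinor))
          ((differentiableOn_piLp 2).2 fun i => by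
            fin_cases i
            · exact hs.hu.hol t
            · exact hs.hv.hol t)
          (fun z _ => by
            rw [EuclideanSpace.norm_sq_eq, Fin.sum_univ_two]
            simp only [Matrix.cons_val_zero, Matrix.cons_val_one]
            have : 0 ≤ ‖w (|t| + 1) 2 t z‖ ^ 2 + ‖w (|t| + 1) 3 t z‖ ^ 2
              + ‖w (|t| + 1) 4 t z‖ ^ 2 := by positivity
            linarith)
        simpa only [hWt] using this
      · have := hs.memGevrey hσ hhalf hlt r (g := w (|t| + 1) 2 t) (hs.hφ.hol t)
          (fun z _ => by
            have : 0 ≤ ‖w (|t| + 1) 0 t z‖ ^ 2 + ‖w (|t| + 1) 1 t z‖ ^ 2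
              + ‖w (|t| + 1) 3 t z‖ ^ 2 + ‖w (|t| + 1) 4 t z‖ ^ 2 := by positivity
            linarith)
        convert this using 1
        funext x
        have h3 := (hw _ (hpos t)).symm t hlt _ (hr t x)
        simp only [complexify, hWt]
        exact Complex.conj_eq_iff_re.1 (by simpa [conjRefl] using h3)
      · have := hs.memGevrey hσ hhalf hlt (r - 1)
          (g := fun z => (1 / 2 : ℂ) * (w (|t| + 1) 3 t z + w (|t| + 1) 4 t z))
          (((hs.hp.add hs.hq).const_mul _).hol t)
          (fun z _ => by
            have h2 : ‖(1 / 2 : ℂ)‖ = 1 / 2 := by norm_num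
            rw [norm_mul, h2, mul_pow]
            have h3 : ‖w (|t| + 1) 3 t z + w (|t| + 1) 4 t z‖ ^ 2
                ≤ (‖w (|t| + 1) 3 t z‖ + ‖w (|t| + 1) 4 t z‖) ^ 2 := by
              gcongr; exact norm_add_le _ _
            nlinarith [sq_nonneg (‖w (|t| + 1) 3 t z‖ - ‖w (|t| + 1) 4 t z‖),
              sq_nonneg ‖w (|t| + 1) 0 t z‖, sq_nonneg ‖w (|t| + 1) 1 t z‖,
              sq_nonneg ‖w (|t| + 1) 2 t z‖])
        convert this using 1
        funext x
        rw [complexify, hφt, hWt, hWt]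
    -- `(|t| + 1)⁴ ≤ 16 t⁴` for `|t| ≥ 1`, and the factor `1 / 2`, give `c / 32`
    · have h1 : (|t| + 1) ^ 4 ≤ 16 * t ^ 4 := by
        have h2 : (|t| + 1) ^ 4 ≤ (2 * |t|) ^ 4 := by gcongr; linarith
        have h3 : (2 * |t|) ^ 4 = 16 * t ^ 4 := by
          rw [mul_pow, (by decide : Even 4).pow_abs]; norm_num
        exact h2.trans h3.le
      have h4 : 0 < (|t| + 1) ^ 4 := by positivity
      change c / 32 / t ^ 4 ≤ c / (|t| + 1) ^ 4 / 2
      rw [div_div, div_div]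
      exact div_le_div_of_nonneg_left hc0.le (by positivity) (by linarith)
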